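/- Let $(\Sigma,g)$ be a compact smooth Riemannian manifold without boundary of dimension $d\ge 1$ (for instance a compact Riemannian surface), with its Riemannian volume, and let $\lambda>0$, $\mu\in\mathbb{R}$ and $0<T<\infty$. Consider the equation $$ i\,\partial_t u+\Delta u+i\lambda\,u\,\zeta(|u|+1)+\mu\,u\log|u|=0 \quad\text{on } (0,T)\times\Sigma, \tag{E} $$ where $\zeta$ is the Riemann zeta function and $u\,\zeta(|u|+1)$ and $u\log|u|$ are taken to be $0$ where $u=0$. A function $u\in L^\infty(0,T;H^1(\Sigma))$ is a distributional solution of (E) if for all $\varphi\in C_c^\infty((0,T);\mathbb{R})$ and $\psi\in C^\infty(\Sigma;\mathbb{C})$ $$ \int_0^T\Big[-i\,\varphi'(t)\,(u(t),\psi)_2-\varphi(t)\,(\nabla u(t),\nabla\psi)_2+\varphi(t)\,\big(i\lambda\,u\,\zeta(|u|+1)+\mu\,u\log|u|,\ \psi\big)_2\Big]dt=0, $$ where $(\cdot,\cdot)_2$ is the $L^2(\Sigma)$ Hermitian product. **Proposition (Uniqueness).** Let $u_1,u_2\in L^\infty(0,T;H^1(\Sigma))$ be two distributional solutions of (E). Then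 each $u_j$ agrees, for almost every $t\in(0,T)$, with a (necessarily unique) function in $C([0,T];L^2(\Sigma))$, still denoted $u_j$; in particular the initial value $u_j(0)$ is well defined in $L^2(\Sigma)$. With $w=u_1-u_2$, $$ \|w(t)\|_{L^2(\Sigma)}\le e^{|\mu|t}\,\|w(0)\|_{L^2(\Sigma)}\qquad\text{for all } t\in[0,T]. $$ Hence, if $u_1(0)=u_2(0)$, then $u_1(t)=u_2(t)$ for all $t\in[0,T]$, and $u_1=u_2$ almost everywhere on $(0,T)\times\Sigma$. -/

import Mathlib

open Set Filter Topology MeasureTheory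
open scoped Manifold ContDiff ENNReal NNReal ComplexConjugate

noncomputable section

namespace ZetaLogNLS

/-- The model space `ℝ^d` with its Euclidean norm. -/
abbrev Model (d : ℕ) : Type := EuclideanSpace ℝ (Fin d)

/-- Smooth Riemannian metrics on a `d`-dimensional manifold `M` without boundary. -/
abbrev SmoothMetric (d : ℕ) (M : Type*) [TopologicalSpace M] [ChartedSpace (Model d) M]
    [IsManifold 𝓘(ℝ, Model d) ∞ M] : Type _ :=
  Bundle.ContMDiffRiemannianMetric 𝓘(ℝ, Model d) ∞ (Model d)
    (fun x : M => TangentSpace 𝓘(ℝ, Model d) x)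

section Geometry

variable {d : ℕ} {M : Type*} [TopologicalSpace M] [ChartedSpace (Model d) M]
  [IsManifold 𝓘(ℝ, Model d) ∞ M]

/-- The Gram matrix `g_x(b_i, b_j)` of a family of tangent vectors at `x`. -/
def gram (g : SmoothMetric d M) (x : M) (b : Fin d → TangentSpace 𝓘(ℝ, Model d) x) :
    Matrix (Fin d) (Fin d) ℝ :=
  Matrix.of fun i j => g.inner x (b i) (b j)

/-- The basis of `T_x M` given by the standard basis of the model space. -/
def frame (x : M) (i : Fin d) : TangentSpace 𝓘(ℝ, Model d) x :=
  (EuclideanSpace.single i (1 : ℝ) : Model d)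

/-- The coordinate vector fields `∂_1, …, ∂_d` of the chart around `c`, at the point with
coordinates `y`. -/
def coordFrame (c : M) (y : Model d) (i : Fin d) :
    TangentSpace 𝓘(ℝ, Model d) ((extChartAt 𝓘(ℝ, Model d) c).symm y) :=
  mfderiv 𝓘(ℝ, Model d) 𝓘(ℝ, Model d) (extChartAt 𝓘(ℝ, Model d) c).symm y
    (EuclideanSpace.single i (1 : ℝ) : Model d)

/-- The density `√(det (g_ij))` of the Riemannian volume in the chart around `c`. -/
def volumeDensity (g : SmoothMetric d M) (c : M) (y : Model d) : ℝ :=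
  Real.sqrt (gram g ((extChartAt 𝓘(ℝ, Model d) c).symm y) (coordFrame c y)).det

/-- The Riemannian volume measure. On the domain of the chart around `c` it is the image of
`√(det (g_ij)) dy`; these local measures agree on overlaps, and their supremum in the lattice of
measures is the measure that restricts to each of them. -/
def vol (g : SmoothMetric d M) [MeasurableSpace M] : Measure M :=
  ⨆ c : M, Measure.map (extChartAt 𝓘(ℝ, Model d) c).symm
    ((volume.restrict (extChartAt 𝓘(ℝ, Model d) c).target).withDensity
      fun y => ENNReal.ofReal (volumeDensity g c y))

/-- Complex-valued covectors at `x`. -/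
abbrev Covec (d : ℕ) {M : Type*} [TopologicalSpace M] [ChartedSpace (Model d) M] (x : M) : Type :=
  TangentSpace 𝓘(ℝ, Model d) x →L[ℝ] ℂ

/-- The Hermitian product `∑ g^{ij} α_i conj(β_j)` of complex covectors at `x`. It does not depend
on the basis of `T_x M`. If `α = df` and `β = dh`, it is `⟨∇f, ∇h⟩_g`. -/
def covecInner (g : SmoothMetric d M) (x : M) (α β : Covec d x) : ℂ :=
  ∑ i, ∑ j, (((gram g x (frame x))⁻¹ i j : ℝ) : ℂ) * α (frame x i) * conj (β (frame x j))

/-- The norm `|α|_g` of a complex covector. -/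
def covecNorm (g : SmoothMetric d M) (x : M) (α : Covec d x) : ℝ :=
  Real.sqrt (covecInner g x α α).re

/-- The differential of a complex-valued function (its gradient, seen as a covector field). -/
def differential (d : ℕ) {M : Type*} [TopologicalSpace M] [ChartedSpace (Model d) M]
    (f : M → ℂ) (x : M) : Covec d x :=
  mfderiv 𝓘(ℝ, Model d) 𝓘(ℝ, ℂ) f x

/-- `f ∈ C^∞(M; ℂ)`. -/
def IsSmooth (d : ℕ) {M : Type*} [TopologicalSpace M] [ChartedSpace (Model d) M]
    (f : M → ℂ) : Prop :=
  ContMDiff 𝓘(ℝ, Model d) 𝓘(ℝ, ℂ) ∞ f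

variable [MeasurableSpace M]

/-- `f ∈ H^1(M)` with weak gradient `η`: the space `H^1` of the compact manifold `M` is the
completion of `C^∞(M; ℂ)` for the norm `‖f‖_2 + ‖∇f‖_2`, that is, some smooth functions `F n`
satisfy `F n → f` and `d(F n) → η` in `L^2`. -/
def HasWeakGradient (g : SmoothMetric d M) (f : M → ℂ) (η : ∀ x : M, Covec d x) : Prop :=
  AEStronglyMeasurable f (vol g) ∧
  ∃ F : ℕ → M → ℂ, (∀ n, IsSmooth d (F n)) ∧
    (∀ n, AEStronglyMeasurable (fun x => covecNorm g x (differential d (F n) x - η x)) (vol g)) ∧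
    Tendsto (fun n => eLpNorm (fun x => F n x - f x) 2 (vol g)) atTop (𝓝 0) ∧
    Tendsto (fun n => eLpNorm (fun x => covecNorm g x (differential d (F n) x - η x)) 2 (vol g))
      atTop (𝓝 0)

/-- `u ∈ L^∞(0,T; H^1(M))`, with spatial gradient `η`. A function with values in the separable
Hilbert space `H^1` is measurable when it is weakly measurable, which is expressed by the
measurability of `u` on `(0,T) × M` and of the products `(∇u(t), ∇ψ)` for smooth `ψ`. -/
structure MemLinftyH1 (g : SmoothMetric d M) (T : ℝ) (u : ℝ → M → ℂ)
    (η : ℝ → ∀ x : M, Covec d x) : Prop where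
  aestronglyMeasurable : AEStronglyMeasurable (fun p : ℝ × M => u p.1 p.2)
    ((volume.restrict (Ioo 0 T)).prod (vol g))
  aemeasurable_gradient : ∀ ψ : M → ℂ, IsSmooth d ψ →
    AEMeasurable (fun t => ∫ x, covecInner g x (η t x) (differential d ψ x) ∂(vol g))
      (volume.restrict (Ioo 0 T))
  hasWeakGradient : ∀ᵐ t ∂(volume.restrict (Ioo 0 T)), HasWeakGradient g (u t) (η t)
  bounded : ∃ C : ℝ≥0, ∀ᵐ t ∂(volume.restrict (Ioo 0 T)),
    eLpNorm (u t) 2 (vol g) ≤ C ∧ eLpNorm (fun x => covecNorm g x (η t x)) 2 (vol g) ≤ C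

end Geometry

/-- The nonlinearity `i λ z ζ(|z| + 1) + μ z log |z|`. Both terms are `0` at `z = 0`. -/
def nonlinearity (lam mu : ℝ) (z : ℂ) : ℂ :=
  Complex.I * lam * z * riemannZeta ((‖z‖ : ℂ) + 1) + mu * z * (Real.log ‖z‖ : ℂ)

section Equation

variable {d : ℕ} {M : Type*} [TopologicalSpace M] [ChartedSpace (Model d) M]
  [IsManifold 𝓘(ℝ, Model d) ∞ M] [MeasurableSpace M]

/-- `u ∈ L^∞(0,T; H^1(M))` solves
`i ∂_t u + Δ u + i λ u ζ(|u| + 1) + μ u log |u| = 0` in the sense of distributions on `(0,T) × M`: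
the equation is tested against `φ(t) conj(ψ(x))` with `φ ∈ C_c^∞(0,T)` and `ψ ∈ C^∞(M)`, where
`⟨Δ u, ψ⟩ = -(∇u, ∇ψ)`. -/
def IsDistributionalSolution (g : SmoothMetric d M) (lam mu T : ℝ) (u : ℝ → M → ℂ) : Prop :=
  ∃ η : ℝ → ∀ x : M, Covec d x, MemLinftyH1 g T u η ∧
    ∀ (φ : ℝ → ℝ) (ψ : M → ℂ), ContDiff ℝ ∞ φ → HasCompactSupport φ → tsupport φ ⊆ Ioo 0 T →
      IsSmooth d ψ →
      ∫ t in Ioo 0 T,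
        (-Complex.I * ((deriv φ t : ℝ) : ℂ) * (∫ x, u t x * conj (ψ x) ∂(vol g))
          - (φ t : ℂ) * (∫ x, covecInner g x (η t x) (differential d ψ x) ∂(vol g))
          + (φ t : ℂ) * (∫ x, nonlinearity lam mu (u t x) * conj (ψ x) ∂(vol g))) = 0

/-- `U ∈ C([0,T]; L^2(M))` and `U(t) = u(t)` for almost every `t ∈ (0,T)`. For `T > 0` such a `U`
is unique on `[0,T]`; the value of `u` at a time `t`, in particular its initial value, is `U t`. -/
def IsContinuousVersion (g : SmoothMetric d M) (T : ℝ) (u : ℝ → M → ℂ)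
    (U : ℝ → Lp ℂ 2 (vol g)) : Prop :=
  ContinuousOn U (Icc 0 T) ∧
    ∀ᵐ t ∂(volume.restrict (Ioo 0 T)), (U t : M → ℂ) =ᵐ[vol g] u t

end Equation

end ZetaLogNLS

end

/-!
Uniqueness for the Schrödinger equation with a zeta and a logarithmic nonlinearity.

The nonlinearity is dissipative up to a Lipschitz error, although it is not Lipschitz. Write
`N(z) = i λ z ζ(|z| + 1) + μ z log |z|`. Then `Re (conj (z₁ - z₂) · i (N(z₁) - N(z₂)))` is at most
`|μ| |z₁ - z₂|²` (`nonlinearity_dissipative`). Two facts are behind this. First, `z ↦ z ζ(|z| + 1)`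
is a monotone map of the plane (`zeta_term_monotone`), so the term with `λ > 0` has a favourable
sign: `s ζ(s + 1)` is nondecreasing in `s > 0`, because it is the mean of the increasing function
`x / (1 - e^{-x})` for the Gamma distribution of parameter `s` (`mul_zetaSum_mono`). Second,
`|Im (conj (z₁ - z₂) (z₁ log |z₁| - z₂ log |z₂|))|` is at most `|z₁ - z₂|²`, the estimate of
Cazenave and Haraux for the logarithmic term. If `w` is the difference of two solutions, then
formally `d/dt ‖w‖² ≤ 2 |μ| ‖w‖²`, and Gronwall's inequality gives the bound.

What has to be justified is the continuity of the solutions in `L²` and the energy identity for `w`,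
for functions that are only in `L^∞(0,T; H¹)` and solve the equation in the sense of distributions.
This is done in an abstract setting. Let `j : V → H` be a bounded map of Hilbert spaces (here
`H¹ → L²`) and let `S = j j*`, which plays the part of `(1 - Δ)⁻¹`. The equation becomes
`(S w)' = i (S m - w)` in `H`, with `m = N(u) + w` bounded in `H` (`IsWeakEvolution`). Then `S w`
has a Lipschitz version. With the resolvent `R = (S + ε)⁻¹`, the function `R S w` is Lipschitz too,
its energy is computed by the fundamental theorem of calculus, and it differs from `w` by `O(√ε)`
uniformly in time, because `w` takes its values in a ball of `V`. Letting `ε → 0` gives the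
continuous version and the energy identity at once (`exists_continuous_version_energy`).

The rest connects the manifold with this setting. The space `H¹` is the completion of the smooth
functions (`SobolevSpace`), and a pair `(f, η)` of a function and its weak gradient gives an element
of it (`HasWeakGradient.exists_sobolevSpace`). The nonlinear term has to stay bounded in `L²`. As
`N(z)` grows like `|z| log |z|`, an embedding `H¹ ⊆ L^q` with any `q > 2` is enough
(`exists_sobolev`); it comes from the Gagliardo-Nirenberg-Sobolev inequality in charts, once the
Riemannian volume is known to be `√(det (g_ij)) dy` in each of them (`vol_restrict_source`).
-/

namespace ZetaLogNLS

/-! ### The nonlinearity -/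

section Nonlinearity

/-- `ζ(s + 1)` for real `s > 0`, as a real number. -/
noncomputable def zetaSum (s : ℝ) : ℝ := ∑' n : ℕ, 1 / ((n : ℝ) + 1) ^ (s + 1)

theorem riemannZeta_add_one_eq {s : ℝ} (hs : 0 < s) :
    riemannZeta ((s : ℂ) + 1) = (zetaSum s : ℂ) := by
  rw [zeta_eq_tsum_one_div_nat_add_one_cpow (by simpa using hs), zetaSum, Complex.ofReal_tsum]
  congr 1 with n
  rw [Complex.ofReal_div, Complex.ofReal_cpow (by positivity)]
  simp

theorem summable_zetaSum {s : ℝ} (hs : 0 < s) :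
    Summable fun n : ℕ => 1 / ((n : ℝ) + 1) ^ (s + 1) := by
  have := (summable_nat_add_iff 1).2 (Real.summable_one_div_nat_rpow.2 (by linarith : 1 < s + 1))
  simpa using this

/-- The weight `x / (1 - e^{-x})`. Its mean for the Gamma distribution of parameter `s` is
`s ζ(s + 1)`. -/
noncomputable def boseWeight (x : ℝ) : ℝ := x / (1 - Real.exp (-x))

theorem one_sub_exp_neg_pos {x : ℝ} (hx : 0 < x) : 0 < 1 - Real.exp (-x) := by
  have : Real.exp (-x) < 1 := Real.exp_lt_one_iff.2 (by linarith)
  linarith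

theorem boseWeight_mono {x y : ℝ} (hx : 0 < x) (hxy : x ≤ y) : boseWeight x ≤ boseWeight y := by
  have hy : 0 < y := hx.trans_le hxy
  rw [boseWeight, boseWeight, div_le_div_iff₀ (one_sub_exp_neg_pos hx) (one_sub_exp_neg_pos hy)]
  have hle : x / y ≤ 1 := (div_le_one hy).2 hxy
  -- by convexity `e^{-x}` lies below the chord of the exponential between `-y` and `0`
  have h := convexOn_exp.2 (mem_univ (0 : ℝ)) (mem_univ (-y)) (sub_nonneg.2 hle)
    (div_nonneg hx.le hy.le) (by ring)
  simp only [smul_eq_mul, mul_zero, zero_add, Real.exp_zero, mul_one] at h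
  have e : x / y * -y = -x := by field_simp
  rw [e] at h
  have h2 := mul_le_mul_of_nonneg_right h hy.le
  have e2 : (1 - x / y + x / y * Real.exp (-y)) * y = y - x + x * Real.exp (-y) := by field_simp
  rw [e2] at h2
  linarith

theorem boseWeight_le {x : ℝ} (hx : 0 < x) : boseWeight x ≤ 1 + x := by
  rw [boseWeight, div_le_iff₀ (one_sub_exp_neg_pos hx)]
  have h1 := Real.add_one_le_exp x
  have h2 : Real.exp x * Real.exp (-x) = 1 := by rw [← Real.exp_add]; simp
  nlinarith [Real.exp_pos (-x)]

/-- The Bose integral `∫ x^s / (e^x - 1) dx = Γ(s + 1) ζ(s + 1)`, from the geometric series. -/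
theorem integral_rpow_mul_boseWeight {s : ℝ} (hs : 0 < s) :
    IntegrableOn (fun x => x ^ (s - 1) * Real.exp (-x) * boseWeight x) (Ioi 0) ∧
      ∫ x in Ioi (0 : ℝ), x ^ (s - 1) * Real.exp (-x) * boseWeight x =
        Real.Gamma (s + 1) * zetaSum s := by
  have hterm : ∀ n : ℕ, ∫ x in Ioi (0 : ℝ), x ^ s * Real.exp (-(((n : ℝ) + 1) * x)) =
      Real.Gamma (s + 1) * (1 / ((n : ℝ) + 1) ^ (s + 1)) := fun n => by
    have := Real.integral_rpow_mul_exp_neg_mul_Ioi (a := s + 1) (r := (n : ℝ) + 1)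
      (by linarith) (by positivity)
    rw [add_sub_cancel_right] at this
    rw [this, Real.div_rpow zero_le_one (by positivity), Real.one_rpow, mul_comm]
  have hΓ : 0 < Real.Gamma (s + 1) := Real.Gamma_pos_of_pos (by linarith)
  have hint : ∀ n : ℕ, IntegrableOn (fun x => x ^ s * Real.exp (-(((n : ℝ) + 1) * x)))
      (Ioi 0) := fun n => by
    refine not_imp_comm.1 integral_undef ?_
    rw [hterm]; positivity
  have hsum := (summable_zetaSum hs).mul_left (Real.Gamma (s + 1))
  have hS := hasSum_integral_of_summable_integral_norm (μ := volume.restrict (Ioi 0))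
    (F := fun (n : ℕ) x => x ^ s * Real.exp (-(((n : ℝ) + 1) * x))) hint (by
      refine hsum.congr fun n => ?_
      rw [← hterm]
      refine setIntegral_congr_fun measurableSet_Ioi fun x hx => ?_
      exact (Real.norm_of_nonneg (mul_nonneg (Real.rpow_nonneg (le_of_lt hx) _)
        (Real.exp_pos _).le)).symm)
  have hpt : ∀ x ∈ Ioi (0 : ℝ), ∑' n : ℕ, x ^ s * Real.exp (-(((n : ℝ) + 1) * x)) =
      x ^ (s - 1) * Real.exp (-x) * boseWeight x := by
    intro x hx
    have hx' : (0 : ℝ) < x := hx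
    have e : ∀ n : ℕ, x ^ s * Real.exp (-(((n : ℝ) + 1) * x)) =
        (x ^ s * Real.exp (-x)) * Real.exp (-x) ^ n := fun n => by
      rw [← Real.exp_nat_mul, mul_assoc, ← Real.exp_add]; congr 2; ring
    simp_rw [e]
    rw [tsum_mul_left, tsum_geometric_of_lt_one (Real.exp_pos _).le
      (by linarith [one_sub_exp_neg_pos hx']), boseWeight, Real.rpow_sub_one hx'.ne']
    field_simp
  have heq : ∫ x in Ioi (0 : ℝ), x ^ (s - 1) * Real.exp (-x) * boseWeight x =
      Real.Gamma (s + 1) * zetaSum s := by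
    rw [← setIntegral_congr_fun measurableSet_Ioi hpt, ← hS.tsum_eq, zetaSum, ← tsum_mul_left]
    exact tsum_congr hterm
  refine ⟨not_imp_comm.1 integral_undef ?_, heq⟩
  rw [heq]
  have : 0 < zetaSum s := (summable_zetaSum hs).tsum_pos (fun n => by positivity) 0 (by simp)
  positivity

theorem integrableOn_Gamma_density {s : ℝ} (hs : 0 < s) :
    IntegrableOn (fun x => x ^ (s - 1) * Real.exp (-x)) (Ioi 0) :=
  (Real.GammaIntegral_convergent hs).congr_fun (fun _ _ => mul_comm _ _) measurableSet_Ioi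

theorem integral_Gamma_density {s : ℝ} (hs : 0 < s) :
    ∫ x in Ioi (0 : ℝ), x ^ (s - 1) * Real.exp (-x) = Real.Gamma s := by
  rw [Real.Gamma_eq_integral hs]
  exact setIntegral_congr_fun measurableSet_Ioi fun _ _ => mul_comm _ _

/-- `s ζ(s + 1)` is nondecreasing: it is the mean of the increasing function `boseWeight` for the
Gamma distribution of parameter `s`, and the ratio of two Gamma densities is monotone. -/
theorem mul_zetaSum_mono {s t : ℝ} (hs : 0 < s) (hst : s ≤ t) :
    s * zetaSum s ≤ t * zetaSum t := by
  rcases hst.eq_or_lt with rfl | hst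
  · exact le_rfl
  have ht : 0 < t := hs.trans hst
  have hΓs := Real.Gamma_pos_of_pos hs
  have hΓt := Real.Gamma_pos_of_pos ht
  obtain ⟨is, es⟩ := integral_rpow_mul_boseWeight hs
  obtain ⟨it, et⟩ := integral_rpow_mul_boseWeight ht
  set ρ := Real.Gamma t / Real.Gamma s with hρ
  have hρ0 : 0 < ρ := div_pos hΓt hΓs
  -- the point where the two densities agree
  set x₀ : ℝ := ρ ^ (1 / (t - s)) with hx₀
  have hx₀0 : 0 < x₀ := Real.rpow_pos_of_pos hρ0 _
  have hts : 0 < t - s := sub_pos.2 hst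
  have hx₀ρ : x₀ ^ (t - s) = ρ := by
    rw [hx₀, ← Real.rpow_mul hρ0.le, one_div, inv_mul_cancel₀ hts.ne', Real.rpow_one]
  -- the increments of the weight and of the ratio of the densities from `x₀` have the same sign
  have hpt : ∀ x ∈ Ioi (0 : ℝ), 0 ≤
      (x ^ (t - 1) * Real.exp (-x) * boseWeight x
        - ρ * (x ^ (s - 1) * Real.exp (-x) * boseWeight x))
      - (boseWeight x₀ * (x ^ (t - 1) * Real.exp (-x))
        - boseWeight x₀ * ρ * (x ^ (s - 1) * Real.exp (-x))) := by
    intro x hx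
    have hx' : (0 : ℝ) < x := hx
    have e : x ^ (t - 1) = x ^ (s - 1) * x ^ (t - s) := by
      rw [← Real.rpow_add hx']; congr 1; ring
    have h1 : 0 ≤ (boseWeight x - boseWeight x₀) * (x ^ (t - s) - ρ) := by
      rw [← hx₀ρ]
      rcases le_total x x₀ with h | h
      · exact mul_nonneg_of_nonpos_of_nonpos (sub_nonpos.2 (boseWeight_mono hx' h))
          (sub_nonpos.2 (Real.rpow_le_rpow hx'.le h hts.le))
      · exact mul_nonneg (sub_nonneg.2 (boseWeight_mono hx₀0 h))
          (sub_nonneg.2 (Real.rpow_le_rpow hx₀0.le h hts.le))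
    have h2 : 0 ≤ x ^ (s - 1) * Real.exp (-x) := by positivity
    rw [e]
    nlinarith [mul_nonneg h2 h1]
  have key := setIntegral_nonneg (μ := volume) measurableSet_Ioi hpt
  have i1 : IntegrableOn (fun x => x ^ (t - 1) * Real.exp (-x) * boseWeight x
      - ρ * (x ^ (s - 1) * Real.exp (-x) * boseWeight x)) (Ioi 0) := it.sub (is.const_mul ρ)
  have i2 : IntegrableOn (fun x => boseWeight x₀ * (x ^ (t - 1) * Real.exp (-x))
      - boseWeight x₀ * ρ * (x ^ (s - 1) * Real.exp (-x))) (Ioi 0) :=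
    ((integrableOn_Gamma_density ht).const_mul _).sub ((integrableOn_Gamma_density hs).const_mul _)
  rw [integral_sub i1 i2, integral_sub it (is.const_mul ρ),
    integral_sub ((integrableOn_Gamma_density ht).const_mul _)
      ((integrableOn_Gamma_density hs).const_mul _), integral_const_mul, integral_const_mul,
    integral_const_mul, es, et, integral_Gamma_density ht, integral_Gamma_density hs,
    Real.Gamma_add_one hs.ne', Real.Gamma_add_one ht.ne'] at key
  have e : boseWeight x₀ * Real.Gamma t - boseWeight x₀ * ρ * Real.Gamma s = 0 := by
    rw [hρ]; field_simp; ring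
  have e2 : ρ * (s * Real.Gamma s * zetaSum s) = Real.Gamma t * (s * zetaSum s) := by
    rw [hρ]; field_simp
  rw [e, e2] at key
  have : 0 ≤ Real.Gamma t * (t * zetaSum t - s * zetaSum s) := by linarith
  exact sub_nonneg.1 (nonneg_of_mul_nonneg_right this hΓt)

theorem zetaSum_nonneg (s : ℝ) : 0 ≤ zetaSum s := tsum_nonneg fun n => by positivity

theorem mul_zetaSum_le {s : ℝ} (hs : 0 < s) : s * zetaSum s ≤ 1 + s := by
  have hΓs := Real.Gamma_pos_of_pos hs
  obtain ⟨is, es⟩ := integral_rpow_mul_boseWeight hs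
  have h1 := integrableOn_Gamma_density (s := s + 1) (by linarith)
  have key := setIntegral_mono_on is ((integrableOn_Gamma_density hs).add h1)
    measurableSet_Ioi (fun x (hx : 0 < x) => by
      have e : x ^ (s + 1 - 1) = x ^ (s - 1) * x := by
        rw [← Real.rpow_add_one hx.ne']; congr 1; ring
      simp only [Pi.add_apply]
      rw [e]
      have h2 : 0 ≤ x ^ (s - 1) * Real.exp (-x) := by positivity
      nlinarith [mul_le_mul_of_nonneg_left (boseWeight_le hx) h2])
  simp only [Pi.add_apply] at key
  rw [es, integral_add (integrableOn_Gamma_density hs) h1, integral_Gamma_density hs,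
    integral_Gamma_density (by linarith), Real.Gamma_add_one hs.ne'] at key
  have : Real.Gamma s * (s * zetaSum s) ≤ Real.Gamma s * (1 + s) := by linarith
  exact le_of_mul_le_mul_left this hΓs

theorem nonlinearity_eq {lam mu : ℝ} (z : ℂ) :
    nonlinearity lam mu z =
      Complex.I * lam * (z * (zetaSum ‖z‖ : ℂ)) + mu * (z * (Real.log ‖z‖ : ℂ)) := by
  rcases eq_or_ne z 0 with rfl | hz
  · simp [nonlinearity]
  · rw [nonlinearity, riemannZeta_add_one_eq (norm_pos_iff.2 hz)]; ring

/-- The zeta term is a monotone operator on `ℂ`. -/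
theorem zeta_term_monotone (z₁ z₂ : ℂ) :
    0 ≤ (conj (z₁ - z₂) * (z₁ * (zetaSum ‖z₁‖ : ℂ) - z₂ * (zetaSum ‖z₂‖ : ℂ))).re := by
  set a := zetaSum ‖z₁‖ with ha
  set b := zetaSum ‖z₂‖ with hb
  have ha0 : 0 ≤ a := zetaSum_nonneg _
  have hb0 : 0 ≤ b := zetaSum_nonneg _
  set r := ‖z₁‖ with hr
  set s := ‖z₂‖ with hs
  have e : (conj (z₁ - z₂) * (z₁ * (a : ℂ) - z₂ * (b : ℂ))).re =
      a * r ^ 2 + b * s ^ 2 - (a + b) * (z₁ * conj z₂).re := by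
    rw [hr, hs, ← Complex.normSq_eq_norm_sq, ← Complex.normSq_eq_norm_sq,
      Complex.normSq_apply, Complex.normSq_apply]
    simp only [map_sub, Complex.mul_re, Complex.sub_re, Complex.conj_re, Complex.ofReal_re,
      Complex.ofReal_im, mul_zero, sub_zero, Complex.sub_im, Complex.conj_im, Complex.mul_im,
      zero_add]
    ring
  rw [e]
  have h1 : (z₁ * conj z₂).re ≤ r * s := by
    refine (Complex.re_le_norm _).trans ?_
    rw [norm_mul, Complex.norm_conj]
  have hr0 : 0 ≤ r := norm_nonneg _
  have hs0 : 0 ≤ s := norm_nonneg _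
  -- by `h1` the expression is at least `(a r - b s) (r - s)`
  have h2 : 0 ≤ (a * r - b * s) * (r - s) := by
    rcases hr0.eq_or_lt with h | h
    · rw [← h]; nlinarith [mul_nonneg hb0 (sq_nonneg s)]
    rcases hs0.eq_or_lt with h' | h'
    · rw [← h']; nlinarith [mul_nonneg ha0 (sq_nonneg r)]
    rcases le_total r s with hle | hle
    · have := mul_zetaSum_mono h hle
      exact mul_nonneg_of_nonpos_of_nonpos (by rw [ha, hb]; linarith) (by linarith)
    · have := mul_zetaSum_mono h' hle
      exact mul_nonneg (by rw [ha, hb]; linarith) (by linarith)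
  nlinarith [mul_le_mul_of_nonneg_left h1 (add_nonneg ha0 hb0)]

theorem abs_log_sub_log_mul_le {r s : ℝ} (hr : 0 < r) (hs : 0 < s) :
    |Real.log r - Real.log s| * min r s ≤ |r - s| := by
  wlog h : s ≤ r generalizing r s
  · rw [abs_sub_comm, min_comm, abs_sub_comm r]; exact this hs hr (le_of_not_ge h)
  rw [min_eq_right h, abs_of_nonneg (sub_nonneg.2 (Real.log_le_log hs h)),
    abs_of_nonneg (sub_nonneg.2 h), ← Real.log_div hr.ne' hs.ne']
  have h1 := Real.log_le_sub_one_of_pos (div_pos hr hs)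
  calc _ ≤ (r / s - 1) * s := by gcongr
    _ = r - s := by field_simp

/-- The logarithmic term is one-sided Lipschitz: the logarithmic singularity at `0` is compensated
by the factor `Im (z₁ conj z₂)`. -/
theorem abs_im_log_term_le (z₁ z₂ : ℂ) :
    |(conj (z₁ - z₂) * (z₁ * (Real.log ‖z₁‖ : ℂ) - z₂ * (Real.log ‖z₂‖ : ℂ))).im| ≤
      ‖z₁ - z₂‖ ^ 2 := by
  rcases eq_or_ne z₁ 0 with rfl | h₁
  · have : (conj (0 - z₂) * (0 * (Real.log ‖(0 : ℂ)‖ : ℂ) - z₂ * (Real.log ‖z₂‖ : ℂ))).im = 0 := by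
      simp [Complex.mul_im]; ring
    rw [this]; simp
  rcases eq_or_ne z₂ 0 with rfl | h₂
  · have : (conj (z₁ - 0) * (z₁ * (Real.log ‖z₁‖ : ℂ) - 0 * (Real.log ‖(0 : ℂ)‖ : ℂ))).im = 0 := by
      simp [Complex.mul_im]; ring
    rw [this]; simp
  set a := Real.log ‖z₁‖ with ha
  set b := Real.log ‖z₂‖ with hb
  have e : (conj (z₁ - z₂) * (z₁ * (a : ℂ) - z₂ * (b : ℂ))).im =
      -((a - b) * (z₁ * conj z₂).im) := by
    simp only [map_sub, Complex.mul_re, Complex.sub_re, Complex.conj_re, Complex.ofReal_re,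
      Complex.ofReal_im, mul_zero, sub_zero, Complex.sub_im, Complex.conj_im, Complex.mul_im,
      zero_add]
    ring
  -- `z₂ conj z₂` and `z₁ conj z₁` are real, so `z₁ conj z₂` may be replaced by a product with
  -- the factor `z₁ - z₂`
  have hm : |(z₁ * conj z₂).im| ≤ ‖z₁ - z₂‖ * min ‖z₁‖ ‖z₂‖ := by
    have e1 : (z₁ * conj z₂).im = ((z₁ - z₂) * conj z₂).im := by
      simp only [Complex.mul_im, Complex.sub_re, Complex.sub_im, Complex.conj_re, Complex.conj_im]
      ring
    have e2 : (z₁ * conj z₂).im = ((z₁ - z₂) * conj z₁).im := by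
      simp only [Complex.mul_im, Complex.sub_re, Complex.sub_im, Complex.conj_re, Complex.conj_im]
      ring
    rcases min_choice ‖z₁‖ ‖z₂‖ with h | h
    · rw [h, e2]
      refine (Complex.abs_im_le_norm _).trans ?_
      rw [norm_mul, Complex.norm_conj]
    · rw [h, e1]
      refine (Complex.abs_im_le_norm _).trans ?_
      rw [norm_mul, Complex.norm_conj]
  rw [e, abs_neg, abs_mul]
  have h3 := abs_log_sub_log_mul_le (norm_pos_iff.2 h₁) (norm_pos_iff.2 h₂)
  have h4 := abs_norm_sub_norm_le z₁ z₂
  calc |a - b| * |(z₁ * conj z₂).im| ≤ |a - b| * (‖z₁ - z₂‖ * min ‖z₁‖ ‖z₂‖) := by gcongr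
    _ = (|a - b| * min ‖z₁‖ ‖z₂‖) * ‖z₁ - z₂‖ := by ring
    _ ≤ ‖z₁ - z₂‖ * ‖z₁ - z₂‖ := by gcongr; exact h3.trans h4
    _ = _ := by ring

/-- Multiplication by `i` turns the term with `λ` into `-λ` times a monotone term, and it leaves
only the imaginary part of the logarithmic term. -/
theorem nonlinearity_dissipative {lam : ℝ} (hlam : 0 ≤ lam) (mu : ℝ) (z₁ z₂ : ℂ) :
    (conj (z₁ - z₂) * (Complex.I * (nonlinearity lam mu z₁ - nonlinearity lam mu z₂))).re ≤
      |mu| * ‖z₁ - z₂‖ ^ 2 := by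
  have h1 := mul_nonneg hlam (zeta_term_monotone z₁ z₂)
  have h2 := abs_im_log_term_le z₁ z₂
  set A := conj (z₁ - z₂) * (z₁ * (zetaSum ‖z₁‖ : ℂ) - z₂ * (zetaSum ‖z₂‖ : ℂ)) with hA
  set B := conj (z₁ - z₂) * (z₁ * (Real.log ‖z₁‖ : ℂ) - z₂ * (Real.log ‖z₂‖ : ℂ)) with hB
  have e : conj (z₁ - z₂) * (Complex.I * (nonlinearity lam mu z₁ - nonlinearity lam mu z₂)) =
      ((-lam : ℝ) : ℂ) * A + (mu : ℂ) * (Complex.I * B) := by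
    rw [nonlinearity_eq, nonlinearity_eq, hA, hB]
    push_cast
    linear_combination (lam * conj (z₁ - z₂) * (z₁ * (zetaSum ‖z₁‖ : ℂ) -
      z₂ * (zetaSum ‖z₂‖ : ℂ))) * Complex.I_mul_I
  rw [e, Complex.add_re, Complex.re_ofReal_mul, Complex.re_ofReal_mul, Complex.I_mul_re]
  have h3 : mu * -B.im ≤ |mu| * |B.im| := by
    rw [← abs_mul]; exact (le_abs_self _).trans (by rw [mul_neg, abs_neg])
  nlinarith [mul_le_mul_of_nonneg_left h2 (abs_nonneg mu)]

theorem measurable_nonlinearity (lam mu : ℝ) : Measurable (nonlinearity lam mu) := by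
  have hζ : Measurable riemannZeta := by
    refine measurable_of_continuousOn_compl_singleton 1 fun s hs => ?_
    exact (differentiableAt_riemannZeta hs).continuousAt.continuousWithinAt
  unfold nonlinearity
  have h1 : Measurable fun z : ℂ => ((‖z‖ : ℝ) : ℂ) :=
    Complex.measurable_ofReal.comp measurable_norm
  have h2 : Measurable fun z : ℂ => ((Real.log ‖z‖ : ℝ) : ℂ) :=
    Complex.measurable_ofReal.comp (Real.measurable_log.comp measurable_norm)
  exact ((measurable_id.const_mul _).mul (hζ.comp (h1.add_const 1))).add
    ((measurable_id.const_mul _).mul h2)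

/-- The nonlinearity grows slower than any power larger than one. -/
theorem exists_nonlinearity_bound (lam mu : ℝ) {q : ℝ} (hq : 2 < q) :
    ∃ C, 0 ≤ C ∧ ∀ z, ‖nonlinearity lam mu z‖ ≤ C * (1 + ‖z‖ ^ (q / 2)) := by
  set δ := q / 2 - 1 with hδ
  have hδ0 : 0 < δ := by rw [hδ]; linarith
  refine ⟨|lam| * 2 + |mu| * (1 + 1 / δ), by positivity, fun z => ?_⟩
  rcases eq_or_ne z 0 with rfl | hz
  · simp only [nonlinearity, mul_zero, zero_mul, add_zero, norm_zero]; positivity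
  set r := ‖z‖ with hr
  have hr0 : 0 < r := norm_pos_iff.2 hz
  have hq0 : 0 ≤ r ^ (q / 2) := Real.rpow_nonneg hr0.le _
  have hrq : r ≤ 1 + r ^ (q / 2) := by
    rcases le_total r 1 with h | h
    · linarith
    · have := Real.rpow_le_rpow_of_exponent_le h (by linarith : (1 : ℝ) ≤ q / 2)
      rw [Real.rpow_one] at this; linarith
  have hζ : ‖z * (zetaSum ‖z‖ : ℂ)‖ ≤ 2 * (1 + r ^ (q / 2)) := by
    rw [norm_mul, Complex.norm_real, Real.norm_of_nonneg (zetaSum_nonneg _)]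
    have := mul_zetaSum_le hr0
    rw [hr] at this ⊢; linarith
  have hlog : ‖z * (Real.log ‖z‖ : ℂ)‖ ≤ (1 + 1 / δ) * (1 + r ^ (q / 2)) := by
    rw [norm_mul, Complex.norm_real, Real.norm_eq_abs, ← hr]
    have hδ1 : 0 ≤ 1 / δ := by positivity
    rcases le_total r 1 with h | h
    · have := (Real.abs_log_mul_self_lt r hr0 h).le
      rw [abs_mul, abs_of_pos hr0, mul_comm] at this
      nlinarith
    · rw [abs_of_nonneg (Real.log_nonneg h)]
      have h1 := Real.log_le_rpow_div hr0.le hδ0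
      have h2 : r * (r ^ δ / δ) = 1 / δ * r ^ (q / 2) := by
        have : r ^ (q / 2) = r ^ δ * r := by
          rw [← Real.rpow_add_one hr0.ne']; congr 1; rw [hδ]; ring
        rw [this]; field_simp
      have h3 := mul_le_mul_of_nonneg_left h1 hr0.le
      rw [h2] at h3
      nlinarith
  rw [nonlinearity_eq]
  calc _ ≤ ‖Complex.I * lam * (z * (zetaSum ‖z‖ : ℂ))‖ + ‖(mu : ℂ) * (z * (Real.log ‖z‖ : ℂ))‖ :=
        norm_add_le _ _
    _ = |lam| * ‖z * (zetaSum ‖z‖ : ℂ)‖ + |mu| * ‖z * (Real.log ‖z‖ : ℂ)‖ := by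
        rw [norm_mul, norm_mul (mu : ℂ), norm_mul Complex.I, Complex.norm_I, one_mul,
          Complex.norm_real, Complex.norm_real, Real.norm_eq_abs, Real.norm_eq_abs]
    _ ≤ |lam| * (2 * (1 + r ^ (q / 2))) + |mu| * ((1 + 1 / δ) * (1 + r ^ (q / 2))) := by gcongr
    _ = _ := by ring

end Nonlinearity

/-! ### Vector-valued calculus in time -/

section Calculus

theorem integrableOn_of_bounded {E : Type*} [NormedAddCommGroup E] {g : ℝ → E} {C : ℝ}
    (hg : AEStronglyMeasurable g volume) (hC : ∀ t, ‖g t‖ ≤ C) {s : Set ℝ}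
    (hs : volume s < ⊤) : IntegrableOn g s :=
  Measure.integrableOn_of_bounded hs.ne hg (ae_of_all _ hC)

theorem intervalIntegrable_of_bounded {E : Type*} [NormedAddCommGroup E] {g : ℝ → E} {C : ℝ}
    (hg : AEStronglyMeasurable g volume) (hC : ∀ t, ‖g t‖ ≤ C) (a b : ℝ) :
    IntervalIntegrable g volume a b :=
  ⟨integrableOn_of_bounded hg hC (by simp), integrableOn_of_bounded hg hC (by simp)⟩

theorem lipschitzWith_primitive {E : Type*} [NormedAddCommGroup E] [NormedSpace ℝ E] {g : ℝ → E}
    {C : ℝ} (hg : AEStronglyMeasurable g volume) (hC : ∀ t, ‖g t‖ ≤ C) (c : ℝ) :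
    LipschitzWith C.toNNReal (fun x => ∫ s in c..x, g s) := by
  have hC0 : 0 ≤ C := (norm_nonneg _).trans (hC 0)
  refine LipschitzWith.of_dist_le_mul fun x y => ?_
  rw [dist_eq_norm, intervalIntegral.integral_interval_sub_left
    (intervalIntegrable_of_bounded hg hC _ _) (intervalIntegrable_of_bounded hg hC _ _),
    Real.coe_toNNReal _ hC0, Real.dist_eq]
  exact intervalIntegral.norm_integral_le_of_norm_le_const fun t _ => hC t

variable {E : Type*} [NormedAddCommGroup E] [NormedSpace ℝ E] [CompleteSpace E]

theorem ae_hasDerivAt_primitive {g : ℝ → E} {C : ℝ} (hg : AEStronglyMeasurable g volume)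
    (hC : ∀ t, ‖g t‖ ≤ C) : ∀ᵐ t, ∀ c, HasDerivAt (fun x => ∫ s in c..x, g s) (g t) t := by
  apply LocallyIntegrable.ae_hasDerivAt_integral
  rw [locallyIntegrable_iff]
  exact fun k hk => integrableOn_of_bounded hg hC hk.measure_lt_top

/-- The fundamental theorem of calculus for an absolutely continuous vector-valued function whose
derivative is known almost everywhere and is bounded. -/
theorem sub_eq_integral_of_ae_hasDerivAt {K k : ℝ → E} {a b C : ℝ}
    (hK : AbsolutelyContinuousOnInterval K a b)
    (hk : AEStronglyMeasurable k volume) (hC : ∀ t, ‖k t‖ ≤ C)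
    (hd : ∀ᵐ t, t ∈ uIcc a b → HasDerivAt K (k t) t) : K b - K a = ∫ t in a..b, k t := by
  have hL := ((lipschitzWith_primitive hk hC a).lipschitzOnWith
    (s := uIcc a b)).absolutelyContinuousOnInterval
  obtain ⟨c, hc⟩ := (hK.sub hL).const_of_ae_hasDerivAt_zero (by
    filter_upwards [hd, ae_hasDerivAt_primitive hk hC] with t h1 h2 ht
    simpa using (h1 ht).sub (h2 a))
  have h1 := hc a left_mem_uIcc
  have h2 := hc b right_mem_uIcc
  simp only [Pi.sub_apply, intervalIntegral.integral_same, sub_zero] at h1 h2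
  rw [h1, ← h2]; abel

/-- Integration by parts against a test function. -/
theorem integral_deriv_smul_primitive {g : ℝ → E} {C T : ℝ} (hT : 0 < T)
    (hg : AEStronglyMeasurable g volume) (hC : ∀ t, ‖g t‖ ≤ C) {φ : ℝ → ℝ} (hφ : ContDiff ℝ ∞ φ)
    (hcs : HasCompactSupport φ) (hφs : tsupport φ ⊆ Ioo 0 T) :
    ∫ t in Ioo 0 T, (deriv φ t • (∫ s in (0 : ℝ)..t, g s) + φ t • g t) = 0 := by
  have hGL := lipschitzWith_primitive hg hC 0
  set G : ℝ → E := fun x => ∫ s in (0 : ℝ)..x, g s with hG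
  have hφ1 : ContDiff ℝ 1 φ := hφ.of_le (by simp)
  have hAC : AbsolutelyContinuousOnInterval (φ • G) 0 T :=
    (hφ1.contDiffOn.absolutelyContinuousOnInterval).smul
      (hGL.lipschitzOnWith.absolutelyContinuousOnInterval)
  have hφ'c : Continuous (deriv φ) := hφ1.continuous_deriv le_rfl
  obtain ⟨A, hA⟩ := hcs.exists_bound_of_continuous hφ1.continuous
  obtain ⟨B, hB⟩ := (hcs.deriv.smul_right (f' := G)).exists_bound_of_continuous
    (hφ'c.smul hGL.continuous)
  have hA0 : 0 ≤ A := (norm_nonneg _).trans (hA 0)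
  have key := sub_eq_integral_of_ae_hasDerivAt (C := B + A * C)
    (k := fun t => deriv φ t • G t + φ t • g t) hAC
    ((hφ'c.smul hGL.continuous).aestronglyMeasurable.add
      (hφ1.continuous.aestronglyMeasurable.smul hg))
    (fun t => (norm_add_le _ _).trans (add_le_add (hB t) (by
      rw [norm_smul]; exact mul_le_mul (hA t) (hC t) (norm_nonneg _) hA0)))
    (by
      filter_upwards [ae_hasDerivAt_primitive hg hC] with t ht _
      have := (hφ1.differentiable one_ne_zero t).hasDerivAt.smul (ht 0)
      rwa [add_comm] at this)
  have h0 : φ 0 = 0 := image_eq_zero_of_notMem_tsupport fun h => by simpa using hφs h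
  have h1 : φ T = 0 := image_eq_zero_of_notMem_tsupport fun h => by simpa using hφs h
  rw [← integral_Ioc_eq_integral_Ioo, ← intervalIntegral.integral_of_le hT.le, ← key]
  simp [h0, h1]

/-- A bounded function on `(0,T)` that is orthogonal to all derivatives of test functions is
constant. -/
theorem ae_eq_const_of_integral_deriv_smul_eq_zero {z : ℝ → E} {C T : ℝ} (hT : 0 < T)
    (hz : AEStronglyMeasurable z volume) (hC : ∀ t, ‖z t‖ ≤ C)
    (h : ∀ φ : ℝ → ℝ, ContDiff ℝ ∞ φ → HasCompactSupport φ → tsupport φ ⊆ Ioo 0 T →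
      ∫ t in Ioo 0 T, deriv φ t • z t = 0) :
    ∃ c, ∀ᵐ t ∂(volume.restrict (Ioo 0 T)), z t = c := by
  have hzi : IntegrableOn z (Ioo 0 T) := integrableOn_of_bounded hz hC (by simp)
  obtain ⟨ρ, hρs, hρ, hρcs, hρ1⟩ : ∃ ρ : ℝ → ℝ, tsupport ρ ⊆ Ioo 0 T ∧ ContDiff ℝ ∞ ρ ∧
      HasCompactSupport ρ ∧ ∫ t, ρ t = 1 := by
    let f : ContDiffBump (T / 2) := ⟨T / 8, T / 4, by positivity, by linarith⟩
    refine ⟨f.normed volume, ?_, f.contDiff_normed, f.hasCompactSupport_normed, f.integral_normed⟩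
    rw [f.tsupport_normed_eq, Real.closedBall_eq_Icc]
    intro t ht
    have h1 : f.rOut = T / 4 := rfl
    rw [h1] at ht
    constructor <;> linarith [ht.1, ht.2]
  -- `θ - (∫ θ) ρ` has mean zero, hence it is the derivative of a test function
  have key : ∀ θ : ℝ → ℝ, ContDiff ℝ ∞ θ → HasCompactSupport θ → tsupport θ ⊆ Ioo 0 T →
      ∫ t in Ioo 0 T, (θ t - (∫ s, θ s) * ρ t) • z t = 0 := by
    intro θ hθ hθcs hθs
    set ψ : ℝ → ℝ := fun t => θ t - (∫ s, θ s) * ρ t with hψ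
    have hψc : ContDiff ℝ ∞ ψ := hθ.sub (contDiff_const.mul hρ)
    have hψi : Integrable ψ :=
      (hθ.continuous.integrable_of_hasCompactSupport hθcs).sub
        ((hρ.continuous.integrable_of_hasCompactSupport hρcs).const_mul _)
    have hψ0 : ∫ t, ψ t = 0 := by
      rw [hψ, integral_sub (hθ.continuous.integrable_of_hasCompactSupport hθcs)
        ((hρ.continuous.integrable_of_hasCompactSupport hρcs).const_mul _),
        integral_const_mul, hρ1]; simp
    set S : Set ℝ := tsupport θ ∪ tsupport ρ with hS
    have hSc : IsCompact S := hθcs.isCompact.union hρcs.isCompact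
    have hSs : S ⊆ Ioo 0 T := union_subset hθs hρs
    have hψS : ∀ t, t ∉ S → ψ t = 0 := by
      intro t ht
      rw [hS, mem_union, not_or] at ht
      simp [hψ, image_eq_zero_of_notMem_tsupport ht.1, image_eq_zero_of_notMem_tsupport ht.2]
    obtain ⟨a, b, ha, hb, hSab⟩ : ∃ a b, 0 < a ∧ b < T ∧ S ⊆ Icc a b := by
      rcases S.eq_empty_or_nonempty with he | hne
      · exact ⟨T / 2, T / 2, by positivity, by linarith, by simp [he]⟩
      · refine ⟨sInf S, sSup S, (hSs (hSc.sInf_mem hne)).1, (hSs (hSc.sSup_mem hne)).2, ?_⟩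
        exact fun x hx => ⟨csInf_le hSc.bddBelow hx, le_csSup hSc.bddAbove hx⟩
    set φ : ℝ → ℝ := fun t => ∫ s in (0 : ℝ)..t, ψ s with hφ
    have hφd : ∀ t, HasDerivAt φ (ψ t) t := fun t =>
      intervalIntegral.integral_hasDerivAt_right (hψc.continuous.intervalIntegrable _ _)
        hψc.continuous.stronglyMeasurable.stronglyMeasurableAtFilter hψc.continuous.continuousAt
    have hφ' : deriv φ = ψ := funext fun t => (hφd t).deriv
    have hφc : ContDiff ℝ ∞ φ := by
      rw [contDiff_infty_iff_deriv, hφ']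
      exact ⟨fun t => (hφd t).differentiableAt, hψc⟩
    have hφ0 : ∀ t, t ∉ Icc a b → φ t = 0 := by
      intro t ht
      rw [mem_Icc, not_and_or, not_le, not_le] at ht
      have hlow : ∀ s, s < a → ψ s = 0 := fun s hs => hψS s fun h => by
        linarith [(hSab h).1]
      have hup : ∀ s, b < s → ψ s = 0 := fun s hs => hψS s fun h => by
        linarith [(hSab h).2]
      rcases ht with ht | ht
      · simp only [hφ]
        refine (intervalIntegral.integral_congr (g := fun _ => (0 : ℝ)) fun s hs => hlow s ?_).trans
          (by simp)
        exact hs.2.trans_lt (max_lt ha ht)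
      · by_cases h0t : 0 ≤ t
        · simp only [hφ]
          rw [intervalIntegral.integral_of_le h0t, ← hψ0]
          refine setIntegral_eq_integral_of_forall_compl_eq_zero fun s hs => ?_
          rw [mem_Ioc, not_and_or, not_lt, not_le] at hs
          rcases hs with hs | hs
          · exact hlow s (by linarith)
          · exact hup s (by linarith)
        · simp only [hφ]
          refine (intervalIntegral.integral_congr (g := fun _ => (0 : ℝ))
            fun s hs => hlow s ?_).trans (by simp)
          exact hs.2.trans_lt (max_lt ha (by linarith))
    have hts : tsupport φ ⊆ Icc a b :=
      closure_minimal (fun t ht => by_contra fun h => ht (hφ0 t h)) isClosed_Icc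
    have := h φ hφc (HasCompactSupport.of_support_subset_isCompact isCompact_Icc
      ((subset_tsupport φ).trans hts))
      (hts.trans fun t ht => ⟨ha.trans_le ht.1, ht.2.trans_lt hb⟩)
    rwa [hφ'] at this
  set c : E := ∫ t in Ioo 0 T, ρ t • z t with hc
  have hsmul : ∀ θ : ℝ → ℝ, ContDiff ℝ ∞ θ → HasCompactSupport θ →
      IntegrableOn (fun t => θ t • z t) (Ioo 0 T) := by
    intro θ hθ hθcs
    obtain ⟨A, hA⟩ := hθcs.exists_bound_of_continuous hθ.continuous
    exact hzi.bdd_smul A hθ.continuous.aestronglyMeasurable (ae_of_all _ hA)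
  refine ⟨c, ?_⟩
  have := isOpen_Ioo.ae_eq_zero_of_integral_contDiff_smul_eq_zero (μ := volume)
    (f := (Ioo 0 T).indicator fun t => z t - c) (U := Ioo 0 T) ?_ ?_
  · rw [ae_restrict_iff' measurableSet_Ioo]
    filter_upwards [this] with t ht h
    simpa [h, sub_eq_zero] using ht h
  · refine IntegrableOn.locallyIntegrableOn ?_
    refine (IntegrableOn.integrable_indicator ?_ measurableSet_Ioo).integrableOn
    exact hzi.sub (by simp)
  · intro θ hθ hθcs hθs
    have hθi := hθ.continuous.integrable_of_hasCompactSupport (μ := volume) hθcs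
    have e1 : ∫ t in Ioo 0 T, θ t • z t = (∫ s, θ s) • c := by
      have := key θ hθ hθcs hθs
      simp only [sub_smul, mul_smul] at this
      rw [integral_sub (hsmul θ hθ hθcs) ((hsmul ρ hρ hρcs).fun_smul _), integral_smul,
        sub_eq_zero] at this
      exact this
    have e2 : ∫ t in Ioo 0 T, θ t = ∫ t, θ t :=
      setIntegral_eq_integral_of_forall_compl_eq_zero fun t ht =>
        image_eq_zero_of_notMem_tsupport fun h => ht (hθs h)
    have e3 : ∀ t, θ t • (Ioo 0 T).indicator (fun t => z t - c) t =
        (Ioo 0 T).indicator (fun t => θ t • z t - θ t • c) t := by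
      intro t; by_cases ht : t ∈ Ioo 0 T <;> simp [ht, smul_sub]
    simp_rw [e3]
    rw [integral_indicator measurableSet_Ioo, integral_sub (hsmul θ hθ hθcs)
      (hθi.integrableOn.smul_const c), e1, integral_smul_const, e2, sub_self]

/-- The lemma of du Bois-Reymond: if `y' = g` in the sense of distributions on `(0,T)`, then `y` is
a primitive of `g`. -/
theorem exists_ae_eq_add_primitive {y g : ℝ → E} {C D T : ℝ} (hT : 0 < T)
    (hy : AEStronglyMeasurable y volume) (hD : ∀ t, ‖y t‖ ≤ D)
    (hg : AEStronglyMeasurable g volume) (hC : ∀ t, ‖g t‖ ≤ C)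
    (h : ∀ φ : ℝ → ℝ, ContDiff ℝ ∞ φ → HasCompactSupport φ → tsupport φ ⊆ Ioo 0 T →
      ∫ t in Ioo 0 T, (deriv φ t • y t + φ t • g t) = 0) :
    ∃ c, ∀ᵐ t ∂(volume.restrict (Ioo 0 T)), y t = c + ∫ s in (0 : ℝ)..t, g s := by
  have hGL := lipschitzWith_primitive hg hC 0
  set G : ℝ → E := fun x => ∫ s in (0 : ℝ)..x, g s with hG
  obtain ⟨B, hB⟩ := isCompact_Icc.exists_bound_of_continuousOn
    (hGL.continuous.continuousOn (s := Icc 0 T))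
  have hB0 : 0 ≤ B := (norm_nonneg _).trans (hB 0 ⟨le_rfl, hT.le⟩)
  have hD0 : 0 ≤ D := (norm_nonneg _).trans (hD 0)
  obtain ⟨c, hc⟩ := ae_eq_const_of_integral_deriv_smul_eq_zero hT
    (z := (Ioo 0 T).indicator fun t => y t - G t) (C := D + B)
    ((hy.sub hGL.continuous.aestronglyMeasurable).indicator measurableSet_Ioo)
    (fun t => by
      by_cases ht : t ∈ Ioo 0 T
      · simpa [ht] using (norm_sub_le _ _).trans (add_le_add (hD t) (hB t ⟨ht.1.le, ht.2.le⟩))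
      · simp only [ht, not_false_eq_true, indicator_of_notMem, norm_zero]; positivity)
    (by
      intro φ hφ hcs hs
      have hφ1 : ContDiff ℝ 1 φ := hφ.of_le (by simp)
      have hφ'c : Continuous (deriv φ) := hφ1.continuous_deriv le_rfl
      obtain ⟨A, hA⟩ := hcs.exists_bound_of_continuous hφ1.continuous
      obtain ⟨A', hA'⟩ := hcs.deriv.exists_bound_of_continuous hφ'c
      have i1 : IntegrableOn (fun t => deriv φ t • y t) (Ioo 0 T) :=
        (integrableOn_of_bounded hy hD (by simp)).bdd_smul A'
          hφ'c.aestronglyMeasurable (ae_of_all _ hA')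
      have i2 : IntegrableOn (fun t => φ t • g t) (Ioo 0 T) :=
        (integrableOn_of_bounded hg hC (by simp)).bdd_smul A
          hφ1.continuous.aestronglyMeasurable (ae_of_all _ hA)
      have i3 : IntegrableOn (fun t => deriv φ t • G t) (Ioo 0 T) :=
        ((hφ'c.smul hGL.continuous).integrable_of_hasCompactSupport
          (hcs.deriv.smul_right (f' := G))).integrableOn
      have e1 := h φ hφ hcs hs
      have e2 := integral_deriv_smul_primitive hT hg hC hφ hcs hs
      rw [integral_add i1 i2] at e1
      rw [integral_add i3 i2] at e2
      rw [setIntegral_congr_fun (g := fun t => deriv φ t • y t - deriv φ t • G t)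
        measurableSet_Ioo (fun t ht => by simp [ht, smul_sub]), integral_sub i1 i3,
        eq_neg_of_add_eq_zero_left e1, eq_neg_of_add_eq_zero_left e2, sub_self])
  refine ⟨c, ?_⟩
  rw [ae_restrict_iff' measurableSet_Ioo] at hc ⊢
  filter_upwards [hc] with t ht h
  have := ht h
  rw [indicator_of_mem h] at this
  rw [← this]; abel

/-- The energy identity for a primitive in a Hilbert space. -/
theorem norm_sq_primitive_sub {F : Type*} [NormedAddCommGroup F] [InnerProductSpace ℂ F]
    [CompleteSpace F] {g : ℝ → F} {C T : ℝ} (c : F)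
    (hg : AEStronglyMeasurable g volume) (hC : ∀ t, ‖g t‖ ≤ C) {a b : ℝ} (ha : a ∈ Icc 0 T)
    (hb : b ∈ Icc 0 T) (Y : ℝ → F) (hY : Y = fun t => c + ∫ s in (0 : ℝ)..t, g s) :
    ‖Y b‖ ^ 2 - ‖Y a‖ ^ 2 = ∫ t in a..b, 2 * (inner ℂ (Y t) (g t)).re := by
  let _ := InnerProductSpace.rclikeToReal ℂ F
  have hYL : LipschitzWith C.toNNReal Y := by
    have := lipschitzWith_primitive hg hC 0
    rw [hY]
    refine LipschitzWith.of_dist_le_mul fun x y => ?_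
    rw [dist_add_left]; exact this.dist_le_mul x y
  obtain ⟨B, hB⟩ := isCompact_Icc.exists_bound_of_continuousOn
    (hYL.continuous.continuousOn (s := Icc 0 T))
  have hsub : uIcc a b ⊆ Icc 0 T := uIcc_subset_Icc ha hb
  have hB0 : 0 ≤ B := (norm_nonneg _).trans (hB a ha)
  have hC0 : 0 ≤ C := (norm_nonneg _).trans (hC 0)
  have hAC : AbsolutelyContinuousOnInterval (fun t => ‖Y t‖ ^ 2) a b := by
    refine LipschitzOnWith.absolutelyContinuousOnInterval (K := (2 * B * C).toNNReal) ?_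
    refine LipschitzOnWith.of_dist_le_mul fun x hx y hy => ?_
    rw [Real.coe_toNNReal _ (by positivity), Real.dist_eq]
    have h1 : |‖Y x‖ - ‖Y y‖| ≤ C * dist x y := by
      refine (abs_norm_sub_norm_le _ _).trans ?_
      rw [← dist_eq_norm]
      have := hYL.dist_le_mul x y
      rwa [Real.coe_toNNReal _ hC0] at this
    have h2 : |‖Y x‖ + ‖Y y‖| ≤ 2 * B := by
      rw [abs_of_nonneg (by positivity)]
      linarith [hB x (hsub hx), hB y (hsub hy)]
    rw [sq_sub_sq, abs_mul]
    calc _ ≤ (2 * B) * (C * dist x y) := by gcongr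
      _ = _ := by ring
  have key := sub_eq_integral_of_ae_hasDerivAt (C := 2 * (B * C)) hAC
    (k := (Icc 0 T).indicator fun t => 2 * (inner ℂ (Y t) (g t)).re)
    ((((hYL.continuous.aestronglyMeasurable.inner (𝕜 := ℂ) hg).re).const_mul 2).indicator
      measurableSet_Icc)
    (fun t => by
      by_cases ht : t ∈ Icc 0 T
      · rw [indicator_of_mem ht, norm_mul, Real.norm_ofNat]
        gcongr
        calc _ ≤ ‖inner ℂ (Y t) (g t)‖ := Complex.abs_re_le_norm _
          _ ≤ ‖Y t‖ * ‖g t‖ := norm_inner_le_norm _ _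
          _ ≤ B * C := mul_le_mul (hB t ht) (hC t) (norm_nonneg _) hB0
      · simp only [ht, not_false_eq_true, indicator_of_notMem, norm_zero]; positivity)
    (by
      filter_upwards [ae_hasDerivAt_primitive hg hC] with t ht hmem
      have hd : HasDerivAt Y (g t) t := by
        rw [hY]; exact (ht 0).const_add c
      rw [indicator_of_mem (hsub hmem)]
      exact hd.norm_sq)
  rw [key]
  refine intervalIntegral.integral_congr fun t ht => ?_
  simp only [indicator_of_mem (hsub ht)]

end Calculus

/-! ### Regularisation and the energy identity -/

section Resolvent

open ContinuousLinearMap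

variable {H V : Type*} [NormedAddCommGroup H] [InnerProductSpace ℂ H] [CompleteSpace H]
  [NormedAddCommGroup V] [InnerProductSpace ℂ V] [CompleteSpace V]

/-- For `j : V → H`, the positive operator `S = j j*` on `H`. If `V = H^1` and `H = L^2`, then
`S = (1 - Δ)⁻¹`. -/
noncomputable def smoothing (j : V →L[ℂ] H) : H →L[ℂ] H := j ∘L adjoint j

theorem inner_smoothing_left (j : V →L[ℂ] H) (x y : H) :
    inner ℂ (smoothing j x) y = inner ℂ (adjoint j x) (adjoint j y) := by
  simp [smoothing, ContinuousLinearMap.adjoint_inner_right]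

theorem inner_smoothing_comm (j : V →L[ℂ] H) (x y : H) :
    inner ℂ (smoothing j x) y = inner ℂ x (smoothing j y) := by
  rw [inner_smoothing_left, ← inner_conj_symm x, inner_smoothing_left, inner_conj_symm]

theorem inner_smoothing_self (j : V →L[ℂ] H) (x : H) :
    inner ℂ (smoothing j x) x = ((‖adjoint j x‖ ^ 2 : ℝ) : ℂ) := by
  rw [inner_smoothing_left, inner_self_eq_norm_sq_to_K]; simp

/-- The resolvent `R = (S + ε)⁻¹` of `S = j j*`. The regularisation `R S` is a contraction, and it
is within `√ε ‖v‖` of the identity at a point `j v`. -/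
theorem exists_resolvent (j : V →L[ℂ] H) {ε : ℝ} (hε : 0 < ε) :
    ∃ R : H →L[ℂ] H, (∀ x, R (smoothing j x) = smoothing j (R x)) ∧
      (∀ x y, inner ℂ (R x) y = inner ℂ x (R y)) ∧
      (∀ x, ‖R (smoothing j x)‖ ≤ ‖x‖) ∧
      (∀ v, ‖R (smoothing j (j v)) - j v‖ ≤ Real.sqrt ε * ‖v‖) := by
  set A : H →L[ℂ] H := smoothing j + (ε : ℂ) • ContinuousLinearMap.id ℂ H with hA
  have hAx : ∀ x, A x = smoothing j x + (ε : ℂ) • x := fun x => by simp [hA]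
  have hin : ∀ x, inner ℂ (A x) x = ((‖adjoint j x‖ ^ 2 + ε * ‖x‖ ^ 2 : ℝ) : ℂ) := fun x => by
    rw [hAx, inner_add_left, inner_smoothing_self, inner_smul_left,
      inner_self_eq_norm_sq_to_K]; simp
  have hu : IsUnit A := by
    refine isUnit_of_forall_le_norm_inner_map A (c := ⟨ε, hε.le⟩) hε fun x => ?_
    rw [hin, Complex.norm_real, Real.norm_of_nonneg (by positivity)]
    change ‖x‖ ^ 2 * ε ≤ _
    nlinarith [sq_nonneg ‖adjoint j x‖]
  obtain ⟨u, hu⟩ := hu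
  set R : H →L[ℂ] H := ↑u⁻¹ with hR
  have hAR : ∀ x, A (R x) = x := fun x => by
    have : (u : H →L[ℂ] H) * ↑u⁻¹ = 1 := u.mul_inv
    rw [hu] at this
    exact congrArg (fun f : H →L[ℂ] H => f x) this
  have hRA : ∀ x, R (A x) = x := fun x => by
    have : ↑u⁻¹ * (u : H →L[ℂ] H) = 1 := u.inv_mul
    rw [hu] at this
    exact congrArg (fun f : H →L[ℂ] H => f x) this
  have hcomm : ∀ x, R (smoothing j x) = smoothing j (R x) := fun x => by
    have h1 : smoothing j x = A (smoothing j (R x)) := by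
      conv_lhs => rw [← hAR x]
      rw [hAx, hAx, map_add, map_smul]
    rw [h1, hRA]
  have hAsymm : ∀ x y, inner ℂ (A x) y = inner ℂ x (A y) := fun x y => by
    rw [hAx, hAx, inner_add_left, inner_add_right, inner_smoothing_comm, inner_smul_left,
      inner_smul_right]; simp
  refine ⟨R, hcomm, fun x y => ?_, fun x => ?_, fun v => ?_⟩
  · conv_lhs => rw [← hAR y]
    rw [← hAsymm, hAR]
  · rw [hcomm]
    conv_rhs => rw [← hAR x]
    refine le_of_sq_le_sq ?_ (norm_nonneg _)
    rw [hAx, @norm_add_sq ℂ, inner_smul_right, inner_smoothing_self]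
    have : RCLike.re ((ε : ℂ) * ((‖adjoint j (R x)‖ ^ 2 : ℝ) : ℂ)) =
        ε * ‖adjoint j (R x)‖ ^ 2 := by
      rw [← Complex.ofReal_mul]; exact Complex.ofReal_re _
    rw [this]
    have : 0 ≤ ε * ‖adjoint j (R x)‖ ^ 2 := by positivity
    nlinarith [sq_nonneg ‖(ε : ℂ) • R x‖]
  · set x := R (j v) with hx
    have e1 : R (smoothing j (j v)) - j v = -((ε : ℂ) • x) := by
      rw [hcomm, ← hx]
      conv_lhs => rw [← hAR (j v), ← hx, hAx]
      abel
    rw [e1, norm_neg, norm_smul, Complex.norm_real, Real.norm_of_nonneg hε.le]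
    have h1 : inner ℂ (A x) x = inner ℂ v (adjoint j x) := by
      rw [hx, hAR, ContinuousLinearMap.adjoint_inner_right]
    have h2 : ‖adjoint j x‖ ^ 2 + ε * ‖x‖ ^ 2 ≤ ‖v‖ * ‖adjoint j x‖ := by
      have := norm_inner_le_norm (𝕜 := ℂ) v (adjoint j x)
      rw [← h1, hin, Complex.norm_real, Real.norm_of_nonneg (by positivity)] at this
      exact this
    have h3 : ε * ‖x‖ ^ 2 ≤ ‖v‖ ^ 2 := by
      nlinarith [sq_nonneg (‖v‖ - 2 * ‖adjoint j x‖), sq_nonneg ‖v‖]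
    have h4 : (ε * ‖x‖) ^ 2 ≤ (Real.sqrt ε * ‖v‖) ^ 2 := by
      rw [mul_pow, mul_pow, Real.sq_sqrt hε.le]
      nlinarith
    exact le_of_sq_le_sq h4 (by positivity)

end Resolvent

section Evolution

theorem le_on_Icc_of_ae_le {f : ℝ → ℝ} {c T : ℝ} (hT : 0 < T) (hf : ContinuousOn f (Icc 0 T))
    (h : ∀ᵐ t ∂(volume.restrict (Ioo 0 T)), f t ≤ c) : ∀ t ∈ Icc 0 T, f t ≤ c := by
  have := Measure.eqOn_Icc_of_ae_eq volume hT.ne (f := fun t => max (f t) c) (g := fun _ => c)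
    (by
      rw [restrict_Ioo_eq_restrict_Icc] at h
      filter_upwards [h] with t ht using max_eq_right ht)
    (hf.sup continuousOn_const) continuousOn_const
  exact fun t ht => max_eq_right_iff.1 (this ht)

/-- A measurable function that is almost everywhere bounded on `s` agrees almost everywhere on `s`
with a measurable function that is bounded everywhere. -/
theorem exists_bounded_version {E : Type*} [NormedAddCommGroup E] {f : ℝ → E} {C : ℝ} (hC : 0 ≤ C)
    {s : Set ℝ} (hs : MeasurableSet s) (hf : AEStronglyMeasurable f (volume.restrict s))
    (hb : ∀ᵐ t ∂(volume.restrict s), ‖f t‖ ≤ C) :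
    ∃ f' : ℝ → E, AEStronglyMeasurable f' volume ∧ (∀ t, ‖f' t‖ ≤ C) ∧
      f' =ᵐ[volume.restrict s] f := by
  have hm := hf.stronglyMeasurable_mk
  set A : Set ℝ := s ∩ {t | ‖hf.mk f t‖ ≤ C} with hA
  have hAm : MeasurableSet A := hs.inter (hm.norm.measurable measurableSet_Iic)
  refine ⟨A.indicator (hf.mk f), (hm.indicator hAm).aestronglyMeasurable, fun t => ?_, ?_⟩
  · by_cases ht : t ∈ A
    · simpa [ht] using ht.2
    · simpa [ht] using hC
  · filter_upwards [hf.ae_eq_mk, hb, ae_restrict_mem hs] with t h1 h2 h3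
    have : t ∈ A := ⟨h3, by rw [mem_ofPred_eq, ← h1]; exact h2⟩
    rw [indicator_of_mem this, h1]

open ContinuousLinearMap

variable {H V : Type*} [NormedAddCommGroup H] [InnerProductSpace ℂ H] [CompleteSpace H]
  [NormedAddCommGroup V] [InnerProductSpace ℂ V] [CompleteSpace V]

/-- The weak form, tested against `φ(t) j* h` with `φ ∈ C_c^∞(0,T)` and `h ∈ H`, of the equation
`i w' - A w + m = 0`, where `A` is the operator on `H` with form `⟨v, v'⟩_V`; as `S = j j*` inverts
`A`, it says that `(S w)' = i (S m - w)`. -/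
def IsWeakEvolution (j : V →L[ℂ] H) (T : ℝ) (w m : ℝ → H) : Prop :=
  ∀ (φ : ℝ → ℝ) (h : H), ContDiff ℝ ∞ φ → HasCompactSupport φ → tsupport φ ⊆ Ioo 0 T →
    ∫ t in Ioo 0 T, (-Complex.I * ((deriv φ t : ℝ) : ℂ) * inner ℂ (smoothing j h) (w t)
      - (φ t : ℂ) * inner ℂ h (w t) + (φ t : ℂ) * inner ℂ (smoothing j h) (m t)) = 0

/-- The regularisation `R S w` of a weak solution, with `R = (S + ε)⁻¹`, has a Lipschitz version,
and it satisfies the energy identity up to an error of order `√ε`. -/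
theorem exists_regularized_version {j : V →L[ℂ] H} {T C : ℝ} (hT : 0 < T) (hC0 : 0 ≤ C)
    {w m : ℝ → H} (hw : AEStronglyMeasurable w volume) (hm : AEStronglyMeasurable m volume)
    (hwC : ∀ t, ‖w t‖ ≤ C) (hmC : ∀ t, ‖m t‖ ≤ C)
    (hW : ∀ᵐ t ∂(volume.restrict (Ioo 0 T)), ∃ v, ‖v‖ ≤ C ∧ j v = w t)
    (heq : IsWeakEvolution j T w m) {ε : ℝ} (hε : 0 < ε) :
    ∃ Y : ℝ → H, Continuous Y ∧
      (∀ᵐ t ∂(volume.restrict (Ioo 0 T)), ‖Y t - w t‖ ≤ Real.sqrt ε * C) ∧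
      ∀ a ∈ Icc 0 T, ∀ b ∈ Icc 0 T, a ≤ b →
        |‖Y b‖ ^ 2 - ‖Y a‖ ^ 2 - ∫ t in a..b, 2 * (inner ℂ (w t) (Complex.I • m t)).re| ≤
          4 * Real.sqrt ε * C ^ 2 * T := by
  obtain ⟨R, hcomm, hsymm, hcontr, happ⟩ := exists_resolvent j hε
  set S := smoothing j with hS
  set y : ℝ → H := fun t => R (S (w t)) with hy
  set g : ℝ → H := fun t => Complex.I • R (S (m t) - w t) with hg
  have hym : AEStronglyMeasurable y volume :=
    (R.continuous.comp S.continuous).comp_aestronglyMeasurable hw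
  have hgm : AEStronglyMeasurable g volume :=
    (R.continuous.comp_aestronglyMeasurable
      ((S.continuous.comp_aestronglyMeasurable hm).sub hw)).const_smul _
  have hyC : ∀ t, ‖y t‖ ≤ C := fun t => (hcontr _).trans (hwC t)
  obtain ⟨D, hgD⟩ : ∃ D, ∀ t, ‖g t‖ ≤ D := by
    refine ⟨‖R‖ * (‖S‖ * C + C), fun t => ?_⟩
    rw [hg]
    simp only [norm_smul, Complex.norm_I, one_mul]
    refine (R.le_opNorm _).trans ?_
    gcongr
    refine (norm_sub_le _ _).trans (add_le_add ((S.le_opNorm _).trans ?_) (hwC t))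
    gcongr
    exact hmC t
  -- `y' = g` in the sense of distributions: test the equation with `R h`
  have hdist : ∀ φ : ℝ → ℝ, ContDiff ℝ ∞ φ → HasCompactSupport φ → tsupport φ ⊆ Ioo 0 T →
      ∫ t in Ioo 0 T, (deriv φ t • y t + φ t • g t) = 0 := by
    intro φ hφ hcs hs
    have hφ1 : ContDiff ℝ 1 φ := hφ.of_le (by simp)
    have hφ'c : Continuous (deriv φ) := hφ1.continuous_deriv le_rfl
    obtain ⟨A, hA⟩ := hcs.exists_bound_of_continuous hφ1.continuous
    obtain ⟨A', hA'⟩ := hcs.deriv.exists_bound_of_continuous hφ'c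
    have i1 : IntegrableOn (fun t => deriv φ t • y t) (Ioo 0 T) :=
      (integrableOn_of_bounded hym hyC (by simp)).bdd_smul (𝕜 := ℝ) A'
        hφ'c.aestronglyMeasurable (ae_of_all _ hA')
    have i2 : IntegrableOn (fun t => φ t • g t) (Ioo 0 T) :=
      (integrableOn_of_bounded hgm hgD (by simp)).bdd_smul (𝕜 := ℝ) A
        hφ1.continuous.aestronglyMeasurable (ae_of_all _ hA)
    refine ext_inner_left ℂ fun h => ?_
    refine (integral_inner (𝕜 := ℂ) (i1.add i2) h).symm.trans ?_
    rw [inner_zero_right,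
      ← mul_zero Complex.I, ← heq φ (R h) hφ hcs hs, ← integral_const_mul]
    refine integral_congr_ae (ae_of_all _ fun t => ?_)
    have e1 : inner ℂ (S (R h)) (w t) = inner ℂ h (R (S (w t))) := by
      rw [← hcomm, hsymm, inner_smoothing_comm, ← hS, hcomm]
    have e2 : inner ℂ (S (R h)) (m t) = inner ℂ h (R (S (m t))) := by
      rw [← hcomm, hsymm, inner_smoothing_comm, ← hS, hcomm]
    have e3 : ∀ (r : ℝ) (x : H), inner ℂ h (r • x) = (r : ℂ) * inner ℂ h x := fun r x => by
      rw [← Complex.coe_smul, inner_smul_right]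
    simp only [Pi.add_apply, ← hS, hy, hg, e1, e2, hsymm h (w t), inner_add_right, e3,
      inner_smul_right, map_sub, inner_sub_right]
    linear_combination (((deriv φ t : ℝ) : ℂ) * inner ℂ h (R (S (w t)))) * Complex.I_mul_I
  obtain ⟨c, hc⟩ := exists_ae_eq_add_primitive hT hym hyC hgm hgD hdist
  set Y : ℝ → H := fun t => c + ∫ s in (0 : ℝ)..t, g s with hYdef
  have hYc : Continuous Y := continuous_const.add (lipschitzWith_primitive hgm hgD 0).continuous
  refine ⟨Y, hYc, ?_, ?_⟩
  · filter_upwards [hc, hW] with t h1 ⟨v, hv, hvw⟩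
    change y t = Y t at h1
    rw [← h1, hy]
    simp only
    rw [← hvw]
    exact (happ v).trans (by gcongr)
  · intro a ha b hb hab
    rw [norm_sq_primitive_sub c hgm hgD ha hb Y hYdef]
    have hwm : AEStronglyMeasurable (fun t => 2 * (inner ℂ (w t) (Complex.I • m t)).re) volume :=
      ((hw.inner (𝕜 := ℂ) (hm.const_smul Complex.I)).re).const_mul 2
    have hwmC : ∀ t, ‖2 * (inner ℂ (w t) (Complex.I • m t)).re‖ ≤ 2 * (C * C) := fun t => by
      rw [norm_mul, Real.norm_ofNat]
      gcongr
      refine (Complex.abs_re_le_norm _).trans ((norm_inner_le_norm _ _).trans ?_)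
      rw [norm_smul, Complex.norm_I, one_mul]
      exact mul_le_mul (hwC t) (hmC t) (norm_nonneg _) hC0
    have hYg : ContinuousOn Y (Icc 0 T) := hYc.continuousOn
    obtain ⟨B, hB⟩ := isCompact_Icc.exists_bound_of_continuousOn hYg
    have hB0 : 0 ≤ B := (norm_nonneg _).trans (hB a ha)
    have i1 : IntervalIntegrable (fun t => 2 * (inner ℂ (Y t) (g t)).re) volume a b := by
      rw [intervalIntegrable_iff_integrableOn_Ioc_of_le hab]
      refine Measure.integrableOn_of_bounded (M := 2 * (B * D)) (by simp)
        (((hYc.aestronglyMeasurable.inner (𝕜 := ℂ) hgm).re).const_mul 2) ?_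
      filter_upwards [ae_restrict_mem measurableSet_Ioc] with t ht
      rw [norm_mul, Real.norm_ofNat]
      gcongr
      refine (Complex.abs_re_le_norm _).trans ((norm_inner_le_norm _ _).trans ?_)
      exact mul_le_mul (hB t ⟨ha.1.trans ht.1.le, ht.2.trans hb.2⟩) (hgD t) (norm_nonneg _) hB0
    rw [← intervalIntegral.integral_sub i1 (intervalIntegrable_of_bounded hwm hwmC a b)]
    have hbound : ∀ᵐ t ∂volume, t ∈ Ioc a b →
        ‖2 * (inner ℂ (Y t) (g t)).re - 2 * (inner ℂ (w t) (Complex.I • m t)).re‖ ≤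
          4 * Real.sqrt ε * C ^ 2 := by
      rw [← ae_restrict_iff' measurableSet_Ioc]
      have hsub : Ioc a b ⊆ Ioc 0 T := Ioc_subset_Ioc ha.1 hb.2
      rw [restrict_Ioo_eq_restrict_Ioc] at hc hW
      filter_upwards [ae_restrict_of_ae_restrict_of_subset hsub hc,
        ae_restrict_of_ae_restrict_of_subset hsub hW] with t h1 ⟨v, hv, hvw⟩
      change y t = Y t at h1
      -- the term with `w` of the energy vanishes, because `⟨S x, x⟩` is real for `x = R w`
      have e0 : (inner ℂ (R (S (w t))) (Complex.I • R (w t))).re = 0 := by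
        rw [hcomm, inner_smul_right, inner_smoothing_self, mul_comm, Complex.re_ofReal_mul]
        simp
      have e1 : (inner ℂ (Y t) (g t)).re =
          (inner ℂ (R (S (R (S (w t))))) (Complex.I • m t)).re := by
        rw [← h1]
        simp only [hy, hg, map_sub, smul_sub, inner_sub_right, Complex.sub_re, e0, sub_zero]
        rw [inner_smul_right, inner_smul_right]
        congr 2
        rw [← hsymm, hS, ← inner_smoothing_comm, ← hS, ← hcomm]
      rw [e1, ← mul_sub, norm_mul, Real.norm_ofNat, ← Complex.sub_re, ← inner_sub_left]
      -- each of the two applications of the contraction `R S` costs `√ε C`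
      have e2 : ‖R (S (R (S (w t)))) - w t‖ ≤ 2 * Real.sqrt ε * C := by
        have f1 : ‖R (S (w t)) - w t‖ ≤ Real.sqrt ε * C := by
          rw [← hvw]; exact (happ v).trans (by gcongr)
        have f2 : ‖R (S (R (S (w t)) - w t))‖ ≤ Real.sqrt ε * C := (hcontr _).trans f1
        rw [map_sub, map_sub] at f2
        calc _ = ‖(R (S (R (S (w t)))) - R (S (w t))) + (R (S (w t)) - w t)‖ := by congr 1; abel
          _ ≤ _ := norm_add_le _ _
          _ ≤ _ := by linarith
      have e3 := (Complex.abs_re_le_norm _).trans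
        (norm_inner_le_norm (𝕜 := ℂ) (R (S (R (S (w t)))) - w t) (Complex.I • m t))
      rw [norm_smul, Complex.norm_I, one_mul] at e3
      have e4 := mul_le_mul e2 (hmC t) (norm_nonneg _) (by positivity)
      rw [Real.norm_eq_abs]
      nlinarith
    have := intervalIntegral.norm_integral_le_of_norm_le_const_ae
      (a := a) (b := b) (C := 4 * Real.sqrt ε * C ^ 2) (by
        rw [uIoc_of_le hab]; exact hbound)
    rw [Real.norm_eq_abs] at this
    refine this.trans ?_
    rw [abs_of_nonneg (by linarith)]
    have h3 : b - a ≤ T := by linarith [ha.1, hb.2]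
    gcongr

/-- A bounded weak solution of `i w' - A w + m = 0` with values in the form domain has a continuous
version, and it satisfies the energy identity. -/
theorem exists_continuous_version_energy {j : V →L[ℂ] H} {T C : ℝ} (hT : 0 < T) (hC0 : 0 ≤ C)
    {w m : ℝ → H} (hw : AEStronglyMeasurable w (volume.restrict (Ioo 0 T)))
    (hm : AEStronglyMeasurable m (volume.restrict (Ioo 0 T)))
    (hmC : ∀ᵐ t ∂(volume.restrict (Ioo 0 T)), ‖m t‖ ≤ C)
    (hW : ∀ᵐ t ∂(volume.restrict (Ioo 0 T)), ∃ v, ‖v‖ ≤ C ∧ j v = w t)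
    (heq : IsWeakEvolution j T w m) :
    ∃ Y : ℝ → H, ContinuousOn Y (Icc 0 T) ∧
      (∀ᵐ t ∂(volume.restrict (Ioo 0 T)), Y t = w t) ∧
      ∀ a ∈ Icc 0 T, ∀ b ∈ Icc 0 T, a ≤ b →
        ‖Y b‖ ^ 2 - ‖Y a‖ ^ 2 = ∫ t in a..b, 2 * (inner ℂ (w t) (Complex.I • m t)).re := by
  have hwb : ∀ᵐ t ∂(volume.restrict (Ioo 0 T)), ‖w t‖ ≤ (1 + ‖j‖) * C := by
    filter_upwards [hW] with t ⟨v, hv, hvw⟩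
    rw [← hvw]
    have := j.le_opNorm v
    nlinarith [norm_nonneg j, norm_nonneg v, mul_le_mul_of_nonneg_left hv (norm_nonneg j)]
  have hCC : C ≤ (1 + ‖j‖) * C := by nlinarith [mul_nonneg (norm_nonneg j) hC0]
  -- change `w` and `m` on null sets and outside of `(0,T)` so that they are bounded everywhere
  obtain ⟨w', hw'm, hw'C, hw'⟩ := exists_bounded_version (hC0.trans hCC) measurableSet_Ioo hw hwb
  obtain ⟨m', hm'm, hm'C, hm'⟩ := exists_bounded_version (hC0.trans hCC) measurableSet_Ioo hm
    (hmC.mono fun t ht => ht.trans hCC)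
  set K := (1 + ‖j‖) * C with hK
  have hK0 : 0 ≤ K := hC0.trans hCC
  have hW' : ∀ᵐ t ∂(volume.restrict (Ioo 0 T)), ∃ v, ‖v‖ ≤ K ∧ j v = w' t := by
    filter_upwards [hW, hw'] with t ⟨v, hv, hvw⟩ h
    exact ⟨v, hv.trans hCC, hvw.trans h.symm⟩
  have heq' : IsWeakEvolution j T w' m' := fun φ h h1 h2 h3 => by
    rw [← heq φ h h1 h2 h3]
    refine integral_congr_ae ?_
    filter_upwards [hw', hm'] with t e1 e2
    rw [e1, e2]
  -- the choice `ε = (n + 1)⁻²` makes the errors `√ε` equal to `(n + 1)⁻¹`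
  have hε : ∀ n : ℕ, (0 : ℝ) < (1 / ((n : ℝ) + 1)) ^ 2 := fun n => by positivity
  choose Y hYc hYw hYe using fun n : ℕ =>
    exists_regularized_version hT hK0 hw'm hm'm hw'C hm'C hW' heq' (hε n)
  have hsq : ∀ n : ℕ, Real.sqrt ((1 / ((n : ℝ) + 1)) ^ 2) = 1 / ((n : ℝ) + 1) := fun n =>
    Real.sqrt_sq (by positivity)
  simp only [hsq] at hYw hYe
  -- two regularisations are close almost everywhere, hence everywhere on `[0,T]` by continuity
  have hdiff : ∀ n k, ∀ t ∈ Icc 0 T,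
      ‖Y n t - Y k t‖ ≤ 1 / ((n : ℝ) + 1) * K + 1 / ((k : ℝ) + 1) * K := by
    intro n k
    refine le_on_Icc_of_ae_le hT ((hYc n).sub (hYc k)).norm.continuousOn ?_
    filter_upwards [hYw n, hYw k] with t h1 h2
    calc ‖Y n t - Y k t‖ = ‖(Y n t - w' t) - (Y k t - w' t)‖ := by congr 1; abel
      _ ≤ _ := norm_sub_le _ _
      _ ≤ _ := add_le_add h1 h2
  have hlim : Tendsto (fun n : ℕ => 1 / ((n : ℝ) + 1) * K) atTop (𝓝 0) := by
    simpa using tendsto_one_div_add_atTop_nhds_zero_nat.mul_const K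
  have hU : UniformCauchySeqOn Y atTop (Icc 0 T) := by
    rw [Metric.uniformCauchySeqOn_iff]
    intro δ hδ
    obtain ⟨N, hN⟩ := (hlim.eventually (gt_mem_nhds (half_pos hδ))).exists_forall_of_atTop
    refine ⟨N, fun n hn k hk t ht => ?_⟩
    rw [dist_eq_norm]
    linarith [hdiff n k t ht, hN n hn, hN k hk]
  have hpt : ∀ t, ∃ z, t ∈ Icc 0 T → Tendsto (fun n => Y n t) atTop (𝓝 z) := fun t => by
    by_cases ht : t ∈ Icc 0 T
    · obtain ⟨z, hz⟩ := cauchySeq_tendsto_of_complete (hU.cauchySeq ht)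
      exact ⟨z, fun _ => hz⟩
    · exact ⟨0, fun h => absurd h ht⟩
  choose Z hZ using hpt
  have hunif := hU.tendstoUniformlyOn_of_tendsto hZ
  refine ⟨Z, hunif.continuousOn (Frequently.of_forall fun n => (hYc n).continuousOn), ?_, ?_⟩
  · filter_upwards [ae_all_iff.2 hYw, hw', ae_restrict_mem measurableSet_Ioo] with t h1 h2 h3
    rw [← h2]
    refine tendsto_nhds_unique (hZ t ⟨h3.1.le, h3.2.le⟩) ?_
    rw [tendsto_iff_norm_sub_tendsto_zero]
    exact squeeze_zero (fun _ => norm_nonneg _) h1 hlim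
  · intro a ha b hb hab
    have e : ∫ t in a..b, 2 * (inner ℂ (w t) (Complex.I • m t)).re =
        ∫ t in a..b, 2 * (inner ℂ (w' t) (Complex.I • m' t)).re := by
      rw [intervalIntegral.integral_of_le hab, intervalIntegral.integral_of_le hab]
      refine integral_congr_ae ?_
      have hsub : Ioc a b ⊆ Ioc 0 T := Ioc_subset_Ioc ha.1 hb.2
      rw [restrict_Ioo_eq_restrict_Ioc] at hw' hm'
      filter_upwards [ae_restrict_of_ae_restrict_of_subset hsub hw',
        ae_restrict_of_ae_restrict_of_subset hsub hm'] with t h1 h2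
      rw [h1, h2]
    rw [e, ← sub_eq_zero]
    have l1 := (((hZ b hb).norm.pow 2).sub ((hZ a ha).norm.pow 2)).sub_const
      (∫ t in a..b, 2 * (inner ℂ (w' t) (Complex.I • m' t)).re)
    refine tendsto_nhds_unique l1 ?_
    refine squeeze_zero_norm (fun n => (hYe n a ha b hb hab)) ?_
    have := (tendsto_one_div_add_atTop_nhds_zero_nat (𝕜 := ℝ)).mul_const (4 * K ^ 2 * T)
    rw [zero_mul] at this
    refine this.congr fun n => ?_
    ring

end Evolution

/-! ### Covectors and the metric at a point -/

section PointwiseMetric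

open Matrix

variable {d : ℕ} {M : Type*} [TopologicalSpace M] [ChartedSpace (Model d) M]

/-- The coordinates of a tangent vector in the basis `frame x`. -/
def frameCoord {x : M} (v : TangentSpace 𝓘(ℝ, Model d) x) : Fin d → ℝ :=
  WithLp.ofLp (show Model d from v)

theorem tangent_eq_sum_frame {x : M} (v : TangentSpace 𝓘(ℝ, Model d) x) :
    v = ∑ i, frameCoord v i • (frame x i : TangentSpace 𝓘(ℝ, Model d) x) := by
  have : ∀ w : Model d, w = ∑ i, w.ofLp i • (EuclideanSpace.single i (1 : ℝ) : Model d) := by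
    intro w
    ext k
    simp [Pi.single_apply]
  exact this v

theorem covec_apply_eq_sum {x : M} (α : Covec d x) (v : TangentSpace 𝓘(ℝ, Model d) x) :
    α v = ∑ i, (frameCoord v i : ℂ) * α (frame x i) := by
  conv_lhs => rw [tangent_eq_sum_frame v]
  simp

variable [IsManifold 𝓘(ℝ, Model d) ∞ M]

theorem metric_sum_eq_gram (g : SmoothMetric d M) (x : M) (v w : Fin d → ℝ)
    (b : Fin d → TangentSpace 𝓘(ℝ, Model d) x) :
    g.inner x (∑ i, v i • b i) (∑ i, w i • b i) = v ⬝ᵥ (gram g x b *ᵥ w) := by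
  simp only [map_sum, map_smul, _root_.sum_apply, _root_.smul_apply,
    smul_eq_mul, dotProduct, mulVec, gram, Matrix.of_apply, Finset.mul_sum]
  rw [Finset.sum_comm]
  refine Finset.sum_congr rfl fun i _ => Finset.sum_congr rfl fun k _ => ?_
  ring

theorem metric_eq_gram (g : SmoothMetric d M) (x : M) (v w : TangentSpace 𝓘(ℝ, Model d) x) :
    g.inner x v w = frameCoord v ⬝ᵥ (gram g x (frame x) *ᵥ frameCoord w) := by
  conv_lhs => rw [tangent_eq_sum_frame v, tangent_eq_sum_frame w]
  exact metric_sum_eq_gram g x _ _ _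

theorem posDef_gram_frame (g : SmoothMetric d M) (x : M) : (gram g x (frame x)).PosDef := by
  refine Matrix.PosDef.of_dotProduct_mulVec_pos ?_ fun v hv => ?_
  · ext i j
    simp [gram, g.symm x (frame x i)]
  · rw [star_trivial, ← metric_sum_eq_gram]
    refine g.pos x _ fun h => hv ?_
    have : (∑ i, v i • (EuclideanSpace.single i (1 : ℝ) : Model d)) = 0 := h
    ext k
    have h2 := congrArg (fun w : Model d => w.ofLp k) this
    simpa [Pi.single_apply] using h2

theorem exists_eq_transpose_mul_self {P : Matrix (Fin d) (Fin d) ℝ} (hP : P.PosSemidef) :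
    ∃ B : Matrix (Fin d) (Fin d) ℝ, P = Bᵀ * B := by
  open scoped MatrixOrder Matrix.Norms.L2Operator in
  obtain ⟨B, hB⟩ := CStarAlgebra.nonneg_iff_eq_star_mul_self.1 (Matrix.nonneg_iff_posSemidef.2 hP)
  exact ⟨B, by rw [hB, Matrix.star_eq_conjTranspose, Matrix.conjTranspose_eq_transpose_of_trivial]⟩

theorem covecInner_eq_dotProduct (g : SmoothMetric d M) (x : M) (α β : Covec d x) :
    covecInner g x α β = (fun i => α (frame x i)) ⬝ᵥ
      ((gram g x (frame x))⁻¹.map ((↑) : ℝ → ℂ) *ᵥ fun i => conj (β (frame x i))) := by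
  simp only [covecInner, dotProduct, mulVec, Matrix.map_apply, Finset.mul_sum]
  refine Finset.sum_congr rfl fun i _ => Finset.sum_congr rfl fun k _ => ?_
  ring

/-- The covectors at `x`, with the Hermitian product of the metric, are isometric to `ℂ^d`. The
second part is the duality estimate `|α(v)| ≤ |α|_g |v|_g`. -/
theorem exists_covec_isometry (g : SmoothMetric d M) (x : M) :
    ∃ Φ : Covec d x →ₗ[ℂ] EuclideanSpace ℂ (Fin d),
      (∀ α β, covecInner g x α β = inner ℂ (Φ β) (Φ α)) ∧
      ∀ α v, ‖α v‖ ≤ ‖Φ α‖ * Real.sqrt (g.inner x v v) := by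
  have hG := posDef_gram_frame g x
  set G := gram g x (frame x) with hGdef
  obtain ⟨B, hB⟩ := exists_eq_transpose_mul_self hG.inv.posSemidef
  let Φ : Covec d x →ₗ[ℂ] EuclideanSpace ℂ (Fin d) :=
    { toFun := fun α => WithLp.toLp 2 (B.map ((↑) : ℝ → ℂ) *ᵥ fun i => α (frame x i))
      map_add' := fun α β => by
        ext k; simp [mulVec, dotProduct, mul_add, Finset.sum_add_distrib]
      map_smul' := fun c α => by
        ext k; simp [mulVec, dotProduct, Finset.mul_sum, mul_left_comm] }
  have hΦ : ∀ α k, Φ α k = ∑ i, (B k i : ℂ) * α (frame x i) := fun α k => by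
    simp [Φ, mulVec, dotProduct]
  refine ⟨Φ, fun α β => ?_, fun α v => ?_⟩
  · rw [covecInner_eq_dotProduct, ← hGdef, hB, PiLp.inner_apply]
    have e : (Bᵀ * B).map ((↑) : ℝ → ℂ) = (B.map ((↑) : ℝ → ℂ))ᵀ * B.map ((↑) : ℝ → ℂ) := by
      ext i k; simp [Matrix.mul_apply]
    rw [e, ← Matrix.mulVec_mulVec, Matrix.dotProduct_mulVec, Matrix.vecMul_transpose, dotProduct]
    refine Finset.sum_congr rfl fun k _ => ?_
    rw [RCLike.inner_apply, hΦ, hΦ]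
    simp [mulVec, dotProduct]
  · set y : Fin d → ℝ := B *ᵥ (G *ᵥ frameCoord v) with hy
    have hGdet : IsUnit G.det := hG.isUnit.map Matrix.detMonoidHom
    have hBy : Bᵀ *ᵥ y = frameCoord v := by
      rw [hy, Matrix.mulVec_mulVec, ← hB, Matrix.mulVec_mulVec, Matrix.nonsing_inv_mul _ hGdet,
        Matrix.one_mulVec]
    have hyy : y ⬝ᵥ y = g.inner x v v := by
      rw [metric_eq_gram, ← hGdef]
      calc y ⬝ᵥ y = y ⬝ᵥ (B *ᵥ (G *ᵥ frameCoord v)) := by rw [← hy]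
        _ = _ := by rw [Matrix.dotProduct_mulVec, ← Matrix.mulVec_transpose, hBy]
    have hα : α v = inner ℂ (WithLp.toLp 2 (fun k => (y k : ℂ)) : EuclideanSpace ℂ (Fin d))
        (Φ α) := by
      rw [covec_apply_eq_sum, ← hBy, PiLp.inner_apply]
      simp only [RCLike.inner_apply, hΦ, mulVec, dotProduct, Matrix.transpose_apply,
        Complex.ofReal_sum, Complex.ofReal_mul, Complex.conj_ofReal, Finset.sum_mul]
      rw [Finset.sum_comm]
      refine Finset.sum_congr rfl fun k _ => Finset.sum_congr rfl fun i _ => ?_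
      ring
    have hny : ‖(WithLp.toLp 2 (fun k => (y k : ℂ)) : EuclideanSpace ℂ (Fin d))‖ =
        Real.sqrt (g.inner x v v) := by
      rw [EuclideanSpace.norm_eq, ← hyy]
      congr 1
      simp [dotProduct, sq]
    rw [hα, ← hny, mul_comm]
    exact norm_inner_le_norm _ _

end PointwiseMetric

/-! ### The metric in charts -/

section Charts

open Matrix

variable {d : ℕ} {M : Type*} [TopologicalSpace M] [ChartedSpace (Model d) M]

/-- The matrix of a family of tangent vectors in the basis `frame x`. -/
def frameMatrix {x : M} (b : Fin d → TangentSpace 𝓘(ℝ, Model d) x) : Matrix (Fin d) (Fin d) ℝ :=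
  Matrix.of fun k i => frameCoord (b i) k

/-- The derivative of the inverse of the chart around `c`, read in the coordinates that identify
each tangent space with the model space. -/
noncomputable def chartDeriv (c : M) (y : Model d) : Model d →L[ℝ] Model d :=
  mfderiv 𝓘(ℝ, Model d) 𝓘(ℝ, Model d) (extChartAt 𝓘(ℝ, Model d) c).symm y

theorem frameMatrix_coordFrame (c : M) (y : Model d) :
    frameMatrix (coordFrame c y) = LinearMap.toMatrix (EuclideanSpace.basisFun (Fin d) ℝ).toBasis
      (EuclideanSpace.basisFun (Fin d) ℝ).toBasis (chartDeriv c y : Model d →ₗ[ℝ] Model d) := by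
  ext k i
  rw [LinearMap.toMatrix_apply]
  simp only [OrthonormalBasis.coe_toBasis, EuclideanSpace.basisFun_apply]
  rfl

theorem det_frameMatrix_coordFrame (c : M) (y : Model d) :
    (frameMatrix (coordFrame c y)).det = (chartDeriv c y).det := by
  rw [frameMatrix_coordFrame, LinearMap.det_toMatrix]

variable [IsManifold 𝓘(ℝ, Model d) ∞ M]

theorem gram_eq_frameMatrix (g : SmoothMetric d M) {x : M}
    (b : Fin d → TangentSpace 𝓘(ℝ, Model d) x) :
    gram g x b = (frameMatrix b)ᵀ * gram g x (frame x) * frameMatrix b := by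
  ext i j
  have : gram g x b i j = g.inner x (b i) (b j) := rfl
  rw [this, metric_eq_gram, Matrix.mul_assoc]
  rfl

/-- The Hermitian product of covectors may be computed in any basis of the tangent space. -/
theorem covecInner_eq_of_basis (g : SmoothMetric d M) {x : M}
    (b : Fin d → TangentSpace 𝓘(ℝ, Model d) x) (hb : (frameMatrix b).det ≠ 0)
    (α β : Covec d x) :
    covecInner g x α β =
      ∑ i, ∑ j, (((gram g x b)⁻¹ i j : ℝ) : ℂ) * α (b i) * conj (β (b j)) := by
  set A := frameMatrix b with hA
  set G := gram g x (frame x) with hG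
  have hAu : IsUnit A.det := hb.isUnit
  have hv : ∀ γ : Covec d x, (fun i => γ (b i)) =
      (A.map ((↑) : ℝ → ℂ))ᵀ *ᵥ fun i => γ (frame x i) := fun γ => by
    ext i
    rw [covec_apply_eq_sum]
    rfl
  have hinv : (gram g x b)⁻¹ = A⁻¹ * G⁻¹ * (A⁻¹)ᵀ := by
    rw [gram_eq_frameMatrix, Matrix.mul_inv_rev, Matrix.mul_inv_rev, ← Matrix.transpose_nonsing_inv,
      Matrix.mul_assoc]
  have key : G⁻¹ = A * (gram g x b)⁻¹ * Aᵀ := by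
    rw [hinv]
    calc G⁻¹ = (A * A⁻¹) * G⁻¹ * (A * A⁻¹)ᵀ := by
          rw [Matrix.mul_nonsing_inv _ hAu]; simp
      _ = _ := by rw [Matrix.transpose_mul]; simp only [Matrix.mul_assoc]
  have hrhs : ∑ i, ∑ j, (((gram g x b)⁻¹ i j : ℝ) : ℂ) * α (b i) * conj (β (b j)) =
      (fun i => α (b i)) ⬝ᵥ ((gram g x b)⁻¹.map ((↑) : ℝ → ℂ) *ᵥ fun i => conj (β (b i))) := by
    simp only [dotProduct, mulVec, Matrix.map_apply, Finset.mul_sum]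
    refine Finset.sum_congr rfl fun i _ => Finset.sum_congr rfl fun k _ => ?_
    ring
  have hconj : (fun i => conj (β (b i))) =
      (A.map ((↑) : ℝ → ℂ))ᵀ *ᵥ fun i => conj (β (frame x i)) := by
    ext i
    have := congrFun (hv β) i
    rw [this]
    simp [mulVec, dotProduct, map_sum]
  have hmap : (A * (gram g x b)⁻¹ * Aᵀ).map ((↑) : ℝ → ℂ) =
      A.map ((↑) : ℝ → ℂ) * ((gram g x b)⁻¹.map ((↑) : ℝ → ℂ) * (A.map ((↑) : ℝ → ℂ))ᵀ) := by
    rw [Matrix.mul_assoc]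
    ext i k; simp [Matrix.mul_apply]
  rw [covecInner_eq_dotProduct, ← hG, key, hrhs, hv α, hconj, hmap, ← Matrix.mulVec_mulVec,
    ← Matrix.mulVec_mulVec, Matrix.dotProduct_mulVec, ← Matrix.mulVec_transpose]

theorem volumeDensity_eq (g : SmoothMetric d M) (c : M) (y : Model d) :
    volumeDensity g c y =
      Real.sqrt (gram g ((extChartAt 𝓘(ℝ, Model d) c).symm y)
        (frame ((extChartAt 𝓘(ℝ, Model d) c).symm y))).det * |(chartDeriv c y).det| := by
  rw [volumeDensity, gram_eq_frameMatrix, Matrix.det_mul, Matrix.det_mul, Matrix.det_transpose,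
    det_frameMatrix_coordFrame, ← Real.sqrt_sq_eq_abs, ← Real.sqrt_mul
      (posDef_gram_frame g _).det_pos.le]
  congr 1; ring

theorem isInvertible_chartDeriv (c : M) {y : Model d}
    (hy : y ∈ (extChartAt 𝓘(ℝ, Model d) c).target) : (chartDeriv c y).det ≠ 0 := by
  have := isInvertible_mfderivWithin_extChartAt_symm (I := 𝓘(ℝ, Model d)) (x := c) hy
  rw [ModelWithCorners.range_eq_univ, mfderivWithin_univ] at this
  obtain ⟨e, he⟩ := this
  have h2 : chartDeriv c y = (show Model d ≃L[ℝ] Model d from e) := he.symm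
  rw [h2]
  exact (LinearEquiv.isUnit_det' _).ne_zero

theorem volumeDensity_pos (g : SmoothMetric d M) (c : M) {y : Model d}
    (hy : y ∈ (extChartAt 𝓘(ℝ, Model d) c).target) : 0 < volumeDensity g c y := by
  rw [volumeDensity_eq]
  exact mul_pos (Real.sqrt_pos.2 (posDef_gram_frame g _).det_pos)
    (abs_pos.2 (isInvertible_chartDeriv c hy))

/-- The coefficients `g_ij` of the metric are continuous in a chart. -/
theorem continuousOn_gram_coordFrame (g : SmoothMetric d M) (c : M) (i j : Fin d) :
    ContinuousOn (fun y => gram g ((extChartAt 𝓘(ℝ, Model d) c).symm y) (coordFrame c y) i j)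
      (extChartAt 𝓘(ℝ, Model d) c).target := by
  have hv : ∀ i, ContinuousOn (fun y => (⟨(extChartAt 𝓘(ℝ, Model d) c).symm y, coordFrame c y i⟩ :
      TangentBundle 𝓘(ℝ, Model d) M)) (extChartAt 𝓘(ℝ, Model d) c).target := by
    intro i
    have h1 := (contMDiffOn_extChartAt_symm (I := 𝓘(ℝ, Model d)) (n := 1)
      c).continuousOn_tangentMapWithin le_rfl (isOpen_extChartAt_target c).uniqueMDiffOn
    have h2 : Continuous (fun y : Model d => (⟨y, (EuclideanSpace.single i (1 : ℝ) : Model d)⟩ :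
        TangentBundle 𝓘(ℝ, Model d) (Model d))) := by
      have := (tangentBundleModelSpaceHomeomorph 𝓘(ℝ, Model d)).symm.continuous.comp
        (continuous_id.prodMk continuous_const :
          Continuous fun y : Model d => (y, (EuclideanSpace.single i (1 : ℝ) : Model d)))
      exact this
    refine (h1.comp h2.continuousOn fun y hy => hy).congr fun y hy => ?_
    simp only [Function.comp, tangentMapWithin, coordFrame]
    rw [mfderivWithin_of_isOpen (isOpen_extChartAt_target c) hy]
  intro y hy
  have hc := (continuousOn_extChartAt_symm (I := 𝓘(ℝ, Model d)) c y hy)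
  have := (g.contMDiff.continuous.continuousAt.comp_continuousWithinAt hc).clm_bundle_apply₂
    (F₁ := Model d) (F₂ := Model d) (E₃ := Bundle.Trivial M ℝ) (F₃ := ℝ) (hv i y hy) (hv j y hy)
  simp only [FiberBundle.continuousWithinAt_totalSpace] at this
  exact this.2

theorem continuousOn_volumeDensity (g : SmoothMetric d M) (c : M) :
    ContinuousOn (volumeDensity g c) (extChartAt 𝓘(ℝ, Model d) c).target := by
  refine Real.continuous_sqrt.comp_continuousOn ?_
  have h : ContinuousOn (fun y => gram g ((extChartAt 𝓘(ℝ, Model d) c).symm y) (coordFrame c y))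
      (extChartAt 𝓘(ℝ, Model d) c).target :=
    continuousOn_pi.2 fun i => continuousOn_pi.2 fun j => continuousOn_gram_coordFrame g c i j
  exact (Continuous.matrix_det continuous_id).comp_continuousOn h

theorem mdifferentiableAt_extChartAt_symm (c : M) {y : Model d}
    (hy : y ∈ (extChartAt 𝓘(ℝ, Model d) c).target) :
    MDifferentiableAt 𝓘(ℝ, Model d) 𝓘(ℝ, Model d) (extChartAt 𝓘(ℝ, Model d) c).symm y :=
  ((contMDiffOn_extChartAt_symm (I := 𝓘(ℝ, Model d)) (n := 1) c).contMDiffAt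
    ((isOpen_extChartAt_target c).mem_nhds hy)).mdifferentiableAt one_ne_zero

theorem contDiffOn_comp_extChartAt_symm {F : M → ℂ} (hF : IsSmooth d F) (c : M) :
    ContDiffOn ℝ ∞ (F ∘ (extChartAt 𝓘(ℝ, Model d) c).symm)
      (extChartAt 𝓘(ℝ, Model d) c).target :=
  contMDiffOn_iff_contDiffOn.1 (ContMDiff.comp_contMDiffOn hF
    (contMDiffOn_extChartAt_symm (I := 𝓘(ℝ, Model d)) c))

theorem differential_coordFrame {F : M → ℂ} (hF : IsSmooth d F) (c : M) {y : Model d}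
    (hy : y ∈ (extChartAt 𝓘(ℝ, Model d) c).target) (i : Fin d) :
    differential d F ((extChartAt 𝓘(ℝ, Model d) c).symm y) (coordFrame c y i) =
      fderiv ℝ (F ∘ (extChartAt 𝓘(ℝ, Model d) c).symm) y (EuclideanSpace.single i 1) := by
  rw [← mfderiv_eq_fderiv, mfderiv_comp y ((ContMDiff.mdifferentiable hF (by simp)) _)
    (mdifferentiableAt_extChartAt_symm c hy)]
  rfl

theorem covecInner_differential_chart (g : SmoothMetric d M) {F K : M → ℂ} (hF : IsSmooth d F)
    (hK : IsSmooth d K) (c : M) {y : Model d} (hy : y ∈ (extChartAt 𝓘(ℝ, Model d) c).target) :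
    covecInner g ((extChartAt 𝓘(ℝ, Model d) c).symm y)
        (differential d F ((extChartAt 𝓘(ℝ, Model d) c).symm y))
        (differential d K ((extChartAt 𝓘(ℝ, Model d) c).symm y)) =
      ∑ i, ∑ j, (((gram g ((extChartAt 𝓘(ℝ, Model d) c).symm y) (coordFrame c y))⁻¹ i j : ℝ) : ℂ) *
        fderiv ℝ (F ∘ (extChartAt 𝓘(ℝ, Model d) c).symm) y (EuclideanSpace.single i 1) *
        conj (fderiv ℝ (K ∘ (extChartAt 𝓘(ℝ, Model d) c).symm) y (EuclideanSpace.single j 1)) := by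
  rw [covecInner_eq_of_basis g (coordFrame c y)
    (by rw [det_frameMatrix_coordFrame]; exact isInvertible_chartDeriv c hy)]
  simp only [differential_coordFrame hF c hy, differential_coordFrame hK c hy]

theorem continuous_covecInner_differential (g : SmoothMetric d M) {F K : M → ℂ}
    (hF : IsSmooth d F) (hK : IsSmooth d K) :
    Continuous fun x => covecInner g x (differential d F x) (differential d K x) := by
  rw [continuous_iff_continuousAt]
  intro c
  set e := extChartAt 𝓘(ℝ, Model d) c with he
  have hderiv : ∀ {F : M → ℂ}, IsSmooth d F → ∀ i : Fin d,
      ContinuousOn (fun y => fderiv ℝ (F ∘ e.symm) y (EuclideanSpace.single i 1)) e.target := by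
    intro F hF i
    exact ((contDiffOn_comp_extChartAt_symm hF c).continuousOn_fderiv_of_isOpen
      (isOpen_extChartAt_target c) (by simp)).clm_apply continuousOn_const
  have hinv : ∀ i j, ContinuousOn (fun y => (((gram g (e.symm y) (coordFrame c y))⁻¹ i j : ℝ) : ℂ))
      e.target := by
    intro i j
    have h : ContinuousOn (fun y => gram g (e.symm y) (coordFrame c y)) e.target :=
      continuousOn_pi.2 fun i => continuousOn_pi.2 fun j => continuousOn_gram_coordFrame g c i j
    have hdet : ∀ y ∈ e.target, (gram g (e.symm y) (coordFrame c y)).det ≠ 0 := fun y hy => by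
      have := volumeDensity_pos g c hy
      exact (Real.sqrt_pos.1 this).ne'
    refine Complex.continuous_ofReal.comp_continuousOn ?_
    simp only [Matrix.inv_def, Ring.inverse_eq_inv', Matrix.smul_apply, smul_eq_mul]
    refine (((Continuous.matrix_det continuous_id).comp_continuousOn h).inv₀ hdet).mul ?_
    exact ((continuous_id.matrix_adjugate.matrix_elem i j)).comp_continuousOn h
  have hchart : ContinuousOn (fun y => covecInner g (e.symm y) (differential d F (e.symm y))
      (differential d K (e.symm y))) e.target := by
    refine ContinuousOn.congr ?_ fun y hy => covecInner_differential_chart g hF hK c hy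
    refine continuousOn_finsetSum _ fun i _ => continuousOn_finsetSum _ fun j _ => ?_
    exact ((hinv i j).mul (hderiv hF i)).mul
      (Complex.continuous_conj.comp_continuousOn (hderiv hK j))
  have hcomp : ContinuousOn (fun x => covecInner g x (differential d F x) (differential d K x))
      e.source := by
    refine (hchart.comp (continuousOn_extChartAt c) e.mapsTo).congr fun x hx => ?_
    exact congrArg (fun z => covecInner g z (differential d F z) (differential d K z))
      (e.left_inv hx).symm
  exact hcomp.continuousAt (extChartAt_source_mem_nhds c)

/-- The chain rule for the change of coordinates from the chart around `c` to the chart around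
`c'`. -/
theorem chartDeriv_transition (c c' : M) {y : Model d}
    (hy : y ∈ (extChartAt 𝓘(ℝ, Model d) c).target)
    (hy' : (extChartAt 𝓘(ℝ, Model d) c).symm y ∈ (extChartAt 𝓘(ℝ, Model d) c').source) :
    DifferentiableAt ℝ (extChartAt 𝓘(ℝ, Model d) c' ∘ (extChartAt 𝓘(ℝ, Model d) c).symm) y ∧
    chartDeriv c y =
      (chartDeriv c' (extChartAt 𝓘(ℝ, Model d) c' ((extChartAt 𝓘(ℝ, Model d) c).symm y))).comp
        (fderiv ℝ (extChartAt 𝓘(ℝ, Model d) c' ∘ (extChartAt 𝓘(ℝ, Model d) c).symm) y) := by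
  set e := extChartAt 𝓘(ℝ, Model d) c with he
  set e' := extChartAt 𝓘(ℝ, Model d) c' with he'
  have hm : MDifferentiableAt 𝓘(ℝ, Model d) 𝓘(ℝ, Model d) (e' ∘ e.symm) y := by
    refine MDifferentiableAt.comp y ?_ (mdifferentiableAt_extChartAt_symm c hy)
    exact mdifferentiableAt_extChartAt (by simpa [he'] using hy')
  have hev : e.symm =ᶠ[𝓝 y] e'.symm ∘ (e' ∘ e.symm) := by
    have h1 : ∀ᶠ z in 𝓝 y, e.symm z ∈ e'.source :=
      (continuousAt_extChartAt_symm'' hy).eventually_mem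
        ((isOpen_extChartAt_source c').mem_nhds hy')
    filter_upwards [h1] with z hz
    simp only [Function.comp, e'.left_inv hz]
  refine ⟨hm.differentiableAt, ?_⟩
  have h2 : mfderiv 𝓘(ℝ, Model d) 𝓘(ℝ, Model d) e.symm y =
      mfderiv 𝓘(ℝ, Model d) 𝓘(ℝ, Model d) (e'.symm ∘ (e' ∘ e.symm)) y := hev.mfderiv_eq
  have h3 := mfderiv_comp y (mdifferentiableAt_extChartAt_symm c' (e'.map_source hy')) hm
  rw [mfderiv_eq_fderiv] at h3
  unfold chartDeriv
  exact h2.trans h3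

/-- The density `√(det (g_ij))` is multiplied by the absolute determinant of the change of
coordinates, as the change of variables formula requires. -/
theorem volumeDensity_transition (g : SmoothMetric d M) (c c' : M) {y : Model d}
    (hy : y ∈ (extChartAt 𝓘(ℝ, Model d) c).target)
    (hy' : (extChartAt 𝓘(ℝ, Model d) c).symm y ∈ (extChartAt 𝓘(ℝ, Model d) c').source) :
    volumeDensity g c y =
      |(fderiv ℝ (extChartAt 𝓘(ℝ, Model d) c' ∘ (extChartAt 𝓘(ℝ, Model d) c).symm) y).det| *
      volumeDensity g c' (extChartAt 𝓘(ℝ, Model d) c' ((extChartAt 𝓘(ℝ, Model d) c).symm y)) := by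
  rw [volumeDensity_eq, volumeDensity_eq, (extChartAt 𝓘(ℝ, Model d) c').left_inv hy',
    (chartDeriv_transition c c' hy hy').2]
  have : ∀ A B : Model d →L[ℝ] Model d, (A.comp B).det = A.det * B.det := fun A B =>
    LinearMap.det_comp _ _
  rw [this, abs_mul]
  ring

end Charts

/-! ### The Riemannian volume -/

section Volume

theorem measurableSet_target {d : ℕ} {M : Type*} [TopologicalSpace M]
    [ChartedSpace (Model d) M] (c : M) : MeasurableSet (extChartAt 𝓘(ℝ, Model d) c).target :=
  (isOpen_extChartAt_target c).measurableSet

theorem measurableSet_source {d : ℕ} {M : Type*} [TopologicalSpace M] [ChartedSpace (Model d) M]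
    [MeasurableSpace M] [BorelSpace M] (c : M) :
    MeasurableSet (extChartAt 𝓘(ℝ, Model d) c).source :=
  (isOpen_extChartAt_source c).measurableSet

theorem aemeasurable_extChartAt_symm {d : ℕ} {M : Type*} [TopologicalSpace M]
    [ChartedSpace (Model d) M] [MeasurableSpace M] [BorelSpace M] (c : M) :
    AEMeasurable (extChartAt 𝓘(ℝ, Model d) c).symm
      (volume.restrict (extChartAt 𝓘(ℝ, Model d) c).target) :=
  (continuousOn_extChartAt_symm c).aemeasurable (measurableSet_target c)

theorem measurableSet_target_inter_preimage {d : ℕ} {M : Type*} [TopologicalSpace M]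
    [ChartedSpace (Model d) M] [MeasurableSpace M] [BorelSpace M] (c : M) {A : Set M}
    (hA : MeasurableSet A) :
    MeasurableSet ((extChartAt 𝓘(ℝ, Model d) c).target ∩
      (extChartAt 𝓘(ℝ, Model d) c).symm ⁻¹' A) := by
  have h := (continuousOn_iff_continuous_domRestrict.1
    (continuousOn_extChartAt_symm (I := 𝓘(ℝ, Model d)) c)).measurable hA
  have h2 := (measurableSet_target c).subtype_image h
  convert h2 using 1
  ext y
  simp [and_comm]

theorem exists_closedBall_subset_target {d : ℕ} {M : Type*} [TopologicalSpace M]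
    [ChartedSpace (Model d) M] (c : M) :
    ∃ r > 0, Metric.closedBall (extChartAt 𝓘(ℝ, Model d) c c) r ⊆
      (extChartAt 𝓘(ℝ, Model d) c).target :=
  Metric.nhds_basis_closedBall.mem_iff.1 (extChartAt_target_mem_nhds c)

theorem chart_preimage_ball_mem_nhds {d : ℕ} {M : Type*} [TopologicalSpace M]
    [ChartedSpace (Model d) M] (c : M) {r : ℝ} (hr : 0 < r) :
    (extChartAt 𝓘(ℝ, Model d) c).source ∩ extChartAt 𝓘(ℝ, Model d) c ⁻¹'
      Metric.ball (extChartAt 𝓘(ℝ, Model d) c c) r ∈ 𝓝 c :=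
  inter_mem (extChartAt_source_mem_nhds c)
    ((continuousAt_extChartAt c).preimage_mem_nhds (Metric.ball_mem_nhds _ hr))

variable {d : ℕ} {M : Type*} [TopologicalSpace M] [ChartedSpace (Model d) M]
  [IsManifold 𝓘(ℝ, Model d) ∞ M] [MeasurableSpace M]

/-- The image on `M` of `√(det (g_ij)) dy` under the inverse of the chart around `c`. -/
noncomputable def chartMeasure (g : SmoothMetric d M) (c : M) : Measure M :=
  Measure.map (extChartAt 𝓘(ℝ, Model d) c).symm
    ((volume.restrict (extChartAt 𝓘(ℝ, Model d) c).target).withDensity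
      fun y => ENNReal.ofReal (volumeDensity g c y))

variable [BorelSpace M]

theorem aemeasurable_extChartAt_symm_withDensity (g : SmoothMetric d M) (c : M) :
    AEMeasurable (extChartAt 𝓘(ℝ, Model d) c).symm
      ((volume.restrict (extChartAt 𝓘(ℝ, Model d) c).target).withDensity
        fun y => ENNReal.ofReal (volumeDensity g c y)) :=
  (aemeasurable_extChartAt_symm c).mono_ac (withDensity_absolutelyContinuous _ _)

theorem chartMeasure_apply (g : SmoothMetric d M) (c : M) {A : Set M} (hA : MeasurableSet A) :
    chartMeasure g c A = ∫⁻ y in (extChartAt 𝓘(ℝ, Model d) c).target ∩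
      (extChartAt 𝓘(ℝ, Model d) c).symm ⁻¹' A, ENNReal.ofReal (volumeDensity g c y) := by
  rw [chartMeasure, Measure.map_apply_of_aemeasurable
    (aemeasurable_extChartAt_symm_withDensity g c) hA, withDensity_apply',
    Measure.restrict_restrict' (measurableSet_target c), inter_comm]

theorem restrict_source_chartMeasure (g : SmoothMetric d M) (c : M) :
    (chartMeasure g c).restrict (extChartAt 𝓘(ℝ, Model d) c).source = chartMeasure g c := by
  rw [Measure.restrict_eq_self_of_ae_mem]
  rw [ae_iff]
  have : {x | x ∉ (extChartAt 𝓘(ℝ, Model d) c).source} =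
    (extChartAt 𝓘(ℝ, Model d) c).sourceᶜ := rfl
  rw [this, chartMeasure_apply g c (measurableSet_source c).compl]
  have he : (extChartAt 𝓘(ℝ, Model d) c).target ∩
      (extChartAt 𝓘(ℝ, Model d) c).symm ⁻¹' (extChartAt 𝓘(ℝ, Model d) c).sourceᶜ = ∅ := by
    ext y
    simp only [mem_inter_iff, mem_preimage, mem_compl_iff, mem_empty_iff_false, iff_false, not_and,
      not_not]
    exact fun hy => (extChartAt 𝓘(ℝ, Model d) c).map_target hy
  rw [he, Measure.restrict_empty, lintegral_zero_measure]

/-- The local measures agree on overlaps, by the change of variables formula. -/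
theorem chartMeasure_le_of_subset (g : SmoothMetric d M) (c c' : M) {A : Set M}
    (hA : MeasurableSet A) (hAc : A ⊆ (extChartAt 𝓘(ℝ, Model d) c').source) :
    chartMeasure g c A ≤ chartMeasure g c' A := by
  rw [chartMeasure_apply g c hA, chartMeasure_apply g c' hA]
  set e := extChartAt 𝓘(ℝ, Model d) c with he
  set e' := extChartAt 𝓘(ℝ, Model d) c' with he'
  set s := e.target ∩ e.symm ⁻¹' A with hs
  have hsm : MeasurableSet s := measurableSet_target_inter_preimage c hA
  have hd : ∀ y ∈ s, HasFDerivWithinAt (e' ∘ e.symm) (fderiv ℝ (e' ∘ e.symm) y) s y := fun y hy =>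
    (chartDeriv_transition c c' hy.1 (hAc hy.2)).1.hasFDerivAt.hasFDerivWithinAt
  have hinj : InjOn (e' ∘ e.symm) s := fun y hy z hz h =>
    e.symm.injOn hy.1 hz.1 (e'.injOn (hAc hy.2) (hAc hz.2) h)
  have h1 := lintegral_image_eq_lintegral_abs_det_fderiv_mul volume hsm hd hinj
    (fun y => ENNReal.ofReal (volumeDensity g c' y))
  have h2 : ∫⁻ y in s, ENNReal.ofReal (volumeDensity g c y) =
      ∫⁻ y in (e' ∘ e.symm) '' s, ENNReal.ofReal (volumeDensity g c' y) := by
    rw [h1]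
    refine setLIntegral_congr_fun hsm fun y hy => ?_
    simp only [Function.comp]
    rw [volumeDensity_transition g c c' hy.1 (hAc hy.2), ENNReal.ofReal_mul (abs_nonneg _)]
  rw [h2]
  refine lintegral_mono_set ?_
  rintro _ ⟨y, hy, rfl⟩
  refine ⟨e'.map_source (hAc hy.2), ?_⟩
  simp only [Function.comp, mem_preimage]
  rw [e'.left_inv (hAc hy.2)]
  exact hy.2

/-- In the domain of a chart, the Riemannian volume is `√(det (g_ij)) dy`. -/
theorem vol_restrict_source (g : SmoothMetric d M) (c : M) :
    (vol g).restrict (extChartAt 𝓘(ℝ, Model d) c).source = chartMeasure g c := by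
  set S := (extChartAt 𝓘(ℝ, Model d) c).source with hS
  have hSm : MeasurableSet S := measurableSet_source c
  have hvol : vol g = ⨆ c, chartMeasure g c := rfl
  apply le_antisymm
  · have h1 : vol g ≤ chartMeasure g c + (vol g).restrict Sᶜ := by
      conv_lhs => rw [hvol]
      refine iSup_le fun c' => ?_
      rw [← Measure.restrict_add_restrict_compl (μ := chartMeasure g c') hSm]
      refine add_le_add ?_ (Measure.restrict_mono_measure (hvol ▸ le_iSup (chartMeasure g) c') _)
      refine Measure.le_iff.2 fun A hA => ?_
      rw [Measure.restrict_apply hA]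
      exact (chartMeasure_le_of_subset g c' c (hA.inter hSm) inter_subset_right).trans
        (measure_mono inter_subset_left)
    have h2 := Measure.restrict_mono_measure h1 S
    rw [Measure.restrict_add, Measure.restrict_restrict hSm, inter_compl_self,
      Measure.restrict_empty, add_zero] at h2
    exact h2.trans Measure.restrict_le_self
  · rw [← restrict_source_chartMeasure g c]
    exact Measure.restrict_mono_measure (hvol ▸ le_iSup (chartMeasure g) c) _

theorem isLocallyFiniteMeasure_vol (g : SmoothMetric d M) : IsLocallyFiniteMeasure (vol g) := by
  refine ⟨fun c => ?_⟩
  obtain ⟨r, hr, hsub⟩ := exists_closedBall_subset_target (d := d) c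
  refine ⟨_, chart_preimage_ball_mem_nhds (d := d) c hr, ?_⟩
  set e := extChartAt 𝓘(ℝ, Model d) c with he
  set U := e.source ∩ e ⁻¹' Metric.ball (e c) r with hU
  have hUm : MeasurableSet U :=
    ((continuousOn_extChartAt c).isOpen_inter_preimage (isOpen_extChartAt_source c)
      Metric.isOpen_ball).measurableSet
  have h1 : vol g U = chartMeasure g c U := by
    rw [← vol_restrict_source, Measure.restrict_apply hUm, inter_eq_self_of_subset_left
      inter_subset_left]
  obtain ⟨B, hB⟩ := (isCompact_closedBall (e c) r).exists_bound_of_continuousOn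
    ((continuousOn_volumeDensity g c).mono hsub)
  rw [h1, chartMeasure_apply g c hUm]
  calc _ ≤ ∫⁻ y in Metric.closedBall (e c) r, ENNReal.ofReal (volumeDensity g c y) := by
        refine lintegral_mono_set ?_
        rintro y ⟨hy, hy2⟩
        have : e (e.symm y) ∈ Metric.ball (e c) r := hy2.2
        rw [e.right_inv hy] at this
        exact Metric.ball_subset_closedBall this
    _ ≤ ∫⁻ _ in Metric.closedBall (e c) r, ENNReal.ofReal B := by
        refine setLIntegral_mono' Metric.isClosed_closedBall.measurableSet fun y hy => ?_
        exact ENNReal.ofReal_le_ofReal ((le_abs_self _).trans (hB y hy))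
    _ < ⊤ := by
        rw [setLIntegral_const]
        exact ENNReal.mul_lt_top ENNReal.ofReal_lt_top (isCompact_closedBall _ _).measure_lt_top

theorem isFiniteMeasure_vol [CompactSpace M] (g : SmoothMetric d M) : IsFiniteMeasure (vol g) := by
  have := isLocallyFiniteMeasure_vol g
  exact ⟨isCompact_univ.measure_lt_top⟩

end Volume

/-! ### Norms of covectors and a Euclidean Sobolev inequality -/

section CovectorNorm

variable {d : ℕ} {M : Type*} [TopologicalSpace M] [ChartedSpace (Model d) M]
  [IsManifold 𝓘(ℝ, Model d) ∞ M]

theorem exists_covecNorm_isometry (g : SmoothMetric d M) (x : M) :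
    ∃ Φ : Covec d x →ₗ[ℂ] EuclideanSpace ℂ (Fin d),
      (∀ α β, covecInner g x α β = inner ℂ (Φ β) (Φ α)) ∧ (∀ α, covecNorm g x α = ‖Φ α‖) ∧
      ∀ α v, ‖α v‖ ≤ ‖Φ α‖ * Real.sqrt (g.inner x v v) := by
  obtain ⟨Φ, h1, h2⟩ := exists_covec_isometry g x
  refine ⟨Φ, h1, fun α => ?_, h2⟩
  rw [covecNorm, h1, inner_self_eq_norm_sq_to_K]
  have : (((‖Φ α‖ : ℝ) : ℂ) ^ 2).re = ‖Φ α‖ ^ 2 := by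
    rw [← Complex.ofReal_pow]; exact Complex.ofReal_re _
  exact (congrArg Real.sqrt this).trans (Real.sqrt_sq (norm_nonneg _))

theorem covecNorm_nonneg (g : SmoothMetric d M) (x : M) (α : Covec d x) : 0 ≤ covecNorm g x α :=
  Real.sqrt_nonneg _

theorem norm_apply_le_covecNorm (g : SmoothMetric d M) (x : M) (α : Covec d x)
    (v : TangentSpace 𝓘(ℝ, Model d) x) :
    ‖α v‖ ≤ covecNorm g x α * Real.sqrt (g.inner x v v) := by
  obtain ⟨Φ, -, h2, h3⟩ := exists_covecNorm_isometry g x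
  rw [h2]; exact h3 α v

theorem norm_covecInner_le (g : SmoothMetric d M) (x : M) (α β : Covec d x) :
    ‖covecInner g x α β‖ ≤ covecNorm g x α * covecNorm g x β := by
  obtain ⟨Φ, h1, h2, -⟩ := exists_covecNorm_isometry g x
  rw [h1, h2, h2, mul_comm]; exact norm_inner_le_norm _ _

theorem covecInner_self (g : SmoothMetric d M) (x : M) (α : Covec d x) :
    covecInner g x α α = ((covecNorm g x α ^ 2 : ℝ) : ℂ) := by
  obtain ⟨Φ, h1, h2, -⟩ := exists_covecNorm_isometry g x
  rw [h1, h2, inner_self_eq_norm_sq_to_K]; simp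

theorem covecInner_conj_symm (g : SmoothMetric d M) (x : M) (α β : Covec d x) :
    conj (covecInner g x α β) = covecInner g x β α := by
  obtain ⟨Φ, h1, -⟩ := exists_covecNorm_isometry g x
  rw [h1, h1, inner_conj_symm]

theorem covecInner_add_left (g : SmoothMetric d M) (x : M) (α β γ : Covec d x) :
    covecInner g x (α + β) γ = covecInner g x α γ + covecInner g x β γ := by
  obtain ⟨Φ, h1, -⟩ := exists_covecNorm_isometry g x
  rw [h1, h1, h1, map_add, inner_add_right]

theorem covecInner_sub_left (g : SmoothMetric d M) (x : M) (α β γ : Covec d x) :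
    covecInner g x (α - β) γ = covecInner g x α γ - covecInner g x β γ := by
  obtain ⟨Φ, h1, -⟩ := exists_covecNorm_isometry g x
  rw [h1, h1, h1, map_sub, inner_sub_right]

theorem covecInner_smul_left (g : SmoothMetric d M) (x : M) (a : ℂ) (α β : Covec d x) :
    covecInner g x (a • α) β = a * covecInner g x α β := by
  obtain ⟨Φ, h1, -⟩ := exists_covecNorm_isometry g x
  rw [h1, h1, map_smul, inner_smul_right]

theorem covecNorm_add_le (g : SmoothMetric d M) (x : M) (α β : Covec d x) :
    covecNorm g x (α + β) ≤ covecNorm g x α + covecNorm g x β := by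
  obtain ⟨Φ, -, h2, -⟩ := exists_covecNorm_isometry g x
  rw [h2, h2, h2, map_add]; exact norm_add_le _ _

theorem covecNorm_neg (g : SmoothMetric d M) (x : M) (α : Covec d x) :
    covecNorm g x (-α) = covecNorm g x α := by
  obtain ⟨Φ, -, h2, -⟩ := exists_covecNorm_isometry g x
  rw [h2, h2, map_neg, norm_neg]

theorem abs_covecNorm_sub_le (g : SmoothMetric d M) (x : M) (α β : Covec d x) :
    |covecNorm g x α - covecNorm g x β| ≤ covecNorm g x (α - β) := by
  obtain ⟨Φ, -, h2, -⟩ := exists_covecNorm_isometry g x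
  rw [h2, h2, h2, map_sub]; exact abs_norm_sub_norm_le _ _

theorem continuous_covecNorm_differential (g : SmoothMetric d M) {F : M → ℂ}
    (hF : IsSmooth d F) : Continuous fun x => covecNorm g x (differential d F x) :=
  Real.continuous_sqrt.comp
    (Complex.continuous_re.comp (continuous_covecInner_differential g hF hF))

end CovectorNorm

section EuclideanSobolev

/-- In dimension one the supremum is bounded by the `L^1` norm of the derivative. -/
theorem enorm_le_lintegral_fderiv_dim_one {v : Model 1 → ℂ} (hv : ContDiff ℝ 1 v)
    (hc : HasCompactSupport v) (x : Model 1) : ‖v x‖ₑ ≤ ∫⁻ y, ‖fderiv ℝ v y‖ₑ := by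
  let E : ℝ → Model 1 := fun t => EuclideanSpace.single 0 t
  have hE : ∀ t, E t = t • (EuclideanSpace.single (0 : Fin 1) (1 : ℝ) : Model 1) := fun t => by
    ext i; simp [E]
  have hEx : ∀ x : Model 1, E (x 0) = x := fun x => by
    ext i; fin_cases i; simp [E]
  have hmp : MeasurePreserving E volume volume := by
    have h1 := (volume_preserving_funUnique (Fin 1) ℝ).symm
    have h2 := (EuclideanSpace.volume_preserving_symm_measurableEquiv_toLp (Fin 1)).symm
    have : E = (MeasurableEquiv.toLp 2 (Fin 1 → ℝ)).symm.symm ∘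
        (MeasurableEquiv.funUnique (Fin 1) ℝ).symm := by
      ext t i; fin_cases i; simp [E]
    rw [this]
    exact h2.comp h1
  have hd : ∀ t, HasDerivAt (v ∘ E) (fderiv ℝ v (E t) (EuclideanSpace.single 0 1)) t := fun t => by
    have h1 : HasDerivAt E (EuclideanSpace.single (0 : Fin 1) (1 : ℝ) : Model 1) t := by
      have := (hasDerivAt_id t).smul_const (EuclideanSpace.single (0 : Fin 1) (1 : ℝ) : Model 1)
      rw [one_smul] at this
      exact this.congr_of_eventuallyEq (Eventually.of_forall hE)
    exact ((hv.differentiable one_ne_zero (E t)).hasFDerivAt).comp_hasDerivAt t h1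
  have hEc : ContDiff ℝ 1 E := by
    have : E = fun t => t • (EuclideanSpace.single (0 : Fin 1) (1 : ℝ) : Model 1) := funext hE
    rw [this]; exact contDiff_id.smul contDiff_const
  have hcs : HasCompactSupport (v ∘ E) := by
    refine hc.comp_isClosedEmbedding (Isometry.isClosedEmbedding ?_)
    exact Isometry.of_dist_eq fun s t => by simp [E]
  calc ‖v x‖ₑ = ‖(v ∘ E) (x 0)‖ₑ := by rw [Function.comp, hEx]
    _ ≤ ∫⁻ t in Iic (x 0), ‖deriv (v ∘ E) t‖ₑ :=
        hcs.enorm_le_lintegral_Ici_deriv (hv.comp hEc) _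
    _ ≤ ∫⁻ t, ‖deriv (v ∘ E) t‖ₑ := setLIntegral_le_lintegral _ _
    _ ≤ ∫⁻ t, ‖fderiv ℝ v (E t)‖ₑ := by
        refine lintegral_mono fun t => ?_
        rw [(hd t).deriv]
        refine (ContinuousLinearMap.le_opENorm _ _).trans ?_
        rw [show ‖(EuclideanSpace.single (0 : Fin 1) (1 : ℝ) : Model 1)‖ₑ = 1 by
          rw [enorm_eq_nnnorm]; simp, mul_one]
    _ = ∫⁻ y, ‖fderiv ℝ v y‖ₑ := hmp.lintegral_comp
        ((hv.continuous_fderiv one_ne_zero).enorm.measurable)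

theorem eLpNorm_eq_restrict_of_support_subset {E F : Type*} [MeasurableSpace E]
    [NormedAddCommGroup F] {μ : Measure E} {p : ℝ≥0∞} {f : E → F} {s : Set E}
    (hs : MeasurableSet s) (hf : Function.support f ⊆ s) :
    eLpNorm f p μ = eLpNorm f p (μ.restrict s) := by
  rw [← eLpNorm_indicator_eq_eLpNorm_restrict hs, indicator_eq_self.2 hf]

/-- A Sobolev inequality in `ℝ^d` with a gain of integrability that is uniform on a ball. For
`d ≥ 2` it follows from the Gagliardo-Nirenberg-Sobolev inequality with the exponents
`2d/(d+1) ≤ 2` and `2d/(d-1) > 2`. -/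
theorem exists_local_sobolev {d : ℕ} (hd : 1 ≤ d) :
    ∃ q : ℝ≥0, 2 < q ∧ ∀ (a : Model d) (R : ℝ), ∃ C : ℝ≥0, ∀ v : Model d → ℂ, ContDiff ℝ 1 v →
      Function.support v ⊆ Metric.closedBall a R →
      eLpNorm v q volume ≤ C * eLpNorm (fderiv ℝ v) 2 volume := by
  have hsupp : ∀ (a : Model d) (R : ℝ) (v : Model d → ℂ),
      Function.support v ⊆ Metric.closedBall a R →
      Function.support (fderiv ℝ v) ⊆ Metric.closedBall a R := fun a R v hv =>
    (support_fderiv_subset ℝ).trans (closure_minimal hv Metric.isClosed_closedBall)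
  -- the gradient norms on a ball are ordered by their exponents
  have hgrad : ∀ (a : Model d) (R : ℝ) (p : ℝ≥0), 1 ≤ p → p ≤ 2 → ∃ C : ℝ≥0, ∀ v : Model d → ℂ,
      ContDiff ℝ 1 v → Function.support v ⊆ Metric.closedBall a R →
      eLpNorm (fderiv ℝ v) p volume ≤ C * eLpNorm (fderiv ℝ v) 2 volume := by
    intro a R p hp1 hp
    have hp0 : (0 : ℝ) < p := by exact_mod_cast (zero_lt_one.trans_le hp1)
    set s := Metric.closedBall a R with hs
    have hfin : volume s ^ (1 / (p : ℝ) - 1 / 2) ≠ ⊤ := by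
      refine ENNReal.rpow_ne_top_of_nonneg (sub_nonneg.2 ?_)
        (isCompact_closedBall _ _).measure_ne_top
      exact one_div_le_one_div_of_le (by positivity) (by exact_mod_cast hp)
    refine ⟨(volume s ^ (1 / (p : ℝ) - 1 / 2)).toNNReal, fun v hv hvs => ?_⟩
    rw [ENNReal.coe_toNNReal hfin,
      eLpNorm_eq_restrict_of_support_subset Metric.isClosed_closedBall.measurableSet
        (hsupp a R v hvs),
      eLpNorm_eq_restrict_of_support_subset (p := 2) Metric.isClosed_closedBall.measurableSet
        (hsupp a R v hvs), mul_comm]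
    have := eLpNorm_le_eLpNorm_mul_rpow_measure_univ (μ := volume.restrict s) (p := p) (q := 2)
      (f := fderiv ℝ v) (by exact_mod_cast hp)
      (hv.continuous_fderiv one_ne_zero).aestronglyMeasurable
    simpa using this
  rcases hd.eq_or_lt with rfl | hd2
  · refine ⟨4, by norm_num, fun a R => ?_⟩
    obtain ⟨C, hC⟩ := hgrad a R 1 le_rfl (by norm_num)
    set s := Metric.closedBall a R with hs
    have hfin : volume s ^ (4⁻¹ : ℝ) ≠ ⊤ :=
      ENNReal.rpow_ne_top_of_nonneg (by norm_num) (isCompact_closedBall _ _).measure_ne_top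
    refine ⟨(volume s ^ (4⁻¹ : ℝ)).toNNReal * C, fun v hv hvs => ?_⟩
    have hcs : HasCompactSupport v :=
      HasCompactSupport.of_support_subset_isCompact (isCompact_closedBall a R) hvs
    rw [ENNReal.coe_mul, ENNReal.coe_toNNReal hfin,
      eLpNorm_eq_restrict_of_support_subset Metric.isClosed_closedBall.measurableSet hvs]
    have h1 := hC v hv hvs
    rw [ENNReal.coe_one, eLpNorm_one_eq_lintegral_enorm] at h1
    have h2 := eLpNorm_le_of_ae_enorm_bound (μ := volume.restrict s) (p := ((4 : ℝ≥0) : ℝ≥0∞))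
      (f := v) (ae_of_all _ (enorm_le_lintegral_fderiv_dim_one hv hcs))
    rw [Measure.restrict_apply_univ] at h2
    have h4 : ((4 : ℝ≥0) : ℝ≥0∞).toReal⁻¹ = 4⁻¹ := by simp
    rw [h4] at h2
    rw [mul_assoc]
    exact h2.trans (by rw [smul_eq_mul, mul_comm]; gcongr)
  · have hn : (1 : ℝ) < d := by exact_mod_cast hd2
    have hn0 : (0 : ℝ) < d := by linarith
    let p : ℝ≥0 := 2 * d / (d + 1)
    let q : ℝ≥0 := 2 * d / (d - 1)
    have hdle : (1 : ℝ≥0) ≤ d := by exact_mod_cast hd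
    have hpc : (p : ℝ) = 2 * d / (d + 1) := by simp [p]
    have hqc : (q : ℝ) = 2 * d / (d - 1) := by simp [q, NNReal.coe_sub hdle]
    have hp1 : 1 ≤ p := by
      rw [← NNReal.coe_le_coe, hpc, NNReal.coe_one, le_div_iff₀ (by linarith)]; linarith
    have hp2 : p ≤ 2 := by
      rw [← NNReal.coe_le_coe, hpc, NNReal.coe_ofNat, div_le_iff₀ (by linarith)]; linarith
    refine ⟨q, ?_, fun a R => ?_⟩
    · rw [← NNReal.coe_lt_coe, hqc, NNReal.coe_ofNat, lt_div_iff₀ (by linarith)]; linarith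
    obtain ⟨C, hC⟩ := hgrad a R p hp1 hp2
    refine ⟨eLpNormLESNormFDerivOfLeConst ℂ volume (Metric.closedBall a R) p q * C,
      fun v hv hvs => ?_⟩
    have h1 := eLpNorm_le_eLpNorm_fderiv_of_le volume hv hvs hp1 (q := q) (by
        rw [finrank_euclideanSpace_fin, ← NNReal.coe_lt_coe, hpc, NNReal.coe_natCast,
          div_lt_iff₀ (by linarith)]
        nlinarith) (by
        rw [finrank_euclideanSpace_fin, NNReal.coe_inv, hpc, hqc]
        have : (d : ℝ) - 1 ≠ 0 := by linarith
        refine le_of_eq ?_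
        field_simp
        ring) Metric.isBounded_closedBall
    rw [ENNReal.coe_mul, mul_assoc]
    exact h1.trans (by gcongr; exact hC v hv hvs)

end EuclideanSobolev

/-! ### The Sobolev inequality on a compact manifold -/

section Sobolev

variable {d : ℕ} {M : Type*} [TopologicalSpace M] [ChartedSpace (Model d) M]
  [IsManifold 𝓘(ℝ, Model d) ∞ M] [MeasurableSpace M] [BorelSpace M]

theorem chartMeasure_le_vol (g : SmoothMetric d M) (c : M) : chartMeasure g c ≤ vol g := by
  rw [← vol_restrict_source]; exact Measure.restrict_le_self

omit [IsManifold 𝓘(ℝ, Model d) ∞ M] in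
theorem aemeasurable_extChartAt_symm_restrict (c : M) {K : Set (Model d)}
    (hsub : K ⊆ (extChartAt 𝓘(ℝ, Model d) c).target) :
    AEMeasurable (extChartAt 𝓘(ℝ, Model d) c).symm (volume.restrict K) :=
  (aemeasurable_extChartAt_symm c).mono_measure (Measure.restrict_mono_set _ hsub)

/-- On compact sets of coordinates, Lebesgue measure is controlled by the Riemannian volume. -/
theorem exists_map_symm_le_vol (g : SmoothMetric d M) (c : M) {K : Set (Model d)}
    (hK : IsCompact K) (hsub : K ⊆ (extChartAt 𝓘(ℝ, Model d) c).target) :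
    ∃ D : ℝ≥0, (volume.restrict K).map (extChartAt 𝓘(ℝ, Model d) c).symm ≤ D • vol g := by
  set e := extChartAt 𝓘(ℝ, Model d) c with he
  obtain ⟨δ, hδ, hle⟩ : ∃ δ > 0, ∀ y ∈ K, δ ≤ volumeDensity g c y := by
    rcases K.eq_empty_or_nonempty with rfl | hne
    · exact ⟨1, one_pos, by simp⟩
    obtain ⟨y, hy, hmin⟩ := hK.exists_isMinOn hne ((continuousOn_volumeDensity g c).mono hsub)
    exact ⟨_, volumeDensity_pos g c (hsub hy), fun z hz => hmin hz⟩
  refine ⟨(δ⁻¹).toNNReal, Measure.le_iff.2 fun A hA => ?_⟩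
  rw [Measure.map_apply_of_aemeasurable (aemeasurable_extChartAt_symm_restrict c hsub) hA,
    Measure.restrict_apply' hK.measurableSet]
  have h1 : ENNReal.ofReal δ * volume (e.symm ⁻¹' A ∩ K) ≤ vol g A := by
    refine le_trans ?_ (chartMeasure_le_vol g c A)
    rw [chartMeasure_apply g c hA, ← setLIntegral_const]
    refine (lintegral_mono_ae ?_).trans
      (lintegral_mono_set (s := e.symm ⁻¹' A ∩ K) fun y hy => ⟨hsub hy.2, hy.1⟩)
    have hm : MeasurableSet (e.symm ⁻¹' A ∩ K) := by
      have := (measurableSet_target_inter_preimage (d := d) c hA).inter hK.measurableSet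
      convert this using 1
      ext y
      simp only [mem_inter_iff, mem_preimage]
      exact ⟨fun h => ⟨⟨hsub h.2, h.1⟩, h.2⟩, fun h => ⟨h.1.2, h.2⟩⟩
    exact (ae_restrict_iff' hm).2 (ae_of_all _ fun y hy => ENNReal.ofReal_le_ofReal (hle y hy.2))
  calc volume (e.symm ⁻¹' A ∩ K)
      = ENNReal.ofReal δ⁻¹ * (ENNReal.ofReal δ * volume (e.symm ⁻¹' A ∩ K)) := by
        rw [← mul_assoc, ← ENNReal.ofReal_mul (by positivity), inv_mul_cancel₀ hδ.ne',
          ENNReal.ofReal_one, one_mul]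
    _ ≤ ENNReal.ofReal δ⁻¹ * vol g A := by gcongr
    _ = ((δ⁻¹).toNNReal • vol g) A := by
        rw [Measure.smul_apply]; rfl

/-- On compact sets of coordinates, the Riemannian volume is controlled by Lebesgue measure. -/
theorem exists_vol_restrict_le_map_symm (g : SmoothMetric d M) (c : M) {K : Set (Model d)}
    (hK : IsCompact K) (hsub : K ⊆ (extChartAt 𝓘(ℝ, Model d) c).target) :
    ∃ B : ℝ≥0, (vol g).restrict ((extChartAt 𝓘(ℝ, Model d) c).source ∩
      extChartAt 𝓘(ℝ, Model d) c ⁻¹' K) ≤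
        B • (volume.restrict K).map (extChartAt 𝓘(ℝ, Model d) c).symm := by
  set e := extChartAt 𝓘(ℝ, Model d) c with he
  obtain ⟨B, hB⟩ := hK.exists_bound_of_continuousOn ((continuousOn_volumeDensity g c).mono hsub)
  refine ⟨B.toNNReal, Measure.le_iff.2 fun A hA => ?_⟩
  have h1 : (vol g).restrict (e.source ∩ e ⁻¹' K) A ≤
      ∫⁻ y in e.symm ⁻¹' A ∩ K, ENNReal.ofReal (volumeDensity g c y) := by
    have hUm : MeasurableSet (e.source ∩ e ⁻¹' K) := by
      have h := (continuousOn_iff_continuous_domRestrict.1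
        (continuousOn_extChartAt (I := 𝓘(ℝ, Model d)) c)).measurable hK.measurableSet
      have h2 := (measurableSet_source (d := d) c).subtype_image h
      convert h2 using 1
      ext y
      simp [and_comm, e]
    rw [Measure.restrict_apply hA]
    have h2 : vol g (A ∩ (e.source ∩ e ⁻¹' K)) = chartMeasure g c (A ∩ (e.source ∩ e ⁻¹' K)) := by
      rw [← vol_restrict_source, Measure.restrict_apply (hA.inter hUm)]
      congr 1
      exact (inter_eq_self_of_subset_left fun x hx => hx.2.1).symm
    rw [h2, chartMeasure_apply g c (hA.inter hUm)]
    refine lintegral_mono_set ?_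
    rintro y ⟨hy, hyA, -, hyK⟩
    have : e (e.symm y) ∈ K := hyK
    rw [e.right_inv hy] at this
    exact ⟨hyA, this⟩
  refine h1.trans ?_
  rw [Measure.smul_apply, Measure.map_apply_of_aemeasurable
    (aemeasurable_extChartAt_symm_restrict c hsub) hA, Measure.restrict_apply' hK.measurableSet]
  calc _ ≤ ∫⁻ _ in e.symm ⁻¹' A ∩ K, ENNReal.ofReal B := by
        have hm : MeasurableSet (e.symm ⁻¹' A ∩ K) := by
          have := (measurableSet_target_inter_preimage (d := d) c hA).inter hK.measurableSet
          convert this using 1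
          ext y
          simp only [mem_inter_iff, mem_preimage]
          exact ⟨fun h => ⟨⟨hsub h.2, h.1⟩, h.2⟩, fun h => ⟨h.1.2, h.2⟩⟩
        exact setLIntegral_mono' hm fun y hy =>
          ENNReal.ofReal_le_ofReal ((le_abs_self _).trans (hB y hy.2))
    _ = _ := by rw [setLIntegral_const]; rfl

omit [MeasurableSpace M] [BorelSpace M] in
/-- The Euclidean differential of a function in a chart is controlled by its Riemannian norm. -/
theorem exists_norm_fderiv_chart_le (g : SmoothMetric d M) (c : M) {K : Set (Model d)}
    (hK : IsCompact K) (hsub : K ⊆ (extChartAt 𝓘(ℝ, Model d) c).target) :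
    ∃ G : ℝ, 0 ≤ G ∧ ∀ F : M → ℂ, IsSmooth d F → ∀ y ∈ K,
      ‖fderiv ℝ (F ∘ (extChartAt 𝓘(ℝ, Model d) c).symm) y‖ ≤
        G * covecNorm g ((extChartAt 𝓘(ℝ, Model d) c).symm y)
          (differential d F ((extChartAt 𝓘(ℝ, Model d) c).symm y)) := by
  set e := extChartAt 𝓘(ℝ, Model d) c with he
  have hb : ∀ i : Fin d, ∃ B : ℝ, ∀ y ∈ K,
      ‖Real.sqrt (gram g (e.symm y) (coordFrame c y) i i)‖ ≤ B := fun i =>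
    hK.exists_bound_of_continuousOn
      (((continuousOn_gram_coordFrame g c i i).mono hsub).sqrt)
  choose B hB using hb
  refine ⟨∑ i, |B i|, Finset.sum_nonneg fun i _ => abs_nonneg _, fun F hF y hy => ?_⟩
  refine ContinuousLinearMap.opNorm_le_bound _
    (mul_nonneg (Finset.sum_nonneg fun i _ => abs_nonneg _) (covecNorm_nonneg _ _ _)) fun v => ?_
  have hv : v = ∑ i, v i • (EuclideanSpace.single i (1 : ℝ) : Model d) := by
    ext j; simp [Finset.sum_apply, Pi.single_apply]
  conv_lhs => rw [hv]
  rw [map_sum, Finset.sum_mul, Finset.sum_mul]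
  refine (norm_sum_le _ _).trans (Finset.sum_le_sum fun i _ => ?_)
  rw [map_smul, norm_smul, ← differential_coordFrame hF c (hsub hy) i]
  have h1 := norm_apply_le_covecNorm g (e.symm y) (differential d F (e.symm y)) (coordFrame c y i)
  have h2 : Real.sqrt (g.inner (e.symm y) (coordFrame c y i) (coordFrame c y i)) ≤ |B i| :=
    (le_abs_self _).trans ((hB i y hy).trans (le_abs_self _))
  have h3 : ‖v i‖ ≤ ‖v‖ := PiLp.norm_apply_le v i
  have h4 := covecNorm_nonneg g (e.symm y) (differential d F (e.symm y))
  calc ‖v i‖ * _ ≤ ‖v‖ * (covecNorm g (e.symm y) (differential d F (e.symm y)) * |B i|) := by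
        gcongr; exact h1.trans (by gcongr)
    _ = _ := by ring

/-- The Sobolev inequality near a point, obtained from the Euclidean one by a cutoff. -/
theorem exists_nhds_sobolev (g : SmoothMetric d M) {q : ℝ≥0} (hq : 0 < q)
    (hsob : ∀ (a : Model d) (R : ℝ), ∃ C : ℝ≥0, ∀ v : Model d → ℂ, ContDiff ℝ 1 v →
      Function.support v ⊆ Metric.closedBall a R →
      eLpNorm v q volume ≤ C * eLpNorm (fderiv ℝ v) 2 volume) (c : M) :
    ∃ U ∈ 𝓝 c, ∃ C : ℝ≥0, ∀ F : M → ℂ, IsSmooth d F →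
      ∫⁻ x in U, ‖F x‖ₑ ^ (q : ℝ) ∂(vol g) ≤ C * (eLpNorm F 2 (vol g) +
        eLpNorm (fun x => covecNorm g x (differential d F x)) 2 (vol g)) ^ (q : ℝ) := by
  obtain ⟨r, hr, hsub⟩ := exists_closedBall_subset_target (d := d) c
  set e := extChartAt 𝓘(ℝ, Model d) c with he
  set K := Metric.closedBall (e c) r with hKdef
  set K' := Metric.closedBall (e c) (r / 2) with hK'def
  have hK : IsCompact K := isCompact_closedBall _ _
  have hK' : IsCompact K' := isCompact_closedBall _ _
  have hKK : K' ⊆ K := Metric.closedBall_subset_closedBall (by linarith)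
  let ρ : ContDiffBump (e c) := ⟨r / 2, r, by linarith, by linarith⟩
  obtain ⟨D, hD⟩ := exists_map_symm_le_vol g c hK hsub
  obtain ⟨B, hB⟩ := exists_vol_restrict_le_map_symm g c hK' (hKK.trans hsub)
  obtain ⟨G, hG0, hG⟩ := exists_norm_fderiv_chart_le g c hK hsub
  have hρc : ContDiff ℝ 1 ρ := ρ.contDiff
  obtain ⟨L, hL⟩ := hK.exists_bound_of_continuousOn
    (hρc.continuous_fderiv one_ne_zero).continuousOn
  obtain ⟨C, hC⟩ := hsob (e c) r
  have hq0 : (0 : ℝ) < q := hq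
  refine ⟨e.source ∩ e ⁻¹' K', mem_of_superset (chart_preimage_ball_mem_nhds (d := d) c
    (half_pos hr)) (inter_subset_inter_right _ (preimage_mono Metric.ball_subset_closedBall)),
    B * (C * ((G.toNNReal + L.toNNReal) * D ^ (2 : ℝ≥0∞).toReal⁻¹)) ^ (q : ℝ), fun F hF => ?_⟩
  set N := eLpNorm F 2 (vol g) +
    eLpNorm (fun x => covecNorm g x (differential d F x)) 2 (vol g) with hN
  set f : Model d → ℂ := F ∘ e.symm with hf
  set v : Model d → ℂ := fun y => ρ y • f y with hv
  have hfd : ContDiffOn ℝ ∞ f e.target := contDiffOn_comp_extChartAt_symm hF c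
  have hopen : IsOpen e.target := isOpen_extChartAt_target c
  have hvs : Function.support v ⊆ K := fun y hy => by
    have : y ∈ Function.support ρ := fun h => hy (by simp [hv, h])
    rw [ρ.support_eq] at this
    exact Metric.ball_subset_closedBall this
  have hfat : ∀ y ∈ e.target, ContDiffAt ℝ 1 f y := fun y hy =>
    ((hfd y hy).contDiffAt (hopen.mem_nhds hy)).of_le (by norm_cast)
  have hv1 : ContDiff ℝ 1 v := contDiff_iff_contDiffAt.2 fun y => by
    by_cases hy : y ∈ e.target
    · exact hρc.contDiffAt.smul (hfat y hy)
    · have hyK : y ∈ Kᶜ := fun h => hy (hsub h)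
      have : v =ᶠ[𝓝 y] fun _ => 0 := by
        filter_upwards [Metric.isClosed_closedBall.isOpen_compl.mem_nhds hyK] with z hz
        by_contra h
        exact hz (hvs h)
      exact contDiffAt_const.congr_of_eventuallyEq this
  have hfder : ∀ y ∈ K, ‖fderiv ℝ v y‖ ≤
      G * covecNorm g (e.symm y) (differential d F (e.symm y)) + L * ‖F (e.symm y)‖ := by
    intro y hy
    have h1 : HasFDerivAt v (ρ y • fderiv ℝ f y + (fderiv ℝ ρ y).smulRight (f y)) y :=
      ((hρc.differentiable one_ne_zero y).hasFDerivAt).smul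
        (((hfat y (hsub hy)).differentiableAt one_ne_zero).hasFDerivAt)
    rw [h1.fderiv]
    refine (norm_add_le _ _).trans (add_le_add ?_ ?_)
    · rw [norm_smul, Real.norm_of_nonneg ρ.nonneg]
      exact (mul_le_of_le_one_left (norm_nonneg _) ρ.le_one).trans (hG F hF y hy)
    · rw [ContinuousLinearMap.norm_smulRight_apply]
      exact mul_le_mul_of_nonneg_right (hL y hy) (norm_nonneg _)
  have hemeas := aemeasurable_extChartAt_symm_restrict (d := d) c hsub
  -- pull-backs of continuous functions are controlled in `L^2`
  have hpull : ∀ {φ : M → ℝ}, Continuous φ →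
      eLpNorm (fun y => φ (e.symm y)) 2 (volume.restrict K) ≤
        ((D ^ (2 : ℝ≥0∞).toReal⁻¹ : ℝ≥0) : ℝ≥0∞) * eLpNorm φ 2 (vol g) := by
    intro φ hφ
    have h1 := eLpNorm_map_measure (p := 2) (g := φ) (hφ.aestronglyMeasurable) hemeas
    have h2 := eLpNorm_mono_measure (p := 2) φ hD
    rw [eLpNorm_smul_measure_of_ne_top' ENNReal.ofNat_ne_top, h1] at h2
    exact h2
  have hpm : ∀ {φ : M → ℝ}, Continuous φ →
      AEStronglyMeasurable (fun y => φ (e.symm y)) (volume.restrict K) := fun hφ =>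
    (hφ.aestronglyMeasurable).comp_aemeasurable hemeas
  have hFc : Continuous F := hF.continuous
  have hgc := continuous_covecNorm_differential g hF
  have h1 : eLpNorm (fderiv ℝ v) 2 volume ≤
      ((G.toNNReal + L.toNNReal) * D ^ (2 : ℝ≥0∞).toReal⁻¹ : ℝ≥0) * N := by
    have hs2 : Function.support (fderiv ℝ v) ⊆ K :=
      (support_fderiv_subset ℝ).trans (closure_minimal hvs Metric.isClosed_closedBall)
    rw [eLpNorm_eq_restrict_of_support_subset hK.measurableSet hs2]
    have hL0 : ∀ y ∈ K, 0 ≤ L := fun y hy => (norm_nonneg _).trans (hL y hy)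
    calc eLpNorm (fderiv ℝ v) 2 (volume.restrict K)
        ≤ eLpNorm ((fun y => (G.toNNReal : ℝ) •
            covecNorm g (e.symm y) (differential d F (e.symm y))) +
            fun y => (L.toNNReal : ℝ) • ‖F (e.symm y)‖) 2 (volume.restrict K) := by
          refine eLpNorm_mono_ae_real ((ae_restrict_iff' hK.measurableSet).2
            (ae_of_all _ fun y hy => ?_))
          have := hfder y hy
          simp only [Pi.add_apply, smul_eq_mul, Real.coe_toNNReal _ hG0,
            Real.coe_toNNReal _ (hL0 y hy)]
          exact this
      _ ≤ eLpNorm (fun y => (G.toNNReal : ℝ) •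
            covecNorm g (e.symm y) (differential d F (e.symm y))) 2 (volume.restrict K) +
          eLpNorm (fun y => (L.toNNReal : ℝ) • ‖F (e.symm y)‖) 2 (volume.restrict K) :=
          eLpNorm_add_le ((hpm hgc).const_smul (G.toNNReal : ℝ))
            ((hpm hFc.norm).const_smul (L.toNNReal : ℝ)) (by norm_num)
      _ ≤ G.toNNReal * (((D ^ (2 : ℝ≥0∞).toReal⁻¹ : ℝ≥0) : ℝ≥0∞) * N) +
          L.toNNReal * (((D ^ (2 : ℝ≥0∞).toReal⁻¹ : ℝ≥0) : ℝ≥0∞) * N) := by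
          have hcs : ∀ (k : ℝ≥0) (ψ : Model d → ℝ), eLpNorm (fun y => (k : ℝ) • ψ y) 2
              (volume.restrict K) = k * eLpNorm ψ 2 (volume.restrict K) := fun k ψ => by
            have := eLpNorm_const_smul (k : ℝ) ψ 2 (volume.restrict K)
            have hk : ‖(k : ℝ)‖ₑ = k := by
              rw [Real.enorm_eq_ofReal (NNReal.coe_nonneg k), ENNReal.ofReal_coe_nnreal]
            exact this.trans (by rw [hk])
          rw [hcs, hcs]
          refine add_le_add ?_ ?_
          · gcongr
            exact (hpull hgc).trans (by gcongr; exact le_add_self)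
          · gcongr
            refine (hpull hFc.norm).trans ?_
            rw [eLpNorm_norm]
            gcongr
            exact le_self_add
      _ = _ := by push_cast; ring
  have hU := lintegral_mono' hB (le_refl fun x => ‖F x‖ₑ ^ (q : ℝ))
  refine hU.trans ?_
  have hFm : AEMeasurable (fun x => ‖F x‖ₑ ^ (q : ℝ)) ((volume.restrict K').map e.symm) :=
    (hFc.enorm.measurable.pow_const _).aemeasurable
  rw [lintegral_smul_measure, lintegral_map' hFm
    (aemeasurable_extChartAt_symm_restrict c (hKK.trans hsub)), ENNReal.smul_def, smul_eq_mul,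
    ENNReal.coe_mul, mul_assoc]
  gcongr
  calc ∫⁻ y in K', ‖F (e.symm y)‖ₑ ^ (q : ℝ) = ∫⁻ y in K', ‖v y‖ₑ ^ (q : ℝ) := by
        refine setLIntegral_congr_fun hK'.measurableSet fun y hy => ?_
        have : ρ y = 1 := ρ.one_of_mem_closedBall hy
        simp [hv, hf, this]
    _ ≤ ∫⁻ y, ‖v y‖ₑ ^ (q : ℝ) := setLIntegral_le_lintegral _ _
    _ = eLpNorm v q volume ^ (q : ℝ) := (eLpNorm_nnreal_pow_eq_lintegral hq.ne').symm
    _ ≤ (C * (((G.toNNReal + L.toNNReal) * D ^ (2 : ℝ≥0∞).toReal⁻¹ : ℝ≥0) * N)) ^ (q : ℝ) := by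
        gcongr
        exact (hC v hv1 hvs).trans (by gcongr)
    _ = _ := by
        rw [← mul_assoc, ← ENNReal.coe_mul, ENNReal.mul_rpow_of_nonneg _ _ hq0.le,
          ENNReal.coe_rpow_of_nonneg _ hq0.le]

/-- The Sobolev inequality on a compact manifold. -/
theorem exists_sobolev [CompactSpace M] (hd : 1 ≤ d) (g : SmoothMetric d M) :
    ∃ q : ℝ≥0, 2 < q ∧ ∃ C : ℝ≥0, ∀ F : M → ℂ, IsSmooth d F →
      eLpNorm F q (vol g) ≤ C * (eLpNorm F 2 (vol g) +
        eLpNorm (fun x => covecNorm g x (differential d F x)) 2 (vol g)) := by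
  obtain ⟨q, hq2, hsob⟩ := exists_local_sobolev hd
  have hq : 0 < q := zero_lt_two.trans hq2
  have hqr : (0 : ℝ) < q := hq
  refine ⟨q, hq2, ?_⟩
  have key : ∃ C : ℝ≥0, ∀ F : M → ℂ, IsSmooth d F →
      ∫⁻ x in univ, ‖F x‖ₑ ^ (q : ℝ) ∂(vol g) ≤ C * (eLpNorm F 2 (vol g) +
        eLpNorm (fun x => covecNorm g x (differential d F x)) 2 (vol g)) ^ (q : ℝ) := by
    refine isCompact_univ.induction_on (p := fun s => ∃ C : ℝ≥0, ∀ F : M → ℂ, IsSmooth d F →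
      ∫⁻ x in s, ‖F x‖ₑ ^ (q : ℝ) ∂(vol g) ≤ C * (eLpNorm F 2 (vol g) +
        eLpNorm (fun x => covecNorm g x (differential d F x)) 2 (vol g)) ^ (q : ℝ))
      ⟨0, fun F _ => by simp⟩ ?_ ?_ ?_
    · rintro s t hst ⟨C, hC⟩
      exact ⟨C, fun F hF => (lintegral_mono_set hst).trans (hC F hF)⟩
    · rintro s t ⟨C, hC⟩ ⟨C', hC'⟩
      refine ⟨C + C', fun F hF => (lintegral_union_le _ _ _).trans ?_⟩
      rw [ENNReal.coe_add, add_mul]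
      exact add_le_add (hC F hF) (hC' F hF)
    · intro c _
      obtain ⟨U, hU, h⟩ := exists_nhds_sobolev g hq hsob c
      exact ⟨U, mem_nhdsWithin_of_mem_nhds hU, h⟩
  obtain ⟨C, hC⟩ := key
  refine ⟨C ^ (1 / (q : ℝ)), fun F hF => ?_⟩
  have h1 := hC F hF
  rw [Measure.restrict_univ, ← eLpNorm_nnreal_pow_eq_lintegral hq.ne'] at h1
  have h2 := ENNReal.rpow_le_rpow h1 (z := 1 / (q : ℝ)) (by positivity)
  rw [ENNReal.mul_rpow_of_nonneg _ _ (by positivity), ← ENNReal.rpow_mul, ← ENNReal.rpow_mul,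
    mul_one_div_cancel hqr.ne', ENNReal.rpow_one, ENNReal.rpow_one] at h2
  rwa [ENNReal.coe_rpow_of_nonneg _ (by positivity)]

end Sobolev

/-! ### The Sobolev space as a completion -/

section SmoothFunctions

variable {d : ℕ} {M : Type*} [TopologicalSpace M] [ChartedSpace (Model d) M]

theorem IsSmooth.mdifferentiableAt {F : M → ℂ} (hF : IsSmooth d F) (x : M) :
    MDifferentiableAt 𝓘(ℝ, Model d) 𝓘(ℝ, ℂ) F x :=
  (ContMDiff.mdifferentiable hF (by simp)) x

theorem differential_add {F K : M → ℂ} (hF : IsSmooth d F) (hK : IsSmooth d K) (x : M) :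
    differential d (F + K) x = differential d F x + differential d K x :=
  ((hF.mdifferentiableAt x).hasMFDerivAt.add (hK.mdifferentiableAt x).hasMFDerivAt).mfderiv

theorem differential_sub {F K : M → ℂ} (hF : IsSmooth d F) (hK : IsSmooth d K) (x : M) :
    differential d (F - K) x = differential d F x - differential d K x :=
  ((hF.mdifferentiableAt x).hasMFDerivAt.sub (hK.mdifferentiableAt x).hasMFDerivAt).mfderiv

theorem differential_const_smul {F : M → ℂ} (hF : IsSmooth d F) (a : ℂ) (x : M) :
    differential d (a • F) x = a • differential d F x := by
  have h := (hF.mdifferentiableAt x).hasMFDerivAt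
  have h2 : HasMFDerivAt 𝓘(ℝ, Model d) 𝓘(ℝ, ℂ) (a • F) x (a • differential d F x : Covec d x) :=
    ⟨h.1.const_smul a, h.2.const_smul a⟩
  exact h2.mfderiv

/-- The complex vector space `C^∞(M; ℂ)`. -/
def smoothSubmodule (d : ℕ) (M : Type*) [TopologicalSpace M] [ChartedSpace (Model d) M] :
    Submodule ℂ (M → ℂ) where
  carrier := {F | IsSmooth d F}
  add_mem' hF hK := ContMDiff.add hF hK
  zero_mem' := contMDiff_const
  smul_mem' a F hF := by
    have : IsSmooth d fun x => a * F x :=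
      ((contDiff_const.mul contDiff_id : ContDiff ℝ ∞ fun z : ℂ => a * z).contMDiff).comp hF
    exact this

variable [IsManifold 𝓘(ℝ, Model d) ∞ M]

/-- The space `C^∞(M; ℂ)`, which will carry the scalar product of `H^1` given by the metric `g`. -/
def SmoothFn (_g : SmoothMetric d M) : Type _ := smoothSubmodule d M

noncomputable instance (g : SmoothMetric d M) : AddCommGroup (SmoothFn g) :=
  inferInstanceAs (AddCommGroup (smoothSubmodule d M))

noncomputable instance (g : SmoothMetric d M) : Module ℂ (SmoothFn g) :=
  inferInstanceAs (Module ℂ (smoothSubmodule d M))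

instance (g : SmoothMetric d M) : CoeFun (SmoothFn g) fun _ => M → ℂ :=
  ⟨fun F => F.1⟩

theorem SmoothFn.isSmooth {g : SmoothMetric d M} (F : SmoothFn g) : IsSmooth d F := F.2

theorem SmoothFn.continuous {g : SmoothMetric d M} (F : SmoothFn g) : Continuous (F : M → ℂ) :=
  F.isSmooth.continuous

theorem SmoothFn.coe_add {g : SmoothMetric d M} (F K : SmoothFn g) : ⇑(F + K) = ⇑F + ⇑K := rfl

theorem SmoothFn.coe_sub {g : SmoothMetric d M} (F K : SmoothFn g) : ⇑(F - K) = ⇑F - ⇑K := rfl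

theorem SmoothFn.coe_smul {g : SmoothMetric d M} (a : ℂ) (F : SmoothFn g) : ⇑(a • F) = a • ⇑F := rfl

variable [CompactSpace M] [MeasurableSpace M] [BorelSpace M]

theorem integrable_of_continuous (g : SmoothMetric d M) {E : Type*} [NormedAddCommGroup E]
    [SecondCountableTopology E] {f : M → E} (hf : Continuous f) : Integrable f (vol g) := by
  have := isFiniteMeasure_vol g
  have h := hf.continuousOn.integrableOn_compact' isCompact_univ MeasurableSet.univ (μ := vol g)
  rwa [integrableOn_univ] at h

theorem memLp_of_continuous (g : SmoothMetric d M) {E : Type*} [NormedAddCommGroup E]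
    [SecondCountableTopology E] {f : M → E} (hf : Continuous f) (p : ℝ≥0∞) : MemLp f p (vol g) := by
  have := isFiniteMeasure_vol g
  obtain ⟨C, hC⟩ := isCompact_univ.exists_bound_of_continuousOn hf.continuousOn
  borelize E
  exact MemLp.of_bound hf.measurable.aestronglyMeasurable C (ae_of_all _ fun x => hC x (mem_univ x))

/-- The scalar product `(F, K) ↦ ∫ K conj(F) + ∫ ⟨dK, dF⟩_g` of `H^1` on smooth functions, linear
in the second variable. -/
noncomputable abbrev smoothFnCore (g : SmoothMetric d M) :
    PreInnerProductSpace.Core ℂ (SmoothFn g) where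
  inner F K := (∫ x, conj (F x) * K x ∂(vol g)) +
    ∫ x, covecInner g x (differential d K x) (differential d F x) ∂(vol g)
  conj_inner_symm F K := by
    rw [map_add, ← integral_conj, ← integral_conj]
    congr 1
    · exact integral_congr_ae (ae_of_all _ fun x => by simp [mul_comm])
    · exact integral_congr_ae (ae_of_all _ fun x => covecInner_conj_symm g x _ _)
  re_inner_nonneg F := by
    have h1 : ∀ x, conj (F x) * F x = ((‖F x‖ ^ 2 : ℝ) : ℂ) := fun x => by
      rw [Complex.conj_mul']; push_cast; rfl
    simp_rw [h1, covecInner_self, integral_complex_ofReal]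
    rw [← Complex.ofReal_add]
    exact add_nonneg (integral_nonneg fun x => sq_nonneg _) (integral_nonneg fun x => sq_nonneg _)
  add_left F K L := by
    have h1 : ∀ F K : SmoothFn g, Integrable (fun x => conj (F x) * K x) (vol g) := fun F K =>
      integrable_of_continuous g ((Complex.continuous_conj.comp F.continuous).mul K.continuous)
    have h2 : ∀ F K : SmoothFn g, Integrable
        (fun x => covecInner g x (differential d K x) (differential d F x)) (vol g) := fun F K =>
      integrable_of_continuous g (continuous_covecInner_differential g K.isSmooth F.isSmooth)
    have h3 : ∀ x, covecInner g x (differential d L x) (differential d (F + K : SmoothFn g) x) =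
        covecInner g x (differential d L x) (differential d F x) +
        covecInner g x (differential d L x) (differential d K x) := fun x => by
      rw [SmoothFn.coe_add, differential_add F.isSmooth K.isSmooth, ← covecInner_conj_symm,
        covecInner_add_left, map_add, covecInner_conj_symm, covecInner_conj_symm]
    simp_rw [h3, SmoothFn.coe_add, Pi.add_apply, map_add, add_mul]
    rw [integral_add (h1 F L) (h1 K L), integral_add (h2 F L) (h2 K L)]
    ring
  smul_left F K a := by
    have h3 : ∀ x, covecInner g x (differential d K x) (differential d (a • F : SmoothFn g) x) =
        conj a * covecInner g x (differential d K x) (differential d F x) := fun x => by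
      rw [SmoothFn.coe_smul, differential_const_smul F.isSmooth, ← covecInner_conj_symm,
        covecInner_smul_left, map_mul, covecInner_conj_symm]
    simp_rw [h3, SmoothFn.coe_smul, Pi.smul_apply, smul_eq_mul, map_mul, mul_assoc]
    rw [integral_const_mul, integral_const_mul]
    ring

noncomputable instance (g : SmoothMetric d M) : SeminormedAddCommGroup (SmoothFn g) :=
  @InnerProductSpace.Core.toSeminormedAddCommGroup ℂ _ _ _ _ (smoothFnCore g)

noncomputable instance (g : SmoothMetric d M) : InnerProductSpace ℂ (SmoothFn g) :=
  InnerProductSpace.ofCore (smoothFnCore g)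

theorem SmoothFn.inner_def {g : SmoothMetric d M} (F K : SmoothFn g) :
    inner ℂ F K = (∫ x, conj (F x) * K x ∂(vol g)) +
      ∫ x, covecInner g x (differential d K x) (differential d F x) ∂(vol g) := rfl

theorem SmoothFn.norm_sq {g : SmoothMetric d M} (F : SmoothFn g) :
    ‖F‖ ^ 2 = (eLpNorm F 2 (vol g)).toReal ^ 2 +
      (eLpNorm (fun x => covecNorm g x (differential d F x)) 2 (vol g)).toReal ^ 2 := by
  have hL : ∀ {E : Type} [NormedAddCommGroup E] [SecondCountableTopology E] {f : M → E},
      Continuous f → (eLpNorm f 2 (vol g)).toReal ^ 2 = ∫ x, ‖f x‖ ^ 2 ∂(vol g) := by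
    intro E _ _ f hf
    have h := memLp_of_continuous g hf 2
    rw [h.eLpNorm_eq_integral_rpow_norm two_ne_zero ENNReal.ofNat_ne_top]
    have h0 : 0 ≤ ∫ x, ‖f x‖ ^ 2 ∂(vol g) := integral_nonneg fun x => sq_nonneg _
    rw [ENNReal.toReal_ofReal (by positivity)]
    simp only [ENNReal.toReal_ofNat, Real.rpow_ofNat]
    rw [← Real.rpow_natCast, ← Real.rpow_mul h0]
    norm_num
  rw [hL F.continuous, hL (continuous_covecNorm_differential g F.isSmooth),
    @norm_sq_eq_re_inner ℂ, SmoothFn.inner_def]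
  have h1 : ∀ x, conj (F x) * F x = ((‖F x‖ ^ 2 : ℝ) : ℂ) := fun x => by
    rw [Complex.conj_mul']; push_cast; rfl
  simp_rw [h1, covecInner_self, integral_complex_ofReal, Real.norm_eq_abs, sq_abs]
  rw [← Complex.ofReal_add]
  exact Complex.ofReal_re _

theorem SmoothFn.norm_le {g : SmoothMetric d M} (F : SmoothFn g) :
    ‖F‖ ≤ (eLpNorm F 2 (vol g)).toReal +
      (eLpNorm (fun x => covecNorm g x (differential d F x)) 2 (vol g)).toReal := by
  refine abs_le_of_sq_le_sq' ?_ (by positivity) |>.2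
  rw [F.norm_sq]
  nlinarith [mul_nonneg (ENNReal.toReal_nonneg (a := eLpNorm F 2 (vol g))) (ENNReal.toReal_nonneg
    (a := eLpNorm (fun x => covecNorm g x (differential d F x)) 2 (vol g)))]

theorem SmoothFn.toReal_eLpNorm_le {g : SmoothMetric d M} (F : SmoothFn g) :
    (eLpNorm F 2 (vol g)).toReal ≤ ‖F‖ := by
  refine abs_le_of_sq_le_sq' ?_ (norm_nonneg _) |>.2
  rw [F.norm_sq]
  exact le_add_of_nonneg_right (sq_nonneg _)

/-- The Sobolev space `H^1(M)`, as the completion of `C^∞(M; ℂ)`. -/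
abbrev SobolevSpace (g : SmoothMetric d M) : Type _ := UniformSpace.Completion (SmoothFn g)

/-- The inclusion of `C^∞(M; ℂ)` in `L^2(M)`. -/
noncomputable def smoothToL2 (g : SmoothMetric d M) : SmoothFn g →ₗ[ℂ] Lp ℂ 2 (vol g) where
  toFun F := (memLp_of_continuous g F.continuous 2).toLp F
  map_add' _ _ := rfl
  map_smul' _ _ := rfl

theorem norm_smoothToL2_le (g : SmoothMetric d M) (F : SmoothFn g) :
    ‖smoothToL2 g F‖ ≤ 1 * ‖F‖ := by
  rw [one_mul]
  exact (Lp.norm_toLp F (memLp_of_continuous g F.continuous 2)).trans_le F.toReal_eLpNorm_le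

/-- The continuous map `H^1(M) → L^2(M)` that extends the inclusion of `C^∞(M; ℂ)`. -/
noncomputable def sobolevToL2 (g : SmoothMetric d M) : SobolevSpace g →L[ℂ] Lp ℂ 2 (vol g) :=
  (smoothToL2 g).extendOfNorm
    (UniformSpace.Completion.toComplL (𝕜 := ℂ) (E := SmoothFn g)).toLinearMap

theorem sobolevToL2_coe (g : SmoothMetric d M) (F : SmoothFn g) :
    sobolevToL2 g (F : SobolevSpace g) = smoothToL2 g F :=
  LinearMap.extendOfNorm_eq (UniformSpace.Completion.denseRange_coe)
    ⟨1, fun F => by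
      simpa using norm_smoothToL2_le g F⟩ F

end SmoothFunctions

/-! ### Weak gradients -/

section WeakGradient

variable {d : ℕ} {M : Type*} [TopologicalSpace M] [ChartedSpace (Model d) M]
  [IsManifold 𝓘(ℝ, Model d) ∞ M] [CompactSpace M] [MeasurableSpace M] [BorelSpace M]

/-- The convergence of smooth functions, with their gradients, to a function `f ∈ H^1` with weak
gradient `η`. -/
structure SmoothApprox (g : SmoothMetric d M) (f : M → ℂ) (η : ∀ x : M, Covec d x)
    (F : ℕ → SmoothFn g) : Prop where
  aestronglyMeasurable : AEStronglyMeasurable f (vol g)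
  aestronglyMeasurable_covecNorm_sub : ∀ n,
    AEStronglyMeasurable (fun x => covecNorm g x (differential d (F n) x - η x)) (vol g)
  tendsto : Tendsto (fun n => eLpNorm (⇑(F n) - f) 2 (vol g)) atTop (𝓝 0)
  tendsto_differential : Tendsto
    (fun n => eLpNorm (fun x => covecNorm g x (differential d (F n) x - η x)) 2 (vol g)) atTop (𝓝 0)

omit [CompactSpace M] [BorelSpace M] in
theorem HasWeakGradient.exists_smoothApprox {g : SmoothMetric d M} {f : M → ℂ}
    {η : ∀ x : M, Covec d x} (h : HasWeakGradient g f η) :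
    ∃ F : ℕ → SmoothFn g, SmoothApprox g f η F := by
  obtain ⟨hf, F, hF, hm, h1, h2⟩ := h
  exact ⟨fun n => ⟨F n, hF n⟩, hf, hm, h1, h2⟩

variable {g : SmoothMetric d M} {f : M → ℂ} {η : ∀ x : M, Covec d x} {F : ℕ → SmoothFn g}

namespace SmoothApprox

omit [CompactSpace M] [BorelSpace M] in
theorem exists_seq_ae (h : SmoothApprox g f η F) : ∃ ns : ℕ → ℕ, StrictMono ns ∧
    ∀ᵐ x ∂(vol g), Tendsto (fun n => covecNorm g x (differential d (F (ns n)) x - η x))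
      atTop (𝓝 0) := by
  refine TendstoInMeasure.exists_seq_tendsto_ae (g := fun _ => (0 : ℝ))
    (f := fun n x => covecNorm g x (differential d (F n) x - η x)) ?_
  refine tendstoInMeasure_of_tendsto_eLpNorm two_ne_zero h.aestronglyMeasurable_covecNorm_sub
    aestronglyMeasurable_const ?_
  refine h.tendsto_differential.congr fun n => ?_
  congr 1
  ext x
  simp

omit [CompactSpace M] in
theorem aestronglyMeasurable_covecNorm (h : SmoothApprox g f η F) :
    AEStronglyMeasurable (fun x => covecNorm g x (η x)) (vol g) := by
  obtain ⟨ns, -, hns⟩ := h.exists_seq_ae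
  refine aestronglyMeasurable_of_tendsto_ae atTop
    (f := fun n x => covecNorm g x (differential d (F (ns n)) x))
    (fun n => (continuous_covecNorm_differential g (F (ns n)).isSmooth).aestronglyMeasurable) ?_
  filter_upwards [hns] with x hx
  rw [tendsto_iff_norm_sub_tendsto_zero]
  exact squeeze_zero (fun n => norm_nonneg _) (fun n => abs_covecNorm_sub_le g x _ _) hx

omit [CompactSpace M] in
theorem aestronglyMeasurable_covecInner (h : SmoothApprox g f η F) (ψ : SmoothFn g) :
    AEStronglyMeasurable (fun x => covecInner g x (η x) (differential d ψ x)) (vol g) := by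
  obtain ⟨ns, -, hns⟩ := h.exists_seq_ae
  refine aestronglyMeasurable_of_tendsto_ae atTop
    (f := fun n x => covecInner g x (differential d (F (ns n)) x) (differential d ψ x))
    (fun n => (continuous_covecInner_differential g (F (ns n)).isSmooth
      ψ.isSmooth).measurable.aestronglyMeasurable) ?_
  filter_upwards [hns] with x hx
  rw [tendsto_iff_norm_sub_tendsto_zero]
  refine squeeze_zero (fun n => norm_nonneg _) (fun n => ?_)
    (by simpa using hx.mul_const (covecNorm g x (differential d ψ x)))
  rw [← covecInner_sub_left]
  exact norm_covecInner_le g x _ _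

omit [CompactSpace M] in
theorem eLpNorm_le (h : SmoothApprox g f η F) (n : ℕ) :
    eLpNorm (F n) 2 (vol g) ≤ eLpNorm f 2 (vol g) + eLpNorm (⇑(F n) - f) 2 (vol g) := by
  have h1 : AEStronglyMeasurable (⇑(F n) - f) (vol g) :=
    (F n).continuous.measurable.aestronglyMeasurable.sub h.aestronglyMeasurable
  have := eLpNorm_add_le (p := 2) h.aestronglyMeasurable h1 (by norm_num)
  rwa [add_sub_cancel] at this

omit [CompactSpace M] in
theorem eLpNorm_covecNorm_le (h : SmoothApprox g f η F) (n : ℕ) :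
    eLpNorm (fun x => covecNorm g x (differential d (F n) x)) 2 (vol g) ≤
      eLpNorm (fun x => covecNorm g x (η x)) 2 (vol g) +
        eLpNorm (fun x => covecNorm g x (differential d (F n) x - η x)) 2 (vol g) := by
  refine le_trans ?_ (eLpNorm_add_le (p := 2) h.aestronglyMeasurable_covecNorm
    (h.aestronglyMeasurable_covecNorm_sub n) (by norm_num))
  refine eLpNorm_mono_real fun x => ?_
  rw [Real.norm_of_nonneg (covecNorm_nonneg _ _ _)]
  have := covecNorm_add_le g x (η x) (differential d (F n) x - η x)
  rwa [add_sub_cancel] at this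

theorem memLp (h : SmoothApprox g f η F) : MemLp f 2 (vol g) := by
  obtain ⟨n, hn⟩ := (h.tendsto.eventually_lt_const zero_lt_one).exists
  have h1 : MemLp (⇑(F n) - f) 2 (vol g) :=
    ⟨(F n).continuous.measurable.aestronglyMeasurable.sub h.aestronglyMeasurable,
      hn.trans ENNReal.one_lt_top⟩
  have := (memLp_of_continuous g (F n).continuous 2).sub h1
  rwa [sub_sub_cancel] at this

theorem memLp_covecNorm (h : SmoothApprox g f η F) :
    MemLp (fun x => covecNorm g x (η x)) 2 (vol g) := by
  obtain ⟨n, hn⟩ := (h.tendsto_differential.eventually_lt_const zero_lt_one).exists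
  have h1 : MemLp (fun x => covecNorm g x (differential d (F n) x - η x)) 2 (vol g) :=
    ⟨h.aestronglyMeasurable_covecNorm_sub n, hn.trans ENNReal.one_lt_top⟩
  have h2 := memLp_of_continuous g (continuous_covecNorm_differential g (F n).isSmooth) 2
  refine (h2.add h1).mono h.aestronglyMeasurable_covecNorm (ae_of_all _ fun x => ?_)
  have h3 := covecNorm_add_le g x (differential d (F n) x) (-(differential d (F n) x - η x))
  rw [covecNorm_neg, neg_sub, add_sub_cancel] at h3
  rw [Real.norm_of_nonneg (covecNorm_nonneg _ _ _)]
  exact h3.trans (le_abs_self _)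

theorem memLp_covecNorm_sub (h : SmoothApprox g f η F) (n : ℕ) :
    MemLp (fun x => covecNorm g x (differential d (F n) x - η x)) 2 (vol g) := by
  have h2 := memLp_of_continuous g (continuous_covecNorm_differential g (F n).isSmooth) 2
  refine (h2.add h.memLp_covecNorm).mono (h.aestronglyMeasurable_covecNorm_sub n)
    (ae_of_all _ fun x => ?_)
  have h3 := covecNorm_add_le g x (differential d (F n) x) (-η x)
  rw [covecNorm_neg, ← sub_eq_add_neg] at h3
  rw [Real.norm_of_nonneg (covecNorm_nonneg _ _ _)]
  exact h3.trans (le_abs_self _)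

theorem norm_sub_le (h : SmoothApprox g f η F) (n m : ℕ) :
    ‖F n - F m‖ ≤ ((eLpNorm (⇑(F n) - f) 2 (vol g)).toReal +
        (eLpNorm (fun x => covecNorm g x (differential d (F n) x - η x)) 2 (vol g)).toReal) +
      ((eLpNorm (⇑(F m) - f) 2 (vol g)).toReal +
        (eLpNorm (fun x => covecNorm g x (differential d (F m) x - η x)) 2 (vol g)).toReal) := by
  have hf : ∀ n, MemLp (⇑(F n) - f) 2 (vol g) := fun n =>
    (memLp_of_continuous g (F n).continuous 2).sub h.memLp
  have h1 : (eLpNorm (F n - F m : SmoothFn g) 2 (vol g)).toReal ≤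
      (eLpNorm (⇑(F n) - f) 2 (vol g)).toReal + (eLpNorm (⇑(F m) - f) 2 (vol g)).toReal := by
    rw [← ENNReal.toReal_add (hf n).eLpNorm_ne_top (hf m).eLpNorm_ne_top]
    refine ENNReal.toReal_mono (ENNReal.add_ne_top.2 ⟨(hf n).eLpNorm_ne_top,
      (hf m).eLpNorm_ne_top⟩) ?_
    have := eLpNorm_sub_le (p := 2) (hf n).1 (hf m).1 (by norm_num)
    rwa [sub_sub_sub_cancel_right] at this
  have h2 : (eLpNorm (fun x => covecNorm g x (differential d (F n - F m : SmoothFn g) x)) 2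
      (vol g)).toReal ≤
      (eLpNorm (fun x => covecNorm g x (differential d (F n) x - η x)) 2 (vol g)).toReal +
      (eLpNorm (fun x => covecNorm g x (differential d (F m) x - η x)) 2 (vol g)).toReal := by
    rw [← ENNReal.toReal_add (h.memLp_covecNorm_sub n).eLpNorm_ne_top
      (h.memLp_covecNorm_sub m).eLpNorm_ne_top]
    refine ENNReal.toReal_mono (ENNReal.add_ne_top.2 ⟨(h.memLp_covecNorm_sub n).eLpNorm_ne_top,
      (h.memLp_covecNorm_sub m).eLpNorm_ne_top⟩) ?_
    refine le_trans (eLpNorm_mono_real fun x => ?_) (eLpNorm_add_le (p := 2)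
      (h.memLp_covecNorm_sub n).1 (h.memLp_covecNorm_sub m).1 (by norm_num))
    rw [Real.norm_of_nonneg (covecNorm_nonneg _ _ _), SmoothFn.coe_sub,
      differential_sub (F n).isSmooth (F m).isSmooth]
    have := covecNorm_add_le g x (differential d (F n) x - η x) (-(differential d (F m) x - η x))
    rwa [covecNorm_neg, ← sub_eq_add_neg, sub_sub_sub_cancel_right] at this
  linarith [(F n - F m).norm_le]

theorem tendsto_integral_covecInner (h : SmoothApprox g f η F) (ψ : SmoothFn g) :
    Tendsto (fun n => ∫ x, covecInner g x (differential d (F n) x) (differential d ψ x) ∂(vol g))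
      atTop (𝓝 (∫ x, covecInner g x (η x) (differential d ψ x) ∂(vol g))) := by
  have hψ := memLp_of_continuous g (continuous_covecNorm_differential g ψ.isSmooth) 2
  refine tendsto_integral_of_L1 _ ?_ (Eventually.of_forall fun n => integrable_of_continuous g
    (continuous_covecInner_differential g (F n).isSmooth ψ.isSmooth)) ?_
  · exact h.aestronglyMeasurable_covecInner ψ
  · have hlim : Tendsto (fun n => eLpNorm (fun x => covecNorm g x (differential d (F n) x - η x)) 2
        (vol g) * eLpNorm (fun x => covecNorm g x (differential d ψ x)) 2 (vol g)) atTop (𝓝 0) := by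
      have := ENNReal.Tendsto.mul_const
        (b := eLpNorm (fun x => covecNorm g x (differential d ψ x)) 2 (vol g))
        h.tendsto_differential (Or.inr hψ.eLpNorm_ne_top)
      rwa [zero_mul] at this
    refine tendsto_of_tendsto_of_tendsto_of_le_of_le tendsto_const_nhds hlim (fun n => zero_le)
      fun n => ?_
    have h1 := eLpNorm_smul_le_mul_eLpNorm (p := 2) (q := 2) (r := 1) hψ.aestronglyMeasurable
      (h.aestronglyMeasurable_covecNorm_sub n)
    refine le_trans ?_ h1
    rw [eLpNorm_one_eq_lintegral_enorm]
    refine lintegral_mono fun x => ?_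
    rw [← covecInner_sub_left, ← ofReal_norm, ← ofReal_norm]
    exact ENNReal.ofReal_le_ofReal ((norm_covecInner_le g x _ _).trans (le_abs_self _))

end SmoothApprox

/-- A function of `H^1` is an element of the completion: the pairing with smooth functions is
computed with its weak gradient. -/
theorem HasWeakGradient.exists_sobolevSpace (h : HasWeakGradient g f η) :
    ∃ U : SobolevSpace g, (sobolevToL2 g U : M → ℂ) =ᵐ[vol g] f ∧
      (∀ ψ : SmoothFn g, inner ℂ (ψ : SobolevSpace g) U =
        inner ℂ (smoothToL2 g ψ) (sobolevToL2 g U) +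
          ∫ x, covecInner g x (η x) (differential d ψ x) ∂(vol g)) ∧
      ‖U‖ ≤ (eLpNorm f 2 (vol g)).toReal +
        (eLpNorm (fun x => covecNorm g x (η x)) 2 (vol g)).toReal := by
  obtain ⟨F, hF⟩ := h.exists_smoothApprox
  have hA : Tendsto (fun n => (eLpNorm (⇑(F n) - f) 2 (vol g)).toReal) atTop (𝓝 0) :=
    (ENNReal.tendsto_toReal ENNReal.zero_ne_top).comp hF.tendsto
  have hB : Tendsto (fun n => (eLpNorm (fun x => covecNorm g x (differential d (F n) x - η x)) 2
      (vol g)).toReal) atTop (𝓝 0) :=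
    (ENNReal.tendsto_toReal ENNReal.zero_ne_top).comp hF.tendsto_differential
  have hcauchy : CauchySeq fun n => (F n : SobolevSpace g) := by
    refine Metric.cauchySeq_iff.2 fun ε hε => ?_
    have hAB := hA.add hB
    rw [add_zero] at hAB
    obtain ⟨N, hN⟩ := eventually_atTop.1 (hAB.eventually_lt_const (half_pos hε))
    refine ⟨N, fun n hn m hm => ?_⟩
    rw [UniformSpace.Completion.dist_eq, dist_eq_norm]
    linarith [hF.norm_sub_le n m, hN n hn, hN m hm]
  obtain ⟨U, hU⟩ := cauchySeq_tendsto_of_complete hcauchy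
  have hjU : Tendsto (fun n => smoothToL2 g (F n)) atTop (𝓝 (sobolevToL2 g U)) := by
    have := ((sobolevToL2 g).continuous.tendsto U).comp hU
    exact this.congr fun n => sobolevToL2_coe g (F n)
  have hjf : Tendsto (fun n => smoothToL2 g (F n)) atTop (𝓝 (hF.memLp.toLp f)) :=
    (Lp.tendsto_Lp_iff_tendsto_eLpNorm'' _ (fun n => memLp_of_continuous g (F n).continuous 2) f
      hF.memLp).2 hF.tendsto
  refine ⟨U, ?_, fun ψ => ?_, ?_⟩
  · rw [tendsto_nhds_unique hjU hjf]
    exact hF.memLp.coeFn_toLp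
  · have h1 : Tendsto (fun n => inner ℂ (ψ : SobolevSpace g) (F n : SobolevSpace g)) atTop
        (𝓝 (inner ℂ (ψ : SobolevSpace g) U)) := tendsto_const_nhds.inner hU
    refine tendsto_nhds_unique h1 (((tendsto_const_nhds.inner hjU).add
      (hF.tendsto_integral_covecInner ψ)).congr fun n => ?_)
    rw [UniformSpace.Completion.inner_coe, SmoothFn.inner_def, L2.inner_def]
    congr 1
    refine integral_congr_ae ?_
    filter_upwards [MemLp.coeFn_toLp (memLp_of_continuous g ψ.continuous 2),
      MemLp.coeFn_toLp (memLp_of_continuous g (F n).continuous 2)] with x h1 h2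
    have h1' : (smoothToL2 g ψ : M → ℂ) x = ψ x := h1
    have h2' : (smoothToL2 g (F n) : M → ℂ) x = F n x := h2
    rw [h1', h2', RCLike.inner_apply, mul_comm]
  · have hlim := (hA.const_add (eLpNorm f 2 (vol g)).toReal).add
      (hB.const_add (eLpNorm (fun x => covecNorm g x (η x)) 2 (vol g)).toReal)
    rw [add_zero, add_zero] at hlim
    refine le_of_tendsto_of_tendsto' hU.norm hlim fun n => ?_
    rw [UniformSpace.Completion.norm_coe]
    have hfn : MemLp (⇑(F n) - f) 2 (vol g) :=
      (memLp_of_continuous g (F n).continuous 2).sub hF.memLp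
    refine (F n).norm_le.trans (add_le_add ?_ ?_)
    · rw [← ENNReal.toReal_add hF.memLp.eLpNorm_ne_top hfn.eLpNorm_ne_top]
      exact ENNReal.toReal_mono (ENNReal.add_ne_top.2 ⟨hF.memLp.eLpNorm_ne_top,
        hfn.eLpNorm_ne_top⟩) (hF.eLpNorm_le n)
    · rw [← ENNReal.toReal_add hF.memLp_covecNorm.eLpNorm_ne_top
        (hF.memLp_covecNorm_sub n).eLpNorm_ne_top]
      exact ENNReal.toReal_mono (ENNReal.add_ne_top.2 ⟨hF.memLp_covecNorm.eLpNorm_ne_top,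
        (hF.memLp_covecNorm_sub n).eLpNorm_ne_top⟩) (hF.eLpNorm_covecNorm_le n)

omit [CompactSpace M] in
/-- The Sobolev inequality passes from smooth functions to `H^1`. -/
theorem HasWeakGradient.eLpNorm_le {q C : ℝ≥0} (hC : ∀ F : M → ℂ, IsSmooth d F →
      eLpNorm F q (vol g) ≤ C * (eLpNorm F 2 (vol g) +
        eLpNorm (fun x => covecNorm g x (differential d F x)) 2 (vol g)))
    (h : HasWeakGradient g f η) {c : ℝ≥0} (hc : eLpNorm f 2 (vol g) +
        eLpNorm (fun x => covecNorm g x (η x)) 2 (vol g) < c) :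
    eLpNorm f q (vol g) ≤ C * c := by
  obtain ⟨F, hF⟩ := h.exists_smoothApprox
  refine eLpNorm_le_of_tendstoInMeasure (u := atTop) (f := fun n => ⇑(F n)) ?_
    (tendstoInMeasure_of_tendsto_eLpNorm two_ne_zero
      (fun n => (F n).continuous.measurable.aestronglyMeasurable) hF.aestronglyMeasurable
      hF.tendsto)
    (fun n => (F n).continuous.measurable.aestronglyMeasurable)
  have hlim : Tendsto (fun n => (eLpNorm f 2 (vol g) + eLpNorm (⇑(F n) - f) 2 (vol g)) +
      (eLpNorm (fun x => covecNorm g x (η x)) 2 (vol g) +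
        eLpNorm (fun x => covecNorm g x (differential d (F n) x - η x)) 2 (vol g))) atTop
      (𝓝 ((eLpNorm f 2 (vol g) + 0) + (eLpNorm (fun x => covecNorm g x (η x)) 2 (vol g) + 0))) :=
    (tendsto_const_nhds.add hF.tendsto).add (tendsto_const_nhds.add hF.tendsto_differential)
  rw [add_zero, add_zero] at hlim
  filter_upwards [hlim.eventually_lt_const hc] with n hn
  refine (hC (F n) (F n).isSmooth).trans ?_
  gcongr
  exact (add_le_add (hF.eLpNorm_le n) (hF.eLpNorm_covecNorm_le n)).trans hn.le

end WeakGradient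

/-! ### Measurability in time and density of test functions -/

section Measurability

/-- A function with values in `L^2` is strongly measurable when it is given by a jointly measurable
function. -/
theorem aestronglyMeasurable_of_prod {α β : Type*} [MeasurableSpace α] [MeasurableSpace β]
    {μ : Measure α} {ν : Measure β} [SFinite ν] [SecondCountableTopology (Lp ℂ 2 ν)]
    {u : α → β → ℂ} (hu : AEStronglyMeasurable (fun p : α × β => u p.1 p.2) (μ.prod ν))
    {W : α → Lp ℂ 2 ν} (hW : ∀ᵐ t ∂μ, (W t : β → ℂ) =ᵐ[ν] u t) : AEStronglyMeasurable W μ := by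
  classical
  set u' := hu.mk with hu'
  have hu'm : StronglyMeasurable u' := hu.stronglyMeasurable_mk
  have hs : ∀ t, StronglyMeasurable fun x => u' (t, x) := fun t =>
    hu'm.comp_measurable measurable_prodMk_left
  have hnorm : ∀ h : Lp ℂ 2 ν, Measurable fun t => eLpNorm (fun x => u' (t, x) - h x) 2 ν := by
    intro h
    simp_rw [eLpNorm_eq_lintegral_rpow_enorm_toReal two_ne_zero ENNReal.ofNat_ne_top]
    refine Measurable.pow_const (Measurable.lintegral_prod_right' (ν := ν)
      (f := fun p : α × β => ‖u' p - h p.2‖ₑ ^ (2 : ℝ≥0∞).toReal) ?_) _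
    exact ((hu'm.sub ((Lp.stronglyMeasurable h).comp_measurable measurable_snd)).enorm).pow_const _
  let S : Set α := {t | eLpNorm (fun x => u' (t, x)) 2 ν < ⊤}
  have hS : MeasurableSet S := by
    have h0 := hnorm 0
    have h1 : ∀ t, eLpNorm (fun x => u' (t, x) - (0 : Lp ℂ 2 ν) x) 2 ν =
        eLpNorm (fun x => u' (t, x)) 2 ν := fun t => by
      refine eLpNorm_congr_ae ?_
      filter_upwards [Lp.coeFn_zero ℂ 2 ν] with x hx
      rw [hx, Pi.zero_apply, sub_zero]
    simp_rw [h1] at h0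
    exact h0 measurableSet_Iio
  let W' : α → Lp ℂ 2 ν := fun t =>
    if h : t ∈ S then MemLp.toLp (fun x => u' (t, x)) ⟨(hs t).aestronglyMeasurable, h⟩ else 0
  -- the distances to fixed elements are measurable by Tonelli's theorem
  have hdist : ∀ h : Lp ℂ 2 ν, Measurable fun t => edist (W' t) h := by
    intro h
    have : (fun t => edist (W' t) h) = fun t =>
        if t ∈ S then eLpNorm (fun x => u' (t, x) - h x) 2 ν else edist (0 : Lp ℂ 2 ν) h := by
      funext t
      by_cases ht : t ∈ S
      · simp only [W', dif_pos ht, if_pos ht]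
        rw [Lp.edist_def]
        refine eLpNorm_congr_ae ?_
        filter_upwards [MemLp.coeFn_toLp (p := 2) (μ := ν) (f := fun x => u' (t, x))
          ⟨(hs t).aestronglyMeasurable, ht⟩] with x hx
        rw [Pi.sub_apply, hx]
      · simp only [W', dif_neg ht, if_neg ht]
    rw [this]
    exact Measurable.ite hS (hnorm h) measurable_const
  let _ : MeasurableSpace (Lp ℂ 2 ν) := borel _
  have : BorelSpace (Lp ℂ 2 ν) := ⟨rfl⟩
  -- every open set is a countable union of balls
  have hW' : Measurable W' := by
    refine measurable_of_isOpen fun O hO => ?_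
    have hr : ∀ h : O, ∃ r > 0, Metric.eball (h : Lp ℂ 2 ν) r ⊆ O := fun h =>
      EMetric.isOpen_iff.1 hO h h.2
    choose r hr0 hr using hr
    obtain ⟨I, hI, hcover⟩ := TopologicalSpace.isOpen_iUnion_countable
      (fun h : O => Metric.eball (h : Lp ℂ 2 ν) (r h)) (fun h => Metric.isOpen_eball)
    have hO' : O = ⋃ h ∈ I, Metric.eball (h : Lp ℂ 2 ν) (r h) := by
      rw [hcover]
      refine Subset.antisymm (fun x hx => mem_iUnion.2 ⟨⟨x, hx⟩, Metric.mem_eball_self (hr0 _)⟩)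
        (iUnion_subset hr)
    rw [hO', preimage_iUnion₂]
    exact MeasurableSet.biUnion hI fun h _ => hdist h measurableSet_Iio
  refine ⟨W', hW'.stronglyMeasurable, ?_⟩
  filter_upwards [hW, Measure.ae_ae_of_ae_prod hu.ae_eq_mk] with t h1 h2
  have h3 : (W t : β → ℂ) =ᵐ[ν] fun x => u' (t, x) := h1.trans h2
  have ht : t ∈ S := by
    have := Lp.eLpNorm_lt_top (W t)
    rwa [eLpNorm_congr_ae h3] at this
  refine Lp.ext ?_
  simp only [W', dif_pos ht]
  exact h3.trans (MemLp.coeFn_toLp _).symm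

end Measurability

section Density

variable {H V : Type*} [NormedAddCommGroup H] [InnerProductSpace ℂ H] [CompleteSpace H]
  [NormedAddCommGroup V] [InnerProductSpace ℂ V] [CompleteSpace V]

/-- It suffices to test the weak equation with a dense set of elements of `V`. -/
theorem isWeakEvolution_of_denseRange {X : Type*} {ι : X → V} (hι : DenseRange ι) {j : V →L[ℂ] H}
    {T C : ℝ} {w m : ℝ → H} {U : ℝ → V}
    (hw : AEStronglyMeasurable w (volume.restrict (Ioo 0 T)))
    (hm : AEStronglyMeasurable m (volume.restrict (Ioo 0 T)))
    (hU : ∀ x, AEStronglyMeasurable (fun t => inner ℂ (ι x) (U t)) (volume.restrict (Ioo 0 T)))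
    (hmC : ∀ᵐ t ∂(volume.restrict (Ioo 0 T)), ‖m t‖ ≤ C)
    (hUC : ∀ᵐ t ∂(volume.restrict (Ioo 0 T)), ‖U t‖ ≤ C)
    (hUw : ∀ᵐ t ∂(volume.restrict (Ioo 0 T)), j (U t) = w t)
    (heq : ∀ (φ : ℝ → ℝ) (x : X), ContDiff ℝ ∞ φ → HasCompactSupport φ → tsupport φ ⊆ Ioo 0 T →
      ∫ t in Ioo 0 T, (-Complex.I * ((deriv φ t : ℝ) : ℂ) * inner ℂ (j (ι x)) (w t)
        - (φ t : ℂ) * inner ℂ (ι x) (U t) + (φ t : ℂ) * inner ℂ (j (ι x)) (m t)) = 0) :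
    IsWeakEvolution j T w m := by
  intro φ h hφ hφc hφs
  set v := ContinuousLinearMap.adjoint j h with hv
  obtain ⟨x, hx⟩ : ∃ x : ℕ → X, Tendsto (fun k => ι (x k)) atTop (𝓝 v) := by
    obtain ⟨y, hy, hlim⟩ := mem_closure_iff_seq_limit.1 (hι v)
    choose x hx using hy
    exact ⟨x, by simpa only [hx] using hlim⟩
  obtain ⟨R, hR⟩ : ∃ R, ∀ k, ‖ι (x k)‖ ≤ R := by
    obtain ⟨R, hR⟩ := (Metric.isBounded_range_of_tendsto _ hx).exists_norm_le
    exact ⟨R, fun k => hR _ (mem_range_self k)⟩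
  have hR0 : 0 ≤ R := (norm_nonneg _).trans (hR 0)
  have hφ' : Continuous (deriv φ) := hφ.continuous_deriv (by simp)
  have hlim := tendsto_integral_of_dominated_convergence (μ := volume.restrict (Ioo 0 T))
    (F := fun k t => -Complex.I * ((deriv φ t : ℝ) : ℂ) * inner ℂ (j (ι (x k))) (w t)
        - (φ t : ℂ) * inner ℂ (ι (x k)) (U t) + (φ t : ℂ) * inner ℂ (j (ι (x k))) (m t))
    (f := fun t => -Complex.I * ((deriv φ t : ℝ) : ℂ) * inner ℂ (smoothing j h) (w t)
        - (φ t : ℂ) * inner ℂ h (w t) + (φ t : ℂ) * inner ℂ (smoothing j h) (m t))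
    (fun t => |deriv φ t| * (‖j‖ * R * (‖j‖ * C)) + |φ t| * (R * C) + |φ t| * (‖j‖ * R * C))
    ?_ ?_ ?_ ?_
  · refine tendsto_nhds_unique hlim ?_
    simp_rw [heq φ _ hφ hφc hφs]
    exact tendsto_const_nhds
  · intro k
    refine ((AEStronglyMeasurable.mul ?_ ?_).sub (AEStronglyMeasurable.mul ?_ (hU _))).add
      (AEStronglyMeasurable.mul ?_ ?_)
    · exact (continuous_const.mul (Complex.continuous_ofReal.comp hφ')).aestronglyMeasurable
    · exact aestronglyMeasurable_const.inner hw
    · exact (Complex.continuous_ofReal.comp hφ.continuous).aestronglyMeasurable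
    · exact (Complex.continuous_ofReal.comp hφ.continuous).aestronglyMeasurable
    · exact aestronglyMeasurable_const.inner hm
  · have hc : Continuous fun t => |deriv φ t| * (‖j‖ * R * (‖j‖ * C)) + |φ t| * (R * C) +
        |φ t| * (‖j‖ * R * C) := by
      have := hφ.continuous
      fun_prop
    exact (hc.continuousOn.integrableOn_Icc (a := 0) (b := T)).mono_set Ioo_subset_Icc_self
  · intro k
    filter_upwards [hmC, hUC, hUw] with t h1 h2 h3
    have hj : ‖j (ι (x k))‖ ≤ ‖j‖ * R :=
      (j.le_opNorm _).trans (mul_le_mul_of_nonneg_left (hR k) (norm_nonneg _))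
    have hwC : ‖w t‖ ≤ ‖j‖ * C := by
      rw [← h3]; exact (j.le_opNorm _).trans (mul_le_mul_of_nonneg_left h2 (norm_nonneg _))
    refine (norm_add_le _ _).trans (add_le_add ((norm_sub_le _ _).trans (add_le_add ?_ ?_)) ?_)
    · rw [norm_mul, norm_mul, norm_neg, Complex.norm_I, one_mul, Complex.norm_real,
        Real.norm_eq_abs]
      gcongr
      exact (norm_inner_le_norm _ _).trans (mul_le_mul hj hwC (norm_nonneg _) (by positivity))
    · rw [norm_mul, Complex.norm_real, Real.norm_eq_abs]
      gcongr
      exact (norm_inner_le_norm _ _).trans (mul_le_mul (hR k) h2 (norm_nonneg _) hR0)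
    · rw [norm_mul, Complex.norm_real, Real.norm_eq_abs]
      gcongr
      exact (norm_inner_le_norm _ _).trans (mul_le_mul hj h1 (norm_nonneg _) (by positivity))
  · filter_upwards [hUw] with t h3
    have hj : Tendsto (fun k => j (ι (x k))) atTop (𝓝 (smoothing j h)) :=
      (j.continuous.tendsto v).comp hx
    have h4 : inner ℂ h (w t) = inner ℂ v (U t) := by
      rw [hv, ContinuousLinearMap.adjoint_inner_left, h3]
    rw [h4]
    exact ((tendsto_const_nhds.mul (hj.inner tendsto_const_nhds)).sub
      (tendsto_const_nhds.mul (hx.inner tendsto_const_nhds))).add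
      (tendsto_const_nhds.mul (hj.inner tendsto_const_nhds))

end Density

/-! ### Distributional solutions as weak evolutions in the Lebesgue space -/

section Evolution

variable {d : ℕ} {M : Type*} [TopologicalSpace M] [ChartedSpace (Model d) M]
  [IsManifold 𝓘(ℝ, Model d) ∞ M] [CompactSpace M] [MeasurableSpace M] [BorelSpace M]

theorem secondCountableTopology_L2 (g : SmoothMetric d M) :
    SecondCountableTopology (Lp ℂ 2 (vol g)) := by
  have := isFiniteMeasure_vol g
  have := ChartedSpace.secondCountable_of_sigmaCompact (Model d) M
  have : Fact ((2 : ℝ≥0∞) ≠ ⊤) := ⟨ENNReal.ofNat_ne_top⟩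
  infer_instance

/-- The nonlinearity maps bounded sets of `H^1` to bounded sets of `L^2`, as it grows less than
`|z|^{q/2}` for some `q > 2` with `H^1 ⊆ L^q`. -/
theorem exists_nonlinearity_L2_bound (hd : 1 ≤ d) (g : SmoothMetric d M) (lam mu : ℝ) (c : ℝ≥0) :
    ∃ B : ℝ≥0, ∀ (f : M → ℂ) (η : ∀ x : M, Covec d x), HasWeakGradient g f η →
      eLpNorm f 2 (vol g) ≤ c → eLpNorm (fun x => covecNorm g x (η x)) 2 (vol g) ≤ c →
      eLpNorm (fun x => nonlinearity lam mu (f x)) 2 (vol g) ≤ B := by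
  have := isFiniteMeasure_vol g
  obtain ⟨q, hq, K, hK⟩ := exists_sobolev hd g
  have hq' : (2 : ℝ) < q := by exact_mod_cast hq
  obtain ⟨A, hA0, hA⟩ := exists_nonlinearity_bound lam mu hq'
  have h1 : eLpNorm (fun _ : M => (1 : ℝ)) 2 (vol g) ≠ ⊤ := (memLp_const (1 : ℝ)).eLpNorm_ne_top
  refine ⟨A.toNNReal * ((eLpNorm (fun _ : M => (1 : ℝ)) 2 (vol g)).toNNReal +
    (K * (c + c + 1)) ^ ((q : ℝ) / 2)), fun f η h hf hη => ?_⟩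
  have hfq : eLpNorm f q (vol g) ≤ K * (c + c + 1 : ℝ≥0) := by
    refine h.eLpNorm_le hK ((add_le_add hf hη).trans_lt ?_)
    push_cast
    exact ENNReal.lt_add_right (by finiteness) one_ne_zero
  have hq2 : (0 : ℝ) < (q : ℝ) / 2 := by positivity
  calc eLpNorm (fun x => nonlinearity lam mu (f x)) 2 (vol g)
      ≤ eLpNorm (A • ((fun _ => (1 : ℝ)) + fun x => ‖f x‖ ^ ((q : ℝ) / 2))) 2 (vol g) :=
        eLpNorm_mono_real fun x => hA (f x)
    _ = ‖A‖ₑ * eLpNorm ((fun _ => (1 : ℝ)) + fun x => ‖f x‖ ^ ((q : ℝ) / 2)) 2 (vol g) :=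
        eLpNorm_const_smul _ _ _ _
    _ ≤ ‖A‖ₑ * (eLpNorm (fun _ => (1 : ℝ)) 2 (vol g) +
          eLpNorm (fun x => ‖f x‖ ^ ((q : ℝ) / 2)) 2 (vol g)) := by
        gcongr
        exact eLpNorm_add_le aestronglyMeasurable_const
          (h.1.norm.aemeasurable.pow_const _).aestronglyMeasurable (by norm_num)
    _ = ‖A‖ₑ * (eLpNorm (fun _ => (1 : ℝ)) 2 (vol g) + eLpNorm f q (vol g) ^ ((q : ℝ) / 2)) := by
        rw [eLpNorm_norm_rpow f hq2]
        congr 4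
        rw [show (2 : ℝ≥0∞) = ENNReal.ofReal 2 by simp, ← ENNReal.ofReal_mul (by norm_num),
          mul_div_cancel₀ _ (two_ne_zero), ENNReal.ofReal_coe_nnreal]
    _ ≤ _ := by
        rw [ENNReal.coe_mul, ENNReal.coe_add, ENNReal.coe_toNNReal h1,
          ENNReal.coe_rpow_of_nonneg _ hq2.le]
        gcongr
        · rw [Real.enorm_eq_ofReal hA0]; rfl
        · exact_mod_cast hfq

/-- A distributional solution, seen as a weak solution in `L^2(M)` of `i w' - A w + (N(u) + w) = 0`,
where `A = 1 - Δ` is the operator with form `⟨·, ·⟩_{H^1}`. -/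
theorem IsDistributionalSolution.exists_evolution (hd : 1 ≤ d) {g : SmoothMetric d M}
    {lam mu T : ℝ} {u : ℝ → M → ℂ} (h : IsDistributionalSolution g lam mu T u) :
    ∃ (w n : ℝ → Lp ℂ 2 (vol g)) (C : ℝ), 0 ≤ C ∧
      AEStronglyMeasurable w (volume.restrict (Ioo 0 T)) ∧
      AEStronglyMeasurable n (volume.restrict (Ioo 0 T)) ∧
      (∀ᵐ t ∂(volume.restrict (Ioo 0 T)), (w t : M → ℂ) =ᵐ[vol g] u t) ∧
      (∀ᵐ t ∂(volume.restrict (Ioo 0 T)),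
        (n t : M → ℂ) =ᵐ[vol g] fun x => nonlinearity lam mu (u t x)) ∧
      (∀ᵐ t ∂(volume.restrict (Ioo 0 T)), ‖n t‖ ≤ C) ∧
      (∀ᵐ t ∂(volume.restrict (Ioo 0 T)), ‖w t‖ ≤ C) ∧
      (∀ᵐ t ∂(volume.restrict (Ioo 0 T)), ∃ v, ‖v‖ ≤ C ∧ sobolevToL2 g v = w t) ∧
      IsWeakEvolution (sobolevToL2 g) T w (n + w) := by
  have := isFiniteMeasure_vol g
  have := secondCountableTopology_L2 g
  obtain ⟨η, hu, heq⟩ := h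
  obtain ⟨c, hc⟩ := hu.bounded
  obtain ⟨B, hB⟩ := exists_nonlinearity_L2_bound hd g lam mu c
  set P : Measure ℝ := volume.restrict (Ioo 0 T) with hP
  have hNm := measurable_nonlinearity lam mu
  -- the values in `H^1` and the values of the nonlinear term in `L^2`
  have hex : ∀ t, ∃ U : SobolevSpace g, HasWeakGradient g (u t) (η t) →
      (sobolevToL2 g U : M → ℂ) =ᵐ[vol g] u t ∧
      (∀ ψ : SmoothFn g, inner ℂ (ψ : SobolevSpace g) U =
        inner ℂ (smoothToL2 g ψ) (sobolevToL2 g U) +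
          ∫ x, covecInner g x (η t x) (differential d ψ x) ∂(vol g)) ∧
      ‖U‖ ≤ (eLpNorm (u t) 2 (vol g)).toReal +
        (eLpNorm (fun x => covecNorm g x (η t x)) 2 (vol g)).toReal := fun t => by
    by_cases ht : HasWeakGradient g (u t) (η t)
    · obtain ⟨U, hU⟩ := ht.exists_sobolevSpace
      exact ⟨U, fun _ => hU⟩
    · exact ⟨0, fun h => absurd h ht⟩
  choose U hU using hex
  have hnex : ∀ t, ∃ n : Lp ℂ 2 (vol g),
      MemLp (fun x => nonlinearity lam mu (u t x)) 2 (vol g) →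
      (n : M → ℂ) =ᵐ[vol g] fun x => nonlinearity lam mu (u t x) := fun t => by
    by_cases ht : MemLp (fun x => nonlinearity lam mu (u t x)) 2 (vol g)
    · exact ⟨ht.toLp _, fun _ => ht.coeFn_toLp⟩
    · exact ⟨0, fun h => absurd h ht⟩
  choose n hn using hnex
  have hUC : ∀ᵐ t ∂P, ‖U t‖ ≤ c + c := by
    filter_upwards [hu.hasWeakGradient, hc] with t h1 h2
    refine (hU t h1).2.2.trans (add_le_add ?_ ?_)
    · exact ENNReal.toReal_le_coe_of_le_coe h2.1
    · exact ENNReal.toReal_le_coe_of_le_coe h2.2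
  have hwu : ∀ᵐ t ∂P, (sobolevToL2 g (U t) : M → ℂ) =ᵐ[vol g] u t := by
    filter_upwards [hu.hasWeakGradient] with t h1 using (hU t h1).1
  have hnB : ∀ᵐ t ∂P, eLpNorm (fun x => nonlinearity lam mu (u t x)) 2 (vol g) ≤ B := by
    filter_upwards [hu.hasWeakGradient, hc] with t h1 h2 using hB _ _ h1 h2.1 h2.2
  have hnu : ∀ᵐ t ∂P, (n t : M → ℂ) =ᵐ[vol g] fun x => nonlinearity lam mu (u t x) := by
    filter_upwards [hu.hasWeakGradient, hnB] with t h1 h2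
    exact hn t ⟨(hNm.comp_aemeasurable h1.1.aemeasurable).aestronglyMeasurable,
      h2.trans_lt ENNReal.coe_lt_top⟩
  have hnC : ∀ᵐ t ∂P, ‖n t‖ ≤ B := by
    filter_upwards [hnu, hnB] with t h1 h2
    rw [Lp.norm_def, eLpNorm_congr_ae h1]
    exact ENNReal.toReal_le_coe_of_le_coe h2
  have hwC : ∀ᵐ t ∂P, ‖sobolevToL2 g (U t)‖ ≤ c := by
    filter_upwards [hwu, hc] with t h1 h2
    rw [Lp.norm_def, eLpNorm_congr_ae h1]
    exact ENNReal.toReal_le_coe_of_le_coe h2.1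
  have hwm : AEStronglyMeasurable (fun t => sobolevToL2 g (U t)) P :=
    aestronglyMeasurable_of_prod hu.aestronglyMeasurable hwu
  have hnm : AEStronglyMeasurable n P :=
    aestronglyMeasurable_of_prod (u := fun t x => nonlinearity lam mu (u t x))
      (hNm.comp_aemeasurable hu.aestronglyMeasurable.aemeasurable).aestronglyMeasurable hnu
  have hin : ∀ ψ : SmoothFn g, ∀ᵐ t ∂P, inner ℂ (ψ : SobolevSpace g) (U t) =
        inner ℂ (smoothToL2 g ψ) (sobolevToL2 g (U t)) +
          ∫ x, covecInner g x (η t x) (differential d ψ x) ∂(vol g) := fun ψ => by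
    filter_upwards [hu.hasWeakGradient] with t h1 using (hU t h1).2.1 ψ
  have hcB : (0 : ℝ) ≤ c := c.2
  have hBB : (0 : ℝ) ≤ B := B.2
  have hpair : ∀ (ψ : SmoothFn g) (v : Lp ℂ 2 (vol g)) (f : M → ℂ), (v : M → ℂ) =ᵐ[vol g] f →
      inner ℂ (smoothToL2 g ψ) v = ∫ x, f x * conj (ψ x) ∂(vol g) := by
    intro ψ v f hvf
    rw [L2.inner_def]
    refine integral_congr_ae ?_
    filter_upwards [MemLp.coeFn_toLp (memLp_of_continuous g ψ.continuous 2), hvf] with x h1 h2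
    have h1' : (smoothToL2 g ψ : M → ℂ) x = ψ x := h1
    rw [h1', h2, RCLike.inner_apply]
  refine ⟨fun t => sobolevToL2 g (U t), n, c + c + B, by positivity, hwm, hnm, hwu, hnu, ?_, ?_, ?_,
    ?_⟩
  · filter_upwards [hnC] with t h1 using by linarith
  · filter_upwards [hwC] with t h1 using by linarith
  · filter_upwards [hUC] with t h1 using ⟨U t, by linarith, rfl⟩
  refine isWeakEvolution_of_denseRange (C := c + c + B) (U := U)
    (ι := fun ψ : SmoothFn g => (ψ : SobolevSpace g)) UniformSpace.Completion.denseRange_coe hwm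
    (hnm.add hwm) (fun ψ => ?_) ?_ ?_ (ae_of_all _ fun t => rfl) ?_
  · refine AEStronglyMeasurable.congr ?_ (EventuallyEq.symm (hin ψ))
    exact (aestronglyMeasurable_const.inner hwm).add
      (hu.aemeasurable_gradient ψ ψ.isSmooth).aestronglyMeasurable
  · filter_upwards [hnC, hwC] with t h1 h2
    exact (norm_add_le _ _).trans (by linarith)
  · filter_upwards [hUC] with t h1 using by linarith
  · intro φ ψ hφ hφc hφs
    rw [← heq φ ψ hφ hφc hφs ψ.isSmooth]
    refine integral_congr_ae ?_
    filter_upwards [hin ψ, hwu, hnu] with t h1 h2 h3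
    rw [h1, sobolevToL2_coe, Pi.add_apply, inner_add_right, ← hpair ψ _ _ h2, ← hpair ψ _ _ h3]
    ring

end Evolution

/-! ### The energy estimate and uniqueness -/

section Gronwall

/-- Gronwall's inequality in integral form. -/
theorem le_exp_mul_of_le_add_integral {f : ℝ → ℝ} {a k T : ℝ} (hk : 0 ≤ k)
    (hf : ContinuousOn f (Icc 0 T)) (h : ∀ t ∈ Icc 0 T, f t ≤ a + ∫ s in (0 : ℝ)..t, k * f s)
    {t : ℝ} (ht : t ∈ Icc 0 T) : f t ≤ Real.exp (k * t) * a := by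
  have hT : 0 ≤ T := ht.1.trans ht.2
  let F : ℝ → ℝ := IccExtend hT (domRestrict (Icc 0 T) f)
  have hFc : Continuous F := (continuousOn_iff_continuous_domRestrict.1 hf).Icc_extend'
  have hFf : ∀ s ∈ Icc 0 T, F s = f s := fun s hs => by
    simp only [F, IccExtend_of_mem hT _ hs, domRestrict_apply]
  let G : ℝ → ℝ := fun t => a + ∫ s in (0 : ℝ)..t, k * F s
  have hG : ∀ t, HasDerivAt G (k * F t) t := fun t =>
    ((continuous_const.mul hFc).integral_hasStrictDerivAt 0 t).hasDerivAt.const_add a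
  have hfG : ∀ t ∈ Icc 0 T, F t ≤ G t := fun t ht => by
    rw [hFf t ht]
    refine (h t ht).trans (le_of_eq ?_)
    simp only [G]
    congr 1
    refine intervalIntegral.integral_congr fun s hs => ?_
    rw [uIcc_of_le ht.1] at hs
    simp only [hFf s ⟨hs.1, hs.2.trans ht.2⟩]
  have hE : ∀ t, HasDerivAt (fun t => Real.exp (-(k * t)) * G t)
      (Real.exp (-(k * t)) * (-k) * G t + Real.exp (-(k * t)) * (k * F t)) t := fun t =>
    (by simpa using ((hasDerivAt_id t).const_mul k).neg.exp : HasDerivAt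
      (fun t => Real.exp (-(k * t))) (Real.exp (-(k * t)) * (-k)) t).mul (hG t)
  -- `e^{-kt} (a + ∫ k f)` is nonincreasing
  have hanti : AntitoneOn (fun t => Real.exp (-(k * t)) * G t) (Icc 0 T) := by
    refine antitoneOn_of_deriv_nonpos (convex_Icc 0 T)
      (fun t _ => (hE t).continuousAt.continuousWithinAt)
      (fun t _ => (hE t).differentiableAt.differentiableWithinAt) fun t ht' => ?_
    rw [interior_Icc] at ht'
    rw [(hE t).deriv]
    have := mul_le_mul_of_nonneg_left (hfG t (Ioo_subset_Icc_self ht'))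
      (mul_nonneg (Real.exp_nonneg (-(k * t))) hk)
    nlinarith
  have h1 := hanti (left_mem_Icc.2 hT) ht ht.1
  simp only [G, mul_zero, neg_zero, Real.exp_zero, one_mul, intervalIntegral.integral_same,
    add_zero] at h1
  have h2 := hfG t ht
  rw [hFf t ht] at h2
  refine h2.trans ?_
  have h3 := mul_le_mul_of_nonneg_left h1 (Real.exp_nonneg (k * t))
  rw [← mul_assoc, ← Real.exp_add, add_neg_cancel, Real.exp_zero, one_mul] at h3
  exact h3

end Gronwall

section Difference

variable {H V : Type*} [NormedAddCommGroup H] [InnerProductSpace ℂ H] [CompleteSpace H]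
  [NormedAddCommGroup V] [InnerProductSpace ℂ V] [CompleteSpace V]

theorem integrableOn_weak_integrand {j : V →L[ℂ] H} {T C : ℝ} {w m : ℝ → H}
    (hw : AEStronglyMeasurable w (volume.restrict (Ioo 0 T)))
    (hm : AEStronglyMeasurable m (volume.restrict (Ioo 0 T)))
    (hwC : ∀ᵐ t ∂(volume.restrict (Ioo 0 T)), ‖w t‖ ≤ C)
    (hmC : ∀ᵐ t ∂(volume.restrict (Ioo 0 T)), ‖m t‖ ≤ C) {φ : ℝ → ℝ} (hφ : ContDiff ℝ ∞ φ)
    (h : H) :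
    IntegrableOn (fun t => -Complex.I * ((deriv φ t : ℝ) : ℂ) * inner ℂ (smoothing j h) (w t)
      - (φ t : ℂ) * inner ℂ h (w t) + (φ t : ℂ) * inner ℂ (smoothing j h) (m t)) (Ioo 0 T) := by
  have hφ' : Continuous (deriv φ) := hφ.continuous_deriv (by simp)
  have key : ∀ {a : ℝ → ℂ} (x : H) {y : ℝ → H}, Continuous a →
      AEStronglyMeasurable y (volume.restrict (Ioo 0 T)) →
      (∀ᵐ t ∂(volume.restrict (Ioo 0 T)), ‖y t‖ ≤ C) →
      IntegrableOn (fun t => a t * inner ℂ x (y t)) (Ioo 0 T) := by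
    intro a x y ha hy hyC
    have hc : IntegrableOn (fun t => ‖a t‖ * (‖x‖ * C)) (Ioo 0 T) :=
      (((ha.norm).mul continuous_const).continuousOn.integrableOn_Icc).mono_set Ioo_subset_Icc_self
    refine Integrable.mono' hc
      (ha.aestronglyMeasurable.mul (aestronglyMeasurable_const.inner hy)) ?_
    filter_upwards [hyC] with t ht
    rw [norm_mul]
    gcongr
    exact (norm_inner_le_norm _ _).trans (mul_le_mul_of_nonneg_left ht (norm_nonneg _))
  exact ((key _ (continuous_const.mul (Complex.continuous_ofReal.comp hφ')) hw hwC).sub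
    (key _ (Complex.continuous_ofReal.comp hφ.continuous) hw hwC)).add
    (key _ (Complex.continuous_ofReal.comp hφ.continuous) hm hmC)

theorem IsWeakEvolution.sub {j : V →L[ℂ] H} {T C : ℝ} {w₁ m₁ w₂ m₂ : ℝ → H}
    (hw₁ : AEStronglyMeasurable w₁ (volume.restrict (Ioo 0 T)))
    (hm₁ : AEStronglyMeasurable m₁ (volume.restrict (Ioo 0 T)))
    (hw₁C : ∀ᵐ t ∂(volume.restrict (Ioo 0 T)), ‖w₁ t‖ ≤ C)
    (hm₁C : ∀ᵐ t ∂(volume.restrict (Ioo 0 T)), ‖m₁ t‖ ≤ C)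
    (hw₂ : AEStronglyMeasurable w₂ (volume.restrict (Ioo 0 T)))
    (hm₂ : AEStronglyMeasurable m₂ (volume.restrict (Ioo 0 T)))
    (hw₂C : ∀ᵐ t ∂(volume.restrict (Ioo 0 T)), ‖w₂ t‖ ≤ C)
    (hm₂C : ∀ᵐ t ∂(volume.restrict (Ioo 0 T)), ‖m₂ t‖ ≤ C)
    (h₁ : IsWeakEvolution j T w₁ m₁) (h₂ : IsWeakEvolution j T w₂ m₂) :
    IsWeakEvolution j T (w₁ - w₂) (m₁ - m₂) := by
  intro φ h hφ hφc hφs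
  have h3 := integral_sub (integrableOn_weak_integrand (j := j) hw₁ hm₁ hw₁C hm₁C hφ h)
    (integrableOn_weak_integrand (j := j) hw₂ hm₂ hw₂C hm₂C hφ h)
  rw [h₁ φ h hφ hφc hφs, h₂ φ h hφ hφc hφs, sub_zero] at h3
  rw [← h3]
  refine integral_congr_ae (ae_of_all _ fun t => ?_)
  simp only [Pi.sub_apply, inner_sub_right]
  ring

end Difference

section Uniqueness

variable {d : ℕ} {M : Type*} [TopologicalSpace M] [ChartedSpace (Model d) M]
  [IsManifold 𝓘(ℝ, Model d) ∞ M] [CompactSpace M] [MeasurableSpace M] [BorelSpace M]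

theorem IsDistributionalSolution.exists_isContinuousVersion (hd : 1 ≤ d) {g : SmoothMetric d M}
    {lam mu T : ℝ} (hT : 0 < T) {u : ℝ → M → ℂ} (h : IsDistributionalSolution g lam mu T u) :
    ∃ U, IsContinuousVersion g T u U := by
  obtain ⟨w, n, C, hC0, hw, hn, hwu, -, hnC, hwC, hW, heq⟩ := h.exists_evolution hd
  obtain ⟨Y, hY, hYw, -⟩ := exists_continuous_version_energy hT (C := C + C) (by positivity) hw
    (hn.add hw) (by
      filter_upwards [hnC, hwC] with t h1 h2
      exact (norm_add_le _ _).trans (add_le_add h1 h2)) (by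
      filter_upwards [hW] with t ⟨v, hv, hvw⟩
      exact ⟨v, by linarith, hvw⟩) heq
  refine ⟨Y, hY, ?_⟩
  filter_upwards [hYw, hwu] with t h1 h2
  rwa [h1]

omit [CompactSpace M] [BorelSpace M] in
/-- The dissipativity of the nonlinearity, integrated over `M`. -/
theorem re_inner_nonlinearity_le {g : SmoothMetric d M} {lam mu : ℝ} (hlam : 0 ≤ lam)
    {w₁ w₂ n₁ n₂ : Lp ℂ 2 (vol g)} {f₁ f₂ : M → ℂ} (hw₁ : (w₁ : M → ℂ) =ᵐ[vol g] f₁)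
    (hw₂ : (w₂ : M → ℂ) =ᵐ[vol g] f₂)
    (hn₁ : (n₁ : M → ℂ) =ᵐ[vol g] fun x => nonlinearity lam mu (f₁ x))
    (hn₂ : (n₂ : M → ℂ) =ᵐ[vol g] fun x => nonlinearity lam mu (f₂ x)) :
    (inner ℂ (w₁ - w₂) (Complex.I • (n₁ - n₂))).re ≤ |mu| * ‖w₁ - w₂‖ ^ 2 := by
  have h1 : |mu| * ‖w₁ - w₂‖ ^ 2 = ∫ x, |mu| * ‖(w₁ - w₂) x‖ ^ 2 ∂(vol g) := by
    rw [integral_const_mul, @norm_sq_eq_re_inner ℂ, L2.inner_def]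
    congr 1
    rw [← integral_re (L2.integrable_inner _ _)]
    refine integral_congr_ae (ae_of_all _ fun x => ?_)
    exact (norm_sq_eq_re_inner (𝕜 := ℂ) _).symm
  have h2 : (inner ℂ (w₁ - w₂) (Complex.I • (n₁ - n₂))).re =
      ∫ x, (inner ℂ ((w₁ - w₂) x) ((Complex.I • (n₁ - n₂)) x)).re ∂(vol g) := by
    rw [L2.inner_def]
    exact (integral_re (L2.integrable_inner (𝕜 := ℂ) (w₁ - w₂) (Complex.I • (n₁ - n₂)))).symm
  rw [h1, h2]
  refine integral_mono_ae (L2.integrable_inner (𝕜 := ℂ) (w₁ - w₂) (Complex.I • (n₁ - n₂))).re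
    (((Lp.memLp (w₁ - w₂)).integrable_norm_pow two_ne_zero).const_mul _) ?_
  filter_upwards [hw₁, hw₂, hn₁, hn₂, Lp.coeFn_sub w₁ w₂, Lp.coeFn_sub n₁ n₂,
    Lp.coeFn_smul Complex.I (n₁ - n₂)] with x h1 h2 h3 h4 h5 h6 h7
  simp only [h5, h7, Pi.sub_apply, Pi.smul_apply, h6, h1, h2, h3, h4, smul_eq_mul,
    RCLike.inner_apply]
  rw [mul_comm]
  exact nonlinearity_dissipative hlam mu (f₁ x) (f₂ x)

theorem norm_sub_le_of_isContinuousVersion (hd : 1 ≤ d) {g : SmoothMetric d M} {lam mu T : ℝ}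
    (hlam : 0 ≤ lam) (hT : 0 < T) {u₁ u₂ : ℝ → M → ℂ} (h₁ : IsDistributionalSolution g lam mu T u₁)
    (h₂ : IsDistributionalSolution g lam mu T u₂) {U₁ U₂ : ℝ → Lp ℂ 2 (vol g)}
    (hU₁ : IsContinuousVersion g T u₁ U₁) (hU₂ : IsContinuousVersion g T u₂ U₂) :
    ∀ t ∈ Icc 0 T, ‖U₁ t - U₂ t‖ ≤ Real.exp (|mu| * t) * ‖U₁ 0 - U₂ 0‖ := by
  obtain ⟨w₁, n₁, C₁, hC₁, hw₁, hn₁, hwu₁, hnu₁, hnC₁, hwC₁, hW₁, heq₁⟩ := h₁.exists_evolution hd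
  obtain ⟨w₂, n₂, C₂, hC₂, hw₂, hn₂, hwu₂, hnu₂, hnC₂, hwC₂, hW₂, heq₂⟩ := h₂.exists_evolution hd
  set C := (C₁ + C₁) + (C₂ + C₂) with hC
  have hC0 : 0 ≤ C := by positivity
  have heq := IsWeakEvolution.sub (C := C) hw₁ (hn₁.add hw₁)
    (by filter_upwards [hwC₁] with t h using by linarith)
    (by filter_upwards [hwC₁, hnC₁] with t h h' using (norm_add_le _ _).trans (by linarith))
    hw₂ (hn₂.add hw₂) (by filter_upwards [hwC₂] with t h using by linarith)
    (by filter_upwards [hwC₂, hnC₂] with t h h' using (norm_add_le _ _).trans (by linarith))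
    heq₁ heq₂
  have hmC : ∀ᵐ t ∂(volume.restrict (Ioo 0 T)), ‖(n₁ + w₁ - (n₂ + w₂)) t‖ ≤ C := by
    filter_upwards [hwC₁, hnC₁, hwC₂, hnC₂] with t h1 h2 h3 h4
    exact (norm_sub_le _ _).trans (add_le_add ((norm_add_le _ _).trans (add_le_add h2 h1))
      ((norm_add_le _ _).trans (add_le_add h4 h3)))
  have hwC : ∀ᵐ t ∂(volume.restrict (Ioo 0 T)), ‖(w₁ - w₂) t‖ ≤ C := by
    filter_upwards [hwC₁, hwC₂] with t h1 h2
    exact (norm_sub_le _ _).trans (by linarith)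
  obtain ⟨Y, hY, hYw, hen⟩ := exists_continuous_version_energy hT hC0 (hw₁.sub hw₂)
    ((hn₁.add hw₁).sub (hn₂.add hw₂)) hmC (by
      filter_upwards [hW₁, hW₂] with t ⟨v₁, hv₁, e₁⟩ ⟨v₂, hv₂, e₂⟩
      exact ⟨v₁ - v₂, (norm_sub_le _ _).trans (by linarith), by rw [map_sub, e₁, e₂, Pi.sub_apply]⟩)
      heq
  have hYU : ∀ t ∈ Icc 0 T, Y t = U₁ t - U₂ t := fun t ht => by
    have h := le_on_Icc_of_ae_le (f := fun t => ‖Y t - (U₁ t - U₂ t)‖) (c := 0) hT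
      (hY.sub (hU₁.1.sub hU₂.1)).norm (by
        filter_upwards [hYw, hwu₁, hwu₂, hU₁.2, hU₂.2] with t h1 h2 h3 h4 h5
        have e1 : w₁ t = U₁ t := Lp.ext (h2.trans h4.symm)
        have e2 : w₂ t = U₂ t := Lp.ext (h3.trans h5.symm)
        rw [h1, Pi.sub_apply, e1, e2, sub_self, norm_zero]) t ht
    exact sub_eq_zero.1 (norm_le_zero_iff.1 h)
  -- the energy inequality
  have hle : ∀ᵐ t ∂(volume.restrict (Ioo 0 T)),
      2 * (inner ℂ ((w₁ - w₂) t) (Complex.I • (n₁ + w₁ - (n₂ + w₂)) t)).re ≤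
        2 * |mu| * ‖Y t‖ ^ 2 := by
    filter_upwards [hYw, hwu₁, hwu₂, hnu₁, hnu₂] with t h1 h2 h3 h4 h5
    have e1 := re_inner_nonlinearity_le hlam h2 h3 h4 h5
    -- the summand `w` of `m = N + w` does not contribute
    have e2 : (inner ℂ (w₁ t - w₂ t) (Complex.I • (w₁ t - w₂ t))).re = 0 := by
      rw [inner_smul_right, inner_self_eq_norm_sq_to_K]
      simp [← Complex.ofReal_pow]
    rw [h1]
    simp only [Pi.sub_apply, Pi.add_apply]
    rw [show n₁ t + w₁ t - (n₂ t + w₂ t) = (n₁ t - n₂ t) + (w₁ t - w₂ t) by abel, smul_add,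
      inner_add_right, Complex.add_re, e2, add_zero]
    linarith
  have hI : IntegrableOn (fun s => 2 * (inner ℂ ((w₁ - w₂) s)
      (Complex.I • (n₁ + w₁ - (n₂ + w₂)) s)).re) (Ioo 0 T) := by
    refine Integrable.of_bound ?_ (2 * (C * C)) ?_
    · exact (Complex.continuous_re.comp_aestronglyMeasurable ((hw₁.sub hw₂).inner
        (((hn₁.add hw₁).sub (hn₂.add hw₂)).const_smul Complex.I))).const_mul 2
    · filter_upwards [hwC, hmC] with t h1 h2
      rw [norm_mul, Real.norm_ofNat]
      gcongr
      refine (Complex.abs_re_le_norm _).trans ((norm_inner_le_norm _ _).trans ?_)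
      rw [norm_smul, Complex.norm_I, one_mul]
      exact mul_le_mul h1 h2 (norm_nonneg _) hC0
  have hgr : ∀ t ∈ Icc 0 T, ‖Y t‖ ^ 2 ≤ ‖Y 0‖ ^ 2 + ∫ s in (0 : ℝ)..t, 2 * |mu| * ‖Y s‖ ^ 2 := by
    intro t ht
    have h := hen 0 (left_mem_Icc.2 hT.le) t ht ht.1
    have hi : IntervalIntegrable (fun s => 2 * |mu| * ‖Y s‖ ^ 2) volume 0 t := by
      refine ContinuousOn.intervalIntegrable ?_
      rw [uIcc_of_le ht.1]
      exact continuousOn_const.mul ((hY.norm.pow 2).mono (Icc_subset_Icc_right ht.2))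
    have hm : ∫ s in (0 : ℝ)..t, 2 * (inner ℂ ((w₁ - w₂) s)
        (Complex.I • (n₁ + w₁ - (n₂ + w₂)) s)).re ≤ ∫ s in (0 : ℝ)..t, 2 * |mu| * ‖Y s‖ ^ 2 := by
      refine intervalIntegral.integral_mono_ae_restrict ht.1
        ((intervalIntegrable_iff_integrableOn_Ioo_of_le ht.1).2
          (hI.mono_set (Ioo_subset_Ioo_right ht.2))) hi ?_
      rw [← Measure.restrict_congr_set Ioo_ae_eq_Icc]
      exact ae_restrict_of_ae_restrict_of_subset (Ioo_subset_Ioo_right ht.2) hle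
    linarith
  intro t ht
  have h1 := le_exp_mul_of_le_add_integral (f := fun t => ‖Y t‖ ^ 2) (k := 2 * |mu|) (by positivity)
    (hY.norm.pow 2) hgr ht
  rw [← hYU t ht, ← hYU 0 (left_mem_Icc.2 hT.le)]
  refine abs_le_of_sq_le_sq' ?_ (by positivity) |>.2
  rw [mul_pow, ← Real.exp_nat_mul]
  refine h1.trans (le_of_eq ?_)
  push_cast
  ring_nf

/-- Joint measurability turns the equality of almost all sections into equality almost everywhere
on the product. -/
theorem ae_eq_prod_of_ae_ae_eq {α β E : Type*} [MeasurableSpace α] [MeasurableSpace β]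
    [NormedAddCommGroup E] {μ : Measure α} {ν : Measure β} [SFinite ν] {u₁ u₂ : α → β → E}
    (hu₁ : AEStronglyMeasurable (fun p : α × β => u₁ p.1 p.2) (μ.prod ν))
    (hu₂ : AEStronglyMeasurable (fun p : α × β => u₂ p.1 p.2) (μ.prod ν))
    (h : ∀ᵐ t ∂μ, u₁ t =ᵐ[ν] u₂ t) :
    (fun p : α × β => u₁ p.1 p.2) =ᵐ[μ.prod ν] fun p => u₂ p.1 p.2 := by
  have h1 : hu₁.mk =ᵐ[μ.prod ν] hu₂.mk := by
    refine (Measure.ae_prod_iff_ae_ae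
      (hu₁.stronglyMeasurable_mk.measurableSet_eq_fun hu₂.stronglyMeasurable_mk)).2 ?_
    filter_upwards [h, Measure.ae_ae_of_ae_prod hu₁.ae_eq_mk, Measure.ae_ae_of_ae_prod hu₂.ae_eq_mk]
      with t e0 e1 e2
    filter_upwards [e0, e1, e2] with x f0 f1 f2
    rw [← f1, ← f2, f0]
  exact hu₁.ae_eq_mk.trans (h1.trans hu₂.ae_eq_mk.symm)

end Uniqueness

end ZetaLogNLS

theorem mainTheorem4 {d : ℕ} (hd : 1 ≤ d) {M : Type*} [TopologicalSpace M] [T2Space M]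
    [CompactSpace M] [ChartedSpace (ZetaLogNLS.Model d) M]
    [IsManifold 𝓘(ℝ, ZetaLogNLS.Model d) ∞ M] [MeasurableSpace M] [BorelSpace M]
    (g : ZetaLogNLS.SmoothMetric d M) (lam mu T : ℝ) (hlam : 0 < lam) (hT : 0 < T)
    (u₁ u₂ : ℝ → M → ℂ)
    (h₁ : ZetaLogNLS.IsDistributionalSolution g lam mu T u₁)
    (h₂ : ZetaLogNLS.IsDistributionalSolution g lam mu T u₂) :
    (∃ U₁, ZetaLogNLS.IsContinuousVersion g T u₁ U₁) ∧
    (∃ U₂, ZetaLogNLS.IsContinuousVersion g T u₂ U₂) ∧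
    ∀ U₁ U₂, ZetaLogNLS.IsContinuousVersion g T u₁ U₁ →
      ZetaLogNLS.IsContinuousVersion g T u₂ U₂ →
      (∀ t ∈ Icc 0 T, ‖U₁ t - U₂ t‖ ≤ Real.exp (|mu| * t) * ‖U₁ 0 - U₂ 0‖) ∧
      (U₁ 0 = U₂ 0 →
        (∀ t ∈ Icc 0 T, U₁ t = U₂ t) ∧
        (fun p : ℝ × M => u₁ p.1 p.2) =ᵐ[(volume.restrict (Ioo 0 T)).prod (ZetaLogNLS.vol g)]
          (fun p : ℝ × M => u₂ p.1 p.2)) := by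
  refine ⟨h₁.exists_isContinuousVersion hd hT, h₂.exists_isContinuousVersion hd hT,
    fun U₁ U₂ hU₁ hU₂ => ?_⟩
  have hmain := ZetaLogNLS.norm_sub_le_of_isContinuousVersion hd hlam.le hT h₁ h₂ hU₁ hU₂
  refine ⟨hmain, fun h0 => ?_⟩
  have heq : ∀ t ∈ Icc 0 T, U₁ t = U₂ t := fun t ht => by
    have h := hmain t ht
    rw [h0, sub_self, norm_zero, mul_zero] at h
    exact sub_eq_zero.1 (norm_le_zero_iff.1 h)
  have := ZetaLogNLS.isFiniteMeasure_vol g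
  obtain ⟨η₁, hη₁, -⟩ := h₁
  obtain ⟨η₂, hη₂, -⟩ := h₂
  refine ⟨heq, ZetaLogNLS.ae_eq_prod_of_ae_ae_eq hη₁.aestronglyMeasurable
    hη₂.aestronglyMeasurable ?_⟩
  filter_upwards [hU₁.2, hU₂.2, ae_restrict_mem measurableSet_Ioo] with t e₁ e₂ ht
  rw [heq t (Ioo_subset_Icc_self ht)] at e₁
  exact e₁.symm.trans e₂
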